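/- Let $n\ge 0$ and let $B_{n+1}$ be the Coxeter group of type $B$ and rank $n+1$, with generators $t,s_1,\dots,s_n$ and relations $t^2=s_i^2=1$, $s_is_{i+1}s_i=s_{i+1}s_is_{i+1}$, $s_is_j=s_js_i$ for $|i-j|>1$, $ts_1ts_1=s_1ts_1t$, and $ts_i=s_it$ for $i\ge 2$. Let $\{\xi_1,\xi_2\}=\{1,-1\}$, ordered arbitrarily. Let $\lambda^{(2)}$ be a $2$-partition (an ordered pair of Young diagrams with $n+1$ nodes in total), and let $\mathcal T$ be a standard $2$-tableau of shape $\lambda^{(2)}$, that is, a filling of the nodes by $1,\dots,n+1$, each used once, that increases along rows and down columns of both diagrams. If $i$ stands in row $x$ and column $y$ of the $k$-th diagram, put $c_i=y-x$ and $p_i=\xi_k$. Let $f_{\lambda^{(2)}}$ be the inverse of the product of the hook lengths of all nodes of both diagrams. Let $V=\bigoplus_{\mu^{(2)}}V_{\mu^{(2)}}$ be the sum of Young's seminormal representations over all $2$-partitions of $n+1$. It has a basis $(e_{\mathcal S})$ indexed by the standard $2$-tableaux with $n+1$ nodes. The generators act, with $p_i$, $c_i$ and $d=\delta_{p_i,p_{i+1}}/(c_{i+1}-c_i)$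 taken for $\mathcal S$ (and $d=0$ if $p_i\neq p_{i+1}$), by $t\,e_{\mathcal S}=p_1e_{\mathcal S}$ and $s_i\,e_{\mathcal S}=d\,e_{\mathcal S}+(1+d)\,e_{s_i\mathcal S}$. Here $s_i\mathcal S$ is $\mathcal S$ with $i$ and $i+1$ exchanged, and $e_{s_i\mathcal S}:=0$ if this is not standard. Then there is exactly one element $E_{\mathcal T}\in\mathbb C B_{n+1}$ that acts on $V$ by $E_{\mathcal T}e_{\mathcal S}=\delta_{\mathcal S,\mathcal T}\,e_{\mathcal S}$, and it is a primitive idempotent. Put $$\mathbf s_i(p,p',a,a')=s_i+\frac{\delta_{p,p'}}{a-a'},\qquad \mathbf t(p)=\tfrac12(1+pt),$$ $$\phi_{k+1}(v_1,\dots,v_k,v,u_1,\dots,u_k,u)=\mathbf s_k(v,v_k,u,u_k)\cdots\mathbf s_1(v,v_1,u,u_1)\,\mathbf t(v)\,s_1\cdots s_k\quad(0\le k\le n),$$ $$\Phi(v_1,\dots,v_{n+1},u_1,\dots,u_{n+1})=\prod_{k=0,\dots,n}^{\leftarrow}\phi_{k+1}(v_1,\dots,v_{k+1},u_1,\dots,u_{k+1}),$$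 with the factors in descending order of $k$. Thus, for fixed numbers $v_i$, $\Phi$ is a rational function of $u_1,\dots,u_{n+1}$ with values in $\mathbb C B_{n+1}$. Then $$E_{\mathcal T}=f_{\lambda^{(2)}}\,\Phi(v_1,\dots,v_{n+1},u_1,\dots,u_{n+1})\Big|_{v_i=p_i,\ i=1,\dots,n+1}\Big|_{u_1=c_1}\cdots\Big|_{u_n=c_n}\Big|_{u_{n+1}=c_{n+1}},$$ where the evaluations at $u_1=c_1,\dots,u_{n+1}=c_{n+1}$ are done consecutively in this order, and the rational function obtained at each step is non-singular at the next evaluation. Moreover, for any numbers $v_1,\dots,v_{n+1}$, the product defining $\Phi$ is a reduced word for the longest element of $B_{n+1}$ in which some letters $s_i$ are replaced by elements $\mathbf s_i(v_k,v_l,u_k,u_l)$ with $l<k$, and some letters $t$ by elements $\mathbf t(v_k)$. -/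

import Mathlib

namespace FusionB

noncomputable section

/-! ### The hyperoctahedral group -/

/-- The Coxeter matrix of type `B` and rank `n + 1`, with nodes numbered so that `0` is the end of
the diagram carrying the edge of order `4`. Node `0` is the generator `t`, and node `i.succ`, for
`i : Fin n`, is the generator `s_{i+1}` (that is, `s_1, …, s_n` are the nodes `1, …, n`). -/
def matrixB (n : ℕ) : CoxeterMatrix (Fin (n + 1)) :=
  (CoxeterMatrix.B (n + 1)).reindex Fin.revPerm

/-- The Coxeter group `B_{n+1}`, generated by `t, s_1, …, s_n`. -/
abbrev GroupB (n : ℕ) : Type := (matrixB n).Group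

/-- `B_{n+1}` with its Coxeter generators. -/
abbrev coxB (n : ℕ) : CoxeterSystem (matrixB n) (GroupB n) := (matrixB n).toCoxeterSystem

/-- A Coxeter generator, as an element of the group algebra over `K`. -/
def gen (K : Type) [Field K] {n : ℕ} (b : Fin (n + 1)) : MonoidAlgebra K (GroupB n) :=
  MonoidAlgebra.of K (GroupB n) ((coxB n).simple b)

/-- The generator `t`. -/
def genT (K : Type) [Field K] (n : ℕ) : MonoidAlgebra K (GroupB n) := gen K 0

/-- The generator `s_{i+1}`, for `i : Fin n` counted from `0`. -/
def genS (K : Type) [Field K] {n : ℕ} (i : Fin n) : MonoidAlgebra K (GroupB n) := gen K i.succ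

/-! ### Standard 2-tableaux -/

/-- The set of 2-nodes of a 2-partition: triples (position, (row, column)). -/
abbrev Node (shape : Fin 2 → YoungDiagram) : Type :=
  {x : Fin 2 × ℕ × ℕ // x.2 ∈ shape x.1}

/-- A standard 2-tableau of length `m`: a 2-partition, together with a numbering of its 2-nodes by
`Fin m` that increases along the rows and down the columns of both diagrams. -/
structure StandardTableau (m : ℕ) where
  /-- the underlying 2-partition -/
  shape : Fin 2 → YoungDiagram
  /-- `node a` is the 2-node that carries the number `a` -/
  node : Fin m ≃ Node shape
  /-- numbers increase along rows -/
  row_lt : ∀ a b : Fin m, (node a).1.1 = (node b).1.1 → (node a).1.2.1 = (node b).1.2.1 →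
    (node a).1.2.2 < (node b).1.2.2 → a < b
  /-- numbers increase down columns -/
  col_lt : ∀ a b : Fin m, (node a).1.1 = (node b).1.1 → (node a).1.2.2 = (node b).1.2.2 →
    (node a).1.2.1 < (node b).1.2.1 → a < b

namespace StandardTableau

/-- The content `c(T|a)` (column minus row) of the node with number `a`. -/
def content {m : ℕ} (T : StandardTableau m) (a : Fin m) : ℂ :=
  ((T.node a).1.2.2 : ℂ) - ((T.node a).1.2.1 : ℂ)

/-- `p(T|a) = ξ_k`, where `k` is the position of the node with number `a`. -/
def pos {m : ℕ} (ξ : Fin 2 → ℂ) (T : StandardTableau m) (a : Fin m) : ℂ := ξ (T.node a).1.1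

/-- `S` is obtained from `T` by exchanging the consecutive numbers `i` and `i + 1`. -/
def IsSwap {n : ℕ} (i : Fin n) (T S : StandardTableau (n + 1)) : Prop :=
  ∀ a : Fin (n + 1), (S.node a).1 = (T.node (Equiv.swap i.castSucc i.succ a)).1

end StandardTableau

/-- The hook length of the node `α` of `μ`: the number of nodes of `μ` in the row of `α` weakly to
the right of `α`, or in its column weakly below it. -/
def hookLength (μ : YoungDiagram) (α : ℕ × ℕ) : ℕ :=
  (μ.cells.filter fun β => (β.1 = α.1 ∧ α.2 ≤ β.2) ∨ (β.2 = α.2 ∧ α.1 ≤ β.1)).card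

/-- `f`: the inverse of the product of all hook lengths of a 2-partition. -/
def hookFactor (shape : Fin 2 → YoungDiagram) : ℂ :=
  (∏ k : Fin 2, ∏ α ∈ (shape k).cells, (hookLength (shape k) α : ℂ))⁻¹

/-! ### The seminormal basis and its diagonal matrix units -/

/-- The direct sum, over all 2-partitions of `n + 1`, of the vector spaces with basis the standard
2-tableaux of that shape. -/
abbrev TableauSpace (n : ℕ) : Type := StandardTableau (n + 1) →₀ ℂ

/-- The seminormal basis vector of a standard 2-tableau. -/
def basisVec {n : ℕ} (T : StandardTableau (n + 1)) : TableauSpace n := Finsupp.single T 1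

/-- The diagonal coefficient of `s_{i+1}` at `T` in the seminormal form. -/
def diagCoeff {n : ℕ} (ξ : Fin 2 → ℂ) (i : Fin n) (T : StandardTableau (n + 1)) : ℂ :=
  open Classical in
  if T.pos ξ i.castSucc = T.pos ξ i.succ then 1 / (T.content i.succ - T.content i.castSucc) else 0

/-- `ρ` is Young's seminormal form of the irreducible representations of `B_{n+1}`, all shapes taken
together (the formulas preserve the shape of a tableau). As the generators generate the group,
there is at most one such `ρ`. -/
structure IsSeminormal {n : ℕ} (ξ : Fin 2 → ℂ)
    (ρ : MonoidAlgebra ℂ (GroupB n) →ₐ[ℂ] Module.End ℂ (TableauSpace n)) : Prop where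
  t_apply : ∀ T, ρ (genT ℂ n) (basisVec T) = T.pos ξ 0 • basisVec T
  s_apply : ∀ (i : Fin n) (T S : StandardTableau (n + 1)), T.IsSwap i S →
    ρ (genS ℂ i) (basisVec T) =
      diagCoeff ξ i T • basisVec T + (1 + diagCoeff ξ i T) • basisVec S
  s_apply_of_not : ∀ (i : Fin n) (T : StandardTableau (n + 1)),
    (¬ ∃ S : StandardTableau (n + 1), T.IsSwap i S) →
    ρ (genS ℂ i) (basisVec T) = diagCoeff ξ i T • basisVec T

/-- `E = E_T`: the element of `ℂ B_{n+1}` that acts as the diagonal matrix unit of `T` with respect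
to the seminormal bases (thus by zero in the irreducible representations of all other shapes). -/
def IsTableauIdempotent {n : ℕ} (ξ : Fin 2 → ℂ) (T : StandardTableau (n + 1))
    (E : MonoidAlgebra ℂ (GroupB n)) : Prop :=
  ∃ ρ : MonoidAlgebra ℂ (GroupB n) →ₐ[ℂ] Module.End ℂ (TableauSpace n), IsSeminormal ξ ρ ∧
    ρ E (basisVec T) = basisVec T ∧ ∀ S, S ≠ T → ρ E (basisVec S) = 0

/-- A primitive idempotent: a nonzero idempotent that is not the sum of two nonzero orthogonal
idempotents. -/
def IsPrimitiveIdempotent {A : Type} [Ring A] (e : A) : Prop :=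
  e ≠ 0 ∧ IsIdempotentElem e ∧ ∀ a b : A, IsIdempotentElem a → IsIdempotentElem b →
    a * b = 0 → b * a = 0 → a + b = e → a = 0 ∨ b = 0

/-! ### The rational function `Φ` -/

/-- The element `s_{i+1}(p, p', a, a') = s_{i+1} + δ_{p,p'} / (a - a')`. -/
def baxtS {K : Type} [Field K] {n : ℕ} (i : Fin n) (p p' : ℂ) (a a' : K) :
    MonoidAlgebra K (GroupB n) :=
  open Classical in
  genS K i + algebraMap K (MonoidAlgebra K (GroupB n)) (if p = p' then 1 / (a - a') else 0)

/-- The element `t(p) = (1 + p t) / 2`. -/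
def baxtT (K : Type) [Field K] [Algebra ℂ K] (n : ℕ) (p : ℂ) : MonoidAlgebra K (GroupB n) :=
  (1 / 2 : K) • (1 + algebraMap ℂ K p • genT K n)

/-- `phi v u v' u' k` is
`φ_{k+1}(v_1, …, v_k, v', u_1, …, u_k, u')`, for `k = 0, …, n` (entries of `v`, `u` are numbered
from `0`). -/
def phi {K : Type} [Field K] [Algebra ℂ K] {n : ℕ} (v : Fin (n + 1) → ℂ) (u : Fin (n + 1) → K)
    (v' : ℂ) (u' : K) (k : Fin (n + 1)) : MonoidAlgebra K (GroupB n) :=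
  Fin.induction (motive := fun _ => MonoidAlgebra K (GroupB n)) (baxtT K n v')
    (fun i x => baxtS i v' (v i.castSucc) u' (u i.castSucc) * x * genS K i) k

/-- `Φ(v_1, …, v_{n+1}, u_1, …, u_{n+1}) = φ_{n+1} φ_n ⋯ φ_1`. -/
def Phi {K : Type} [Field K] [Algebra ℂ K] {n : ℕ} (v : Fin (n + 1) → ℂ) (u : Fin (n + 1) → K) :
    MonoidAlgebra K (GroupB n) :=
  (List.ofFn fun k : Fin (n + 1) => phi v u (v k) (u k) k).reverse.prod

/-! ### Evaluation of rational functions -/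

/-- The field `ℂ(u_1, …, u_m)` of rational functions. -/
abbrev RatFun (m : ℕ) : Type := FractionRing (MvPolynomial (Fin m) ℂ)

/-- The variable `u_{k+1}` of `ℂ(u_1, …, u_m)`. -/
def uvar {m : ℕ} (k : Fin m) : RatFun m := algebraMap (MvPolynomial (Fin m) ℂ) _ (MvPolynomial.X k)

/-- The substitution of the number `c` for the `k`-th variable of a polynomial. -/
def substVar {m : ℕ} (k : Fin m) (c : ℂ) : MvPolynomial (Fin m) ℂ →ₐ[ℂ] MvPolynomial (Fin m) ℂ :=
  MvPolynomial.aeval (Function.update MvPolynomial.X k (MvPolynomial.C c))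

/-- The rational function `x` is non-singular at `u_k = c`, and `y` is its evaluation there: `x` is
a quotient of polynomials whose denominator does not vanish identically at `u_k = c`. -/
def IsEvalAt {m : ℕ} (k : Fin m) (c : ℂ) (x y : RatFun m) : Prop :=
  ∃ P Q : MvPolynomial (Fin m) ℂ, substVar k c Q ≠ 0 ∧
    x = algebraMap _ (RatFun m) P / algebraMap _ (RatFun m) Q ∧
    y = algebraMap _ (RatFun m) (substVar k c P) / algebraMap _ (RatFun m) (substVar k c Q)

/-- `Y = X |_{u_1 = c_1} |_{u_2 = c_2} ⋯ |_{u_m = c_m}`, for a rational function `X` with values in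
the group algebra: the evaluations are done consecutively, in this order, and each of the rational
functions met is non-singular at the next point of evaluation. -/
def IsConsecutiveEval {G : Type} [Group G] {m : ℕ} (X : MonoidAlgebra (RatFun m) G)
    (c : Fin m → ℂ) (Y : MonoidAlgebra ℂ G) : Prop :=
  ∃ Z : Fin (m + 1) → MonoidAlgebra (RatFun m) G, Z 0 = X ∧
    (∀ (k : Fin m) (g : G), IsEvalAt k (c k) ((Z k.castSucc).coeff g) ((Z k.succ).coeff g)) ∧
    ∀ g : G, (Z (Fin.last m)).coeff g = algebraMap ℂ (RatFun m) (Y.coeff g)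

/-! ### Words for the longest element -/

/-- `x` is the generator with index `b`, possibly Baxterized: for `t` it may be replaced by some
`t(v_k)`, and for `s_i` by some `s_i(v_k, v_l, u_k, u_l)`, `l < k`. -/
def IsLetter {n : ℕ} (v : Fin (n + 1) → ℂ) (b : Fin (n + 1))
    (x : MonoidAlgebra (RatFun (n + 1)) (GroupB n)) : Prop :=
  x = gen (RatFun (n + 1)) b ∨
  (b = 0 ∧ ∃ k, x = baxtT (RatFun (n + 1)) n (v k)) ∨
  ∃ i : Fin n, b = i.succ ∧ ∃ k l, l < k ∧ x = baxtS i (v k) (v l) (uvar k) (uvar l)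

/-- `x` is a reduced word for the longest element of `B_{n+1}` in which some letters are
Baxterized. -/
def IsBaxterizedLongestWord {n : ℕ} (v : Fin (n + 1) → ℂ)
    (x : MonoidAlgebra (RatFun (n + 1)) (GroupB n)) : Prop :=
  ∃ (ω : List (Fin (n + 1))) (L : List (MonoidAlgebra (RatFun (n + 1)) (GroupB n))),
    (coxB n).IsReduced ω ∧ (∀ w, (coxB n).length w ≤ (coxB n).length ((coxB n).wordProd ω)) ∧
    List.Forall₂ (IsLetter v) ω L ∧ x = L.prod

end

end FusionB

/-! ### Coxeter relations of type B -/

namespace FusionB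

/-! Everything is computed in the seminormal form over a field `K` of characteristic zero, where `K`
is later both ℂ and the field of rational functions.

Fusion. Let J_i be the diagonal operator giving the content of the number i, and P_i the projection
to the tableaux with i in a fixed diagram κ. Then s_i J_{i+1} = J_i s_i + δ, where δ projects to the
tableaux with i and i+1 in the same diagram, and s_i P_{i+1} = P_i s_i. Because φ_{r+1} = (s_r + x)
φ_r s_r, induction gives φ_{r+1}(u)(u - J_{r+1})w = F(u) P_{r+1} w for every w that has the contents
and positions of the numbers at most r prescribed by the tableau (`seminormalExt_phi`). Here F =
`contFun` has its zeros at the contents of the addable nodes and its poles at those of the removable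
nodes of the κ-th diagram of the numbers placed so far. So φ_{r+1} acts on e_S, for S agreeing with
the given tableau up to r, by F(u)/(u - c) with c the content of r+1 in S, or by zero if r+1 lies in
the other diagram of S. At the content prescribed by the tableau this value is regular; it vanishes
unless S also agrees at r+1, and then it is a quotient of two hook products (`isEvalAt_contFun_div`,
`rowHookFactor_update`). Hence after k evaluations the k rightmost factors of Φ have become the sum
of all E_S with S agreeing up to k, divided by the inverse hook product of the numbers up to k
(`evaluatedPhi_mul_partialIdem`). A single factor may have a pole; its product with this sum is
regular. After the last evaluation only E_T/f is left.

Passage to the group algebra. The seminormal form is faithful, because the sum of the characters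
weighted by inverse hook products is 2^{n+1} times the coefficient of the identity
(`weightedTrace_one`, `weightedTrace_seminormal`). This goes by induction along the three types of
double cosets of B_n in B_{n+1}. Each type needs one identity for sums over addable nodes, and these
follow from Lagrange interpolation (`sum_transRatio`, `sum_transRatio_div`). The E_S exist because
sign changes and Jucys–Murphy elements act diagonally by positions and contents, which separate
tableaux (`single_mem_diagonalSubalgebra`). Faithfulness makes E_T unique, and rank one makes it
primitive.

Longest word. The word under Φ is a product of all the sign changes, so it has (n+1)² letters and
acts as -1. Counting inverted positive roots shows that it is reduced (`isReduced_longestWord`), and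
counting coset representatives shows that no element is longer (`length_le_sq`). -/

/-- The Coxeter relations of type `B` and rank `n + 1`, for a sequence of elements of a monoid. -/
structure RelB {M : Type*} [Monoid M] (n : ℕ) (σ : ℕ → M) : Prop where
  sq : ∀ m ≤ n, σ m * σ m = 1
  comm : ∀ i j, j ≤ n → i + 2 ≤ j → σ i * σ j = σ j * σ i
  braid : ∀ i, 1 ≤ i → i + 1 ≤ n → σ i * σ (i + 1) * σ i = σ (i + 1) * σ i * σ (i + 1)
  four : 1 ≤ n → σ 0 * σ 1 * σ 0 * σ 1 = σ 1 * σ 0 * σ 1 * σ 0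

/-- Reversing the nodes moves the edge of order 4 to the nodes 0 and 1; for distinct indices, `i + j
= 1` singles out exactly this pair. -/
theorem matrixB_apply (n : ℕ) (i j : Fin (n + 1)) :
    matrixB n i j = if i = j then 1
      else if (i : ℕ) + j = 1 then 4
      else if (j : ℕ) + 1 = i ∨ (i : ℕ) + 1 = j then 3 else 2 := by
  have h : matrixB n i j = CoxeterMatrix.B (n + 1) (Fin.rev i) (Fin.rev j) := rfl
  rw [h]
  have hB : ∀ a b : Fin (n + 1), CoxeterMatrix.B (n + 1) a b = if a = b then 1
      else (if (a : ℕ) = n + 1 - 1 ∧ (b : ℕ) = n + 1 - 2 ∨ (b : ℕ) = n + 1 - 1 ∧ (a : ℕ) = n + 1 - 2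
        then 4 else (if (b : ℕ) + 1 = a ∨ (a : ℕ) + 1 = b then 3 else 2)) := fun _ _ => rfl
  rw [hB]
  simp only [Fin.rev_inj, Fin.val_rev]
  have hi := i.2
  have hj := j.2
  by_cases hij : i = j
  · simp [hij]
  · have hij' : (i : ℕ) ≠ j := fun h => hij (Fin.ext h)
    simp only [hij, if_false]
    split_ifs <;> first | rfl | omega

theorem RelB.isLiftable {M : Type*} [Monoid M] {n : ℕ} {σ : ℕ → M} (h : RelB n σ) :
    (matrixB n).IsLiftable (fun i : Fin (n + 1) => σ i) := by
  have key2 : ∀ a b : M, a * a = 1 → b * b = 1 → a * b = b * a → (a * b) ^ 2 = 1 := by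
    intro a b ha hb hab
    calc (a * b) ^ 2 = a * (b * a) * b := by simp only [pow_two, mul_assoc]
      _ = (a * a) * (b * b) := by rw [← hab]; simp only [mul_assoc]
      _ = 1 := by rw [ha, hb, one_mul]
  have key3 : ∀ a b : M, a * a = 1 → b * b = 1 → a * b * a = b * a * b → (a * b) ^ 3 = 1 := by
    intro a b ha hb hab
    calc (a * b) ^ 3 = (a * b * a) * (b * a * b) := by simp only [pow_succ, pow_zero, one_mul, mul_assoc]
      _ = (a * b * a) * (a * b * a) := by rw [hab]
      _ = a * (b * (a * a) * b) * a := by simp only [mul_assoc]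
      _ = 1 := by rw [ha, mul_one, hb, mul_one, ha]
  have key4 : ∀ a b : M, a * a = 1 → b * b = 1 → a * b * a * b = b * a * b * a →
      (a * b) ^ 4 = 1 := by
    intro a b ha hb hab
    calc (a * b) ^ 4 = (a * b * a * b) * (a * b * a * b) := by
          simp only [pow_succ, pow_zero, one_mul, mul_assoc]
      _ = (a * b * a * b) * (b * a * b * a) := by rw [hab]
      _ = a * (b * (a * (b * b) * a) * b) * a := by simp only [mul_assoc]
      _ = 1 := by rw [hb, mul_one, ha, mul_one, hb, mul_one, ha]
  intro i j
  have hi := Nat.lt_succ_iff.1 i.2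
  have hj := Nat.lt_succ_iff.1 j.2
  have si := h.sq i hi
  have sj := h.sq j hj
  change (σ i * σ j) ^ (matrixB n i j) = 1
  rw [matrixB_apply]
  split_ifs with h1 h2 h3
  · subst h1; rw [pow_one, si]
  · apply key4 _ _ si sj
    have hn : 1 ≤ n := by
      by_contra hn
      omega
    rcases Nat.eq_zero_or_pos (i : ℕ) with h0 | h0
    · have h0' : (j : ℕ) = 1 := by omega
      rw [h0, h0']; exact h.four hn
    · have h0' : (j : ℕ) = 0 := by omega
      have h0'' : (i : ℕ) = 1 := by omega
      rw [h0', h0'']; exact (h.four hn).symm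
  · apply key3 _ _ si sj
    rcases h3 with h3 | h3
    · rw [← h3]; exact (h.braid j (by omega) (by omega)).symm
    · rw [← h3]; exact h.braid i (by omega) (by omega)
  · apply key2 _ _ si sj
    have hne : (i : ℕ) ≠ j := fun hh => h1 (Fin.ext hh)
    rcases lt_or_gt_of_ne hne with hlt | hlt
    · exact h.comm _ _ hj (by omega)
    · exact (h.comm _ _ hi (by omega)).symm

/-- The simple reflections of `B_{n+1}`, indexed by the natural numbers. -/
noncomputable def sig (n : ℕ) (m : ℕ) : GroupB n :=
  if h : m < n + 1 then (coxB n).simple ⟨m, h⟩ else 1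

theorem sig_val {n : ℕ} (i : Fin (n + 1)) : sig n i = (coxB n).simple i := by
  unfold sig
  rw [dif_pos i.2]

theorem relB_sig (n : ℕ) : RelB n (sig n) := by
  have hs : ∀ m (h : m < n + 1), sig n m = (coxB n).simple ⟨m, h⟩ := fun m h => by simp [sig, h]
  have hsq : ∀ m, sig n m * sig n m = 1 := by
    intro m
    unfold sig
    split_ifs
    · exact (coxB n).simple_mul_simple_self _
    · simp
  have hinv : ∀ m, (sig n m)⁻¹ = sig n m := fun m => inv_eq_of_mul_eq_one_left (hsq m)
  have hpow : ∀ i j (hi : i < n + 1) (hj : j < n + 1),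
      (sig n i * sig n j) ^ (matrixB n ⟨i, hi⟩ ⟨j, hj⟩) = 1 := by
    intro i j hi hj
    rw [hs i hi, hs j hj]
    exact (coxB n).simple_mul_simple_pow _ _
  refine ⟨fun m _ => hsq m, ?_, ?_, ?_⟩
  · intro i j hj hij
    have := hpow i j (by omega) (by omega)
    rw [matrixB_apply, if_neg (by simp [Fin.ext_iff]; omega), if_neg (by simp; omega),
      if_neg (by simp; omega), pow_two] at this
    rw [← mul_inv_eq_one]
    simpa [mul_inv_rev, hinv, mul_assoc] using this
  · intro i h1 hn
    have := hpow i (i + 1) (by omega) (by omega)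
    rw [matrixB_apply, if_neg (by simp [Fin.ext_iff]), if_neg (by simp; omega),
      if_pos (by simp)] at this
    rw [← mul_inv_eq_one]
    simpa [mul_inv_rev, hinv, mul_assoc, pow_succ] using this
  · intro hn
    have := hpow 0 1 (by omega) (by omega)
    rw [matrixB_apply, if_neg (by simp [Fin.ext_iff]), if_pos (by simp)] at this
    rw [← mul_inv_eq_one]
    simpa [mul_inv_rev, hinv, mul_assoc, pow_succ] using this

/-! ### Parabolic subgroups, double cosets and the bound on lengths -/

section Parabolic

variable {G : Type*} [Group G]

/-- The elements `σ_k ⋯ σ_1 σ_0 σ_1 ⋯ σ_k`. -/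
def signChange {M : Type*} [Monoid M] (σ : ℕ → M) : ℕ → M
  | 0 => σ 0
  | k + 1 => σ (k + 1) * signChange σ k * σ (k + 1)

/-- The standard parabolic subgroup generated by the first `k` generators. -/
def parabolic (σ : ℕ → G) (k : ℕ) : Subgroup G := Subgroup.closure {g | ∃ m < k, σ m = g}

variable {n : ℕ} {σ : ℕ → G}

theorem mem_parabolic {k m : ℕ} (h : m < k) : σ m ∈ parabolic σ k :=
  Subgroup.subset_closure ⟨m, h, rfl⟩

theorem parabolic_mono {k l : ℕ} (h : k ≤ l) : parabolic σ k ≤ parabolic σ l := by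
  apply Subgroup.closure_mono
  rintro _ ⟨m, hm, rfl⟩
  exact ⟨m, by omega, rfl⟩

theorem signChange_mem (k : ℕ) : signChange σ k ∈ parabolic σ (k + 1) := by
  induction k with
  | zero => exact mem_parabolic (by omega)
  | succ k ih =>
    have h : σ (k + 1) ∈ parabolic σ (k + 1 + 1) := mem_parabolic (by omega)
    exact mul_mem (mul_mem h (parabolic_mono (by omega) ih)) h

theorem commute_of_mem_parabolic {x : G} {k : ℕ} (hx : ∀ m < k, Commute x (σ m)) {h : G}
    (hh : h ∈ parabolic σ k) : Commute x h := by
  induction hh using Subgroup.closure_induction with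
  | mem _ h => obtain ⟨m, hm, rfl⟩ := h; exact hx m hm
  | one => exact Commute.one_right x
  | mul _ _ _ _ h1 h2 => exact h1.mul_right h2
  | inv _ _ h => exact h.inv_right

theorem RelB.commute_parabolic (hσ : RelB n σ) {k m : ℕ} (hk : k < m) (hm : m ≤ n) {h : G}
    (hh : h ∈ parabolic σ k) : Commute (σ m) h :=
  commute_of_mem_parabolic (fun l hl => (hσ.comm l m hm (by omega)).symm) hh

/-- As a signed permutation, `signChange σ k` negates a coordinate that `σ m` with `m < k` either
leaves alone or never sees. From the relations: the case just below the top is the relation of order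
four, or two braid moves around the inner sign change; all lower cases are inherited. -/
theorem RelB.commute_signChange_sig (hσ : RelB n σ) :
    ∀ (k : ℕ), k ≤ n → ∀ m < k, Commute (signChange σ k) (σ m) := by
  intro k
  induction k with
  | zero => intro _ m hm; omega
  | succ k ih =>
    intro hk m hm
    have hsq := hσ.sq (k + 1) hk
    rcases Nat.lt_or_ge m k with h | h
    · have h1 : Commute (σ (k + 1)) (σ m) := (hσ.comm m (k + 1) hk (by omega)).symm
      exact (h1.mul_left (ih (by omega) m h)).mul_left h1
    · obtain rfl : m = k := by omega
      cases m with
      | zero =>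
        have := hσ.four (by omega)
        change σ 1 * σ 0 * σ 1 * σ 0 = σ 0 * (σ 1 * σ 0 * σ 1)
        rw [← this]; simp only [mul_assoc]
      | succ l =>
        have hb := hσ.braid (l + 1) (by omega) hk
        have hc : σ (l + 2) * signChange σ l = signChange σ l * σ (l + 2) :=
          hσ.commute_parabolic (k := l + 1) (by omega) hk (signChange_mem l)
        change σ (l + 2) * (σ (l + 1) * signChange σ l * σ (l + 1)) * σ (l + 2) * σ (l + 1)
          = σ (l + 1) * (σ (l + 2) * (σ (l + 1) * signChange σ l * σ (l + 1)) * σ (l + 2))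
        calc _ = σ (l + 2) * σ (l + 1) * signChange σ l * (σ (l + 1) * σ (l + 2) * σ (l + 1)) := by
              simp only [mul_assoc]
          _ = σ (l + 2) * σ (l + 1) * (signChange σ l * σ (l + 2)) * σ (l + 1) * σ (l + 2) := by
              rw [hb]; simp only [mul_assoc]
          _ = (σ (l + 2) * σ (l + 1) * σ (l + 2)) * signChange σ l * σ (l + 1) * σ (l + 2) := by
              rw [← hc]; simp only [mul_assoc]
          _ = _ := by rw [← hb]; simp only [mul_assoc]

theorem RelB.commute_signChange (hσ : RelB n σ) {k : ℕ} (hk : k ≤ n) {h : G}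
    (hh : h ∈ parabolic σ k) : Commute (signChange σ k) h :=
  commute_of_mem_parabolic (hσ.commute_signChange_sig k hk) hh

/-- The double cosets of `B_k` in `B_{k+1}`. -/
theorem RelB.double_coset (hσ : RelB n σ) (k : ℕ) (hk : k ≤ n) {w : G}
    (hw : w ∈ parabolic σ (k + 1)) : w ∈ parabolic σ k ∨
      (1 ≤ k ∧ ∃ a ∈ parabolic σ k, ∃ b ∈ parabolic σ k, w = a * σ k * b) ∨
      ∃ a ∈ parabolic σ k, w = a * signChange σ k := by
  induction k generalizing w with
  | zero =>
    have step : ∀ x : G, (x ∈ parabolic σ 0 ∨ ∃ a ∈ parabolic σ 0, x = a * σ 0) →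
        (x * σ 0 ∈ parabolic σ 0 ∨ ∃ a ∈ parabolic σ 0, x * σ 0 = a * σ 0) := by
      rintro x (h | ⟨a, ha, rfl⟩)
      · exact Or.inr ⟨x, h, rfl⟩
      · left; rwa [mul_assoc, hσ.sq 0 hk, mul_one]
    have : w ∈ parabolic σ 0 ∨ ∃ a ∈ parabolic σ 0, w = a * σ 0 := by
      induction hw using Subgroup.closure_induction_right with
      | one => exact Or.inl (one_mem _)
      | mul_right x _ y hy ih =>
        obtain ⟨m, hm, rfl⟩ := hy
        obtain rfl : m = 0 := by omega
        exact step x ih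
      | mul_inv_cancel x _ y hy ih =>
        obtain ⟨m, hm, rfl⟩ := hy
        obtain rfl : m = 0 := by omega
        rw [inv_eq_of_mul_eq_one_left (hσ.sq 0 hk)]
        exact step x ih
    rcases this with h | h
    · exact Or.inl h
    · exact Or.inr (Or.inr h)
  | succ k ih =>
    have hsq := hσ.sq (k + 1) hk
    have hle : parabolic σ k ≤ parabolic σ (k + 1) := parabolic_mono (by omega)
    -- The union of the three double cosets is stable under right multiplication by generators, so
    -- it is the whole subgroup.
    have step : ∀ x : G, ∀ m < k + 1 + 1, (x ∈ parabolic σ (k + 1) ∨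
        (∃ a ∈ parabolic σ (k + 1), ∃ b ∈ parabolic σ (k + 1), x = a * σ (k + 1) * b) ∨
        ∃ a ∈ parabolic σ (k + 1), x = a * signChange σ (k + 1)) →
        (x * σ m ∈ parabolic σ (k + 1) ∨
        (∃ a ∈ parabolic σ (k + 1), ∃ b ∈ parabolic σ (k + 1), x * σ m = a * σ (k + 1) * b) ∨
        ∃ a ∈ parabolic σ (k + 1), x * σ m = a * signChange σ (k + 1)) := by
      intro x m hm hx
      rcases Nat.lt_or_ge m (k + 1) with hmk | hmk
      · have hmem : σ m ∈ parabolic σ (k + 1) := mem_parabolic hmk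
        rcases hx with h | ⟨a, ha, b, hb, rfl⟩ | ⟨a, ha, rfl⟩
        · exact Or.inl (mul_mem h hmem)
        · exact Or.inr (Or.inl ⟨a, ha, b * σ m, mul_mem hb hmem, by simp only [mul_assoc]⟩)
        · refine Or.inr (Or.inr ⟨a * σ m, mul_mem ha hmem, ?_⟩)
          rw [mul_assoc, (hσ.commute_signChange hk hmem).eq, mul_assoc]
      · obtain rfl : m = k + 1 := by omega
        rcases hx with h | ⟨a, ha, b, hb, rfl⟩ | ⟨a, ha, rfl⟩
        · exact Or.inr (Or.inl ⟨x, h, 1, one_mem _, by simp⟩)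
        -- The product `σ (k + 1) * b * σ (k + 1)` must be sorted. The double coset of `b` one level
        -- down decides: the two outer letters cancel, take part in a braid move, or complete the
        -- next sign change.
        · rcases ih (by omega) hb with h | ⟨h1, c, hc, d, hd, rfl⟩ | ⟨c, hc, rfl⟩
          · left
            rw [mul_assoc, mul_assoc, ← (hσ.commute_parabolic (by omega) hk h).eq,
              ← mul_assoc (σ (k + 1)), hsq, one_mul]
            exact mul_mem ha hb
          · right; left
            have h1c := (hσ.commute_parabolic (by omega) hk hc).eq
            have h1d := (hσ.commute_parabolic (by omega) hk hd).eq
            refine ⟨a * c * σ k, mul_mem (mul_mem ha (hle hc)) (mem_parabolic (by omega)),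
              σ k * d, mul_mem (mem_parabolic (by omega)) (hle hd), ?_⟩
            calc a * σ (k + 1) * (c * σ k * d) * σ (k + 1)
                = a * (σ (k + 1) * c) * σ k * (d * σ (k + 1)) := by simp only [mul_assoc]
              _ = a * c * (σ (k + 1) * σ k * σ (k + 1)) * d := by
                rw [h1c, ← h1d]; simp only [mul_assoc]
              _ = _ := by rw [← hσ.braid k h1 hk]; simp only [mul_assoc]
          · right; right
            have h1c := (hσ.commute_parabolic (by omega) hk hc).eq
            refine ⟨a * c, mul_mem ha (hle hc), ?_⟩
            calc a * σ (k + 1) * (c * signChange σ k) * σ (k + 1)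
                = a * (σ (k + 1) * c) * signChange σ k * σ (k + 1) := by simp only [mul_assoc]
              _ = _ := by rw [h1c]; simp only [signChange, mul_assoc]
        · refine Or.inr (Or.inl ⟨a, ha, signChange σ k, signChange_mem k, ?_⟩)
          simp only [signChange, mul_assoc, hsq, mul_one]
    have : w ∈ parabolic σ (k + 1) ∨
        (∃ a ∈ parabolic σ (k + 1), ∃ b ∈ parabolic σ (k + 1), w = a * σ (k + 1) * b) ∨
        ∃ a ∈ parabolic σ (k + 1), w = a * signChange σ (k + 1) := by
      induction hw using Subgroup.closure_induction_right with
      | one => exact Or.inl (one_mem _)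
      | mul_right x _ y hy ih =>
        obtain ⟨m, hm, rfl⟩ := hy
        exact step x m hm ih
      | mul_inv_cancel x _ y hy ih =>
        obtain ⟨m, hm, rfl⟩ := hy
        rw [inv_eq_of_mul_eq_one_left (hσ.sq m (by omega))]
        exact step x m hm ih
    rcases this with h | h | h
    · exact Or.inl h
    · exact Or.inr (Or.inl ⟨by omega, h⟩)
    · exact Or.inr (Or.inr h)

end Parabolic

theorem parabolic_sig_eq_top (n : ℕ) : parabolic (sig n) (n + 1) = ⊤ := by
  rw [← (coxB n).subgroup_closure_range_simple]
  unfold parabolic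
  congr 1
  ext g
  constructor
  · rintro ⟨m, hm, rfl⟩
    exact ⟨⟨m, hm⟩, by simp [sig, hm]⟩
  · rintro ⟨i, rfl⟩
    exact ⟨i, i.2, sig_val i⟩

theorem length_sig_le (n m : ℕ) : (coxB n).length (sig n m) ≤ 1 := by
  unfold sig
  split_ifs
  · exact ((coxB n).length_simple _).le
  · simp

theorem length_signChange_le (n k : ℕ) :
    (coxB n).length (signChange (sig n) k) ≤ 2 * k + 1 := by
  induction k with
  | zero => exact length_sig_le n 0
  | succ k ih =>
    have h1 := (coxB n).length_mul_le (sig n (k + 1) * signChange (sig n) k) (sig n (k + 1))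
    have h2 := (coxB n).length_mul_le (sig n (k + 1)) (signChange (sig n) k)
    have h3 := length_sig_le n (k + 1)
    change (coxB n).length (sig n (k + 1) * signChange (sig n) k * sig n (k + 1)) ≤ _
    omega

/-- In the middle double coset the right factor splits by induction as `c * r`, and `c` commutes
past the top generator. So the representatives are the final segments of s_k ⋯ s_1 t s_1 ⋯ s_k, of
at most 2k+1 letters. -/
theorem exists_coset_rep (n k : ℕ) (hk : k ≤ n) {w : GroupB n}
    (hw : w ∈ parabolic (sig n) (k + 1)) : ∃ a ∈ parabolic (sig n) k, ∃ r,
      w = a * r ∧ (coxB n).length r ≤ 2 * k + 1 := by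
  induction k generalizing w with
  | zero =>
    rcases (relB_sig n).double_coset 0 hk hw with h | ⟨h, _⟩ | ⟨a, ha, rfl⟩
    · exact ⟨w, h, 1, by simp, by simp⟩
    · omega
    · exact ⟨a, ha, _, rfl, length_signChange_le n 0⟩
  | succ k ih =>
    rcases (relB_sig n).double_coset (k + 1) hk hw with h | ⟨_, a, ha, b, hb, rfl⟩ | ⟨a, ha, rfl⟩
    · exact ⟨w, h, 1, by simp, by simp⟩
    · obtain ⟨c, hc, r, rfl, hr⟩ := ih (by omega) hb
      refine ⟨a * c, mul_mem ha (parabolic_mono (by omega) hc), sig n (k + 1) * r, ?_, ?_⟩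
      · have := ((relB_sig n).commute_parabolic (by omega) hk hc).eq
        calc a * sig n (k + 1) * (c * r) = a * (sig n (k + 1) * c) * r := by simp only [mul_assoc]
          _ = _ := by rw [this]; simp only [mul_assoc]
      · have h2 := (coxB n).length_mul_le (sig n (k + 1)) r
        have h3 := length_sig_le n (k + 1)
        omega
    · exact ⟨a, ha, _, rfl, length_signChange_le n _⟩

/-- The bounds 2j+1 on coset representatives, summed over j < k, give k². -/
theorem length_le_of_mem_parabolic (n k : ℕ) (hk : k ≤ n + 1) {w : GroupB n}
    (hw : w ∈ parabolic (sig n) k) : (coxB n).length w ≤ k * k := by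
  induction k generalizing w with
  | zero =>
    have : parabolic (sig n) 0 = ⊥ := by simp [parabolic]
    rw [this, Subgroup.mem_bot] at hw
    simp [hw]
  | succ k ih =>
    obtain ⟨a, ha, r, rfl, hr⟩ := exists_coset_rep n k (by omega) hw
    have h1 := ih (by omega) ha
    have h2 := (coxB n).length_mul_le a r
    nlinarith

theorem length_le_sq {n : ℕ} (w : GroupB n) : (coxB n).length w ≤ (n + 1) * (n + 1) :=
  length_le_of_mem_parabolic n (n + 1) le_rfl (by rw [parabolic_sig_eq_top]; trivial)

end FusionB

/-! ### Signed permutations, inversions and the longest word -/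

namespace FusionB

/-- The action of the generators of type `B` on integer sequences by signed permutations. -/
def signedPerm : ℕ → Function.End (ℕ → ℤ)
  | 0 => fun x => Function.update x 0 (-x 0)
  | m + 1 => fun x => x ∘ Equiv.swap m (m + 1)

theorem relB_signedPerm (n : ℕ) : RelB n signedPerm := by
  refine ⟨?_, ?_, ?_, ?_⟩
  · rintro (_ | m) _
    · funext x i
      change Function.update (Function.update x 0 (-x 0)) 0 (- Function.update x 0 (-x 0) 0) i = x i
      simp
    · funext x i
      change x (Equiv.swap m (m + 1) (Equiv.swap m (m + 1) i)) = x i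
      simp
  · rintro (_ | i) (_ | j) _ hij
    · omega
    · funext x l
      change Function.update (x ∘ Equiv.swap j (j + 1)) 0 (-x (Equiv.swap j (j + 1) 0)) l
        = (Function.update x 0 (-x 0)) (Equiv.swap j (j + 1) l)
      have h0 : Equiv.swap j (j + 1) 0 = 0 := Equiv.swap_apply_of_ne_of_ne (by omega) (by omega)
      rw [h0]
      by_cases hl : l = 0
      · subst hl; rw [h0]; simp
      · have h1 : Equiv.swap j (j + 1) l ≠ 0 := by
          intro h; apply hl; rw [← h0] at h; exact (Equiv.injective _ h)
        rw [Function.update_of_ne hl, Function.update_of_ne h1]; rfl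
    · omega
    · funext x l
      change x (Equiv.swap j (j + 1) (Equiv.swap i (i + 1) l))
        = x (Equiv.swap i (i + 1) (Equiv.swap j (j + 1) l))
      congr 1
      simp only [Equiv.swap_apply_def]
      split_ifs <;> omega
  · rintro (_ | i) h1 hn
    · omega
    · funext x l
      change x (Equiv.swap i (i + 1) (Equiv.swap (i + 1) (i + 2) (Equiv.swap i (i + 1) l)))
        = x (Equiv.swap (i + 1) (i + 2) (Equiv.swap i (i + 1) (Equiv.swap (i + 1) (i + 2) l)))
      congr 1
      simp only [Equiv.swap_apply_def]
      split_ifs <;> omega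
  · intro _
    have hf : ∀ x : ℕ → ℤ, ∀ l, signedPerm 0 x l = if l = 0 then - x 0 else x l := by
      intro x l
      change Function.update x 0 (-x 0) l = _
      rw [Function.update_apply]
    have hg : ∀ x : ℕ → ℤ, ∀ l, signedPerm 1 x l = if l = 0 then x 1 else if l = 1 then x 0
        else x l := by
      intro x l
      change x (Equiv.swap 0 1 l) = _
      rw [Equiv.swap_apply_def]
      split_ifs <;> rfl
    funext x l
    change signedPerm 0 (signedPerm 1 (signedPerm 0 (signedPerm 1 x))) l
      = signedPerm 1 (signedPerm 0 (signedPerm 1 (signedPerm 0 x))) l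
    by_cases h0 : l = 0
    · subst h0; simp [hf, hg]
    · by_cases h1 : l = 1
      · subst h1; simp [hf, hg]
      · simp [hf, hg, h0, h1]

/-- The positive roots of type `B_N` made negative by an integer sequence; the roots `e_j - e_i`
carry the label `false`, and the roots `e_j + e_i` the label `true`. -/
def inversions (N : ℕ) (x : ℕ → ℤ) : Finset (ℕ × ℕ × Bool) :=
  ((Finset.range N) ×ˢ (Finset.range N) ×ˢ Finset.univ).filter fun p =>
    p.1 ≤ p.2.1 ∧ if p.2.2 then x p.1 + x p.2.1 < 0 else x p.2.1 < x p.1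

theorem mem_inversions {N : ℕ} {x : ℕ → ℤ} {i j : ℕ} {b : Bool} :
    (i, j, b) ∈ inversions N x ↔ i ≤ j ∧ j < N ∧ if b then x i + x j < 0 else x j < x i := by
  unfold inversions
  simp only [Finset.mem_filter, Finset.mem_product, Finset.mem_range, Finset.mem_univ, and_true]
  constructor
  · rintro ⟨⟨_, h⟩, h', h''⟩; exact ⟨h', h, h''⟩
  · rintro ⟨h', h, h''⟩; exact ⟨⟨by omega, h⟩, h', h''⟩

/-- A simple reflection permutes the positive roots other than its own, so it changes the number of
inverted roots by at most one. In `key`, `q` is the root of the reflection and `f` the permutation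
of the others. A diagonal pair `(i, i, true)` stands for the short root, while `(i, i, false)` is
never inverted. -/
theorem card_inversions_signedPerm_le {N m : ℕ} (hm : m < N) (x : ℕ → ℤ) :
    (inversions N (signedPerm m x)).card ≤ (inversions N x).card + 1 := by
  classical
  have key : ∀ (f : ℕ × ℕ × Bool → ℕ × ℕ × Bool) (q : ℕ × ℕ × Bool),
      (∀ p ∈ inversions N (signedPerm m x), p ≠ q → f p ∈ inversions N x ∧ f (f p) = p) →
      (inversions N (signedPerm m x)).card ≤ (inversions N x).card + 1 := by
    intro f q h
    have hsub : inversions N (signedPerm m x) ⊆ insert q ((inversions N x).image f) := by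
      intro p hp
      by_cases hpq : p = q
      · exact Finset.mem_insert.2 (Or.inl hpq)
      · obtain ⟨h1, h2⟩ := h p hp hpq
        exact Finset.mem_insert_of_mem (Finset.mem_image.2 ⟨_, h1, h2⟩)
    exact (Finset.card_le_card hsub).trans ((Finset.card_insert_le _ _).trans
      (Nat.add_le_add_right Finset.card_image_le 1))
  cases m with
  | zero =>
    have hf : ∀ l, signedPerm 0 x l = if l = 0 then - x 0 else x l := by
      intro l
      change Function.update x 0 (-x 0) l = _
      rw [Function.update_apply]
    -- Negating the coordinate 0 exchanges e_j - e_0 and e_j + e_0; the root of t is e_0.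
    apply key (fun p => if p.1 = 0 then (p.1, p.2.1, !p.2.2) else p) (0, 0, true)
    rintro ⟨i, j, b⟩ hp hne
    rw [mem_inversions] at hp
    obtain ⟨h1, h2, h3⟩ := hp
    simp only [hf] at h3
    by_cases hi : i = 0
    · subst hi
      have hj : j ≠ 0 := by
        rintro rfl
        cases b
        · simp at h3
        · exact hne rfl
      simp only [if_true, Bool.not_not, and_true, mem_inversions]
      simp only [hj, if_true, if_false] at h3
      refine ⟨h1, h2, ?_⟩
      cases b <;> simp at h3 ⊢ <;> omega
    · have hj : j ≠ 0 := by omega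
      simp only [hi, hj, if_false] at h3
      simp only [hi, if_false, and_true, mem_inversions]
      exact ⟨h1, h2, h3⟩
  | succ m =>
    have hs : Function.Involutive (Equiv.swap m (m + 1)) := fun l => by simp
    have hf : ∀ l, signedPerm (m + 1) x l = x (Equiv.swap m (m + 1) l) := fun l => rfl
    -- The exception keeps the pair of indices in increasing order: e_m + e_{m+1} is fixed by the
    -- reflection, and e_{m+1} - e_m is its own root.
    apply key (fun p => if p.1 = m ∧ p.2.1 = m + 1 then p else
      (Equiv.swap m (m + 1) p.1, Equiv.swap m (m + 1) p.2.1, p.2.2)) (m, m + 1, false)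
    rintro ⟨i, j, b⟩ hp hne
    rw [mem_inversions] at hp
    obtain ⟨h1, h2, h3⟩ := hp
    simp only [hf] at h3
    by_cases hij : i = m ∧ j = m + 1
    · obtain ⟨rfl, rfl⟩ := hij
      have hb : b = true := by
        cases b
        · exact absurd rfl hne
        · rfl
      subst hb
      simp only [and_self, if_true, and_true, mem_inversions]
      refine ⟨h1, h2, ?_⟩
      simp only [Equiv.swap_apply_left, Equiv.swap_apply_right, if_true] at h3 ⊢
      omega
    · simp only [hij, if_false]
      have h4 : Equiv.swap m (m + 1) i ≤ Equiv.swap m (m + 1) j ∧ Equiv.swap m (m + 1) j < N := by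
        simp only [Equiv.swap_apply_def]
        split_ifs <;> omega
      have h5 : ¬ (Equiv.swap m (m + 1) i = m ∧ Equiv.swap m (m + 1) j = m + 1) := by
        simp only [Equiv.swap_apply_def]
        split_ifs <;> omega
      simp only [h5, if_false, hs i, hs j, and_true, mem_inversions]
      exact ⟨h4.1, h4.2, h3⟩

theorem inversions_pos (N : ℕ) : inversions N (fun i : ℕ => (i : ℤ) + 1) = ∅ := by
  rw [Finset.eq_empty_iff_forall_notMem]
  rintro ⟨i, j, b⟩ h
  rw [mem_inversions] at h
  obtain ⟨h1, h2, h3⟩ := h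
  cases b <;> simp at h3 <;> omega

/-- All N² positive roots are inverted. They are counted by pairs (a, b): those with a < b give e_b
- e_a, and the others give e_a + e_b. -/
theorem card_inversions_neg (N : ℕ) (x : ℕ → ℤ) (hx : ∀ i < N, x i = -((i : ℤ) + 1)) :
    N * N ≤ (inversions N x).card := by
  have hinj : Set.InjOn (fun p : ℕ × ℕ => if p.1 < p.2 then (p.1, p.2, false) else (p.2, p.1, true))
      ((Finset.range N ×ˢ Finset.range N : Finset (ℕ × ℕ)) : Set (ℕ × ℕ)) := by
    rintro ⟨a, b⟩ _ ⟨c, d⟩ _ h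
    simp only at h
    split_ifs at h <;> simp only [Prod.mk.injEq, Bool.false_eq_true, Bool.true_eq_false, and_false,
      and_true] at h ⊢ <;> first | exact h | exact ⟨h.2, h.1⟩
  have := Finset.card_le_card_of_injOn (t := inversions N x) _ (by
    rintro ⟨a, b⟩ h
    simp only [Finset.coe_product, Finset.coe_range, Set.mem_prod, Set.mem_Iio] at h
    simp only
    split_ifs with hab
    · rw [Finset.mem_coe, mem_inversions, hx a h.1, hx b h.2]
      exact ⟨hab.le, h.2, by simp; omega⟩
    · rw [Finset.mem_coe, mem_inversions, hx a h.1, hx b h.2]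
      exact ⟨by omega, h.1, by simp; omega⟩) hinj
  simpa using this

/-- The action of `B_{n+1}` by signed permutations. -/
noncomputable def signedAction (n : ℕ) : GroupB n →* Function.End (ℕ → ℤ) :=
  (coxB n).lift ⟨_, (relB_signedPerm n).isLiftable⟩

theorem signedAction_simple {n : ℕ} (i : Fin (n + 1)) :
    signedAction n ((coxB n).simple i) = signedPerm i :=
  (coxB n).lift_apply_simple (relB_signedPerm n).isLiftable i

theorem card_inversions_le_length {n : ℕ} (ω : List (Fin (n + 1))) :
    (inversions (n + 1) (signedAction n ((coxB n).wordProd ω) fun i : ℕ => (i : ℤ) + 1)).card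
      ≤ ω.length := by
  induction ω with
  | nil =>
    have : signedAction n ((coxB n).wordProd []) (fun i : ℕ => (i : ℤ) + 1) = fun i : ℕ => (i : ℤ) + 1 := by
      rw [CoxeterSystem.wordProd_nil, map_one]; rfl
    rw [this, inversions_pos]; simp
  | cons i ω ih =>
    rw [CoxeterSystem.wordProd_cons, map_mul, signedAction_simple, List.length_cons]
    exact (card_inversions_signedPerm_le i.2 _).trans (Nat.add_le_add_right ih 1)

theorem signChange_signedPerm (k : ℕ) (x : ℕ → ℤ) :
    signChange signedPerm k x = Function.update x k (-x k) := by
  induction k generalizing x with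
  | zero => rfl
  | succ k ih =>
    change (signChange signedPerm k (x ∘ Equiv.swap k (k + 1))) ∘ Equiv.swap k (k + 1) = _
    rw [ih]
    funext l
    simp only [Function.comp, Function.update_apply, Equiv.swap_apply_def]
    split_ifs <;> first | rfl | omega | (congr 1; omega)

/-- The word `s_k ⋯ s_1 t s_1 ⋯ s_k`. -/
def signChangeWord {n : ℕ} (k : Fin (n + 1)) : List (Fin (n + 1)) :=
  Fin.induction (motive := fun _ => List (Fin (n + 1))) [0] (fun i x => i.succ :: (x ++ [i.succ])) k

theorem signChangeWord_zero {n : ℕ} : signChangeWord (0 : Fin (n + 1)) = [0] := rfl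

theorem signChangeWord_succ {n : ℕ} (i : Fin n) :
    signChangeWord i.succ = i.succ :: (signChangeWord i.castSucc ++ [i.succ]) := rfl

theorem length_signChangeWord {n : ℕ} (k : Fin (n + 1)) :
    (signChangeWord k).length = 2 * k + 1 := by
  induction k using Fin.induction with
  | zero => rfl
  | succ i ih => rw [signChangeWord_succ]; simp [ih]; omega

theorem signedAction_signChangeWord {n : ℕ} (k : Fin (n + 1)) :
    signedAction n ((coxB n).wordProd (signChangeWord k)) = signChange signedPerm k := by
  induction k using Fin.induction with
  | zero =>
    rw [signChangeWord_zero, CoxeterSystem.wordProd_singleton, signedAction_simple]; rfl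
  | succ i ih =>
    rw [signChangeWord_succ, CoxeterSystem.wordProd_cons, CoxeterSystem.wordProd_append,
      CoxeterSystem.wordProd_singleton, map_mul, map_mul, ih, signedAction_simple, Fin.val_succ,
      Fin.val_castSucc, ← mul_assoc]
    rfl

/-- The word of the longest element that underlies `Φ`. -/
def longestWord (n : ℕ) : List (Fin (n + 1)) :=
  (List.ofFn fun k : Fin (n + 1) => signChangeWord k).reverse.flatten

theorem length_longestWord (n : ℕ) : (longestWord n).length = (n + 1) * (n + 1) := by
  unfold longestWord
  rw [List.length_flatten, List.map_reverse, List.sum_reverse, List.map_ofFn, List.sum_ofFn]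
  simp only [Function.comp_apply, length_signChangeWord]
  rw [Fin.sum_univ_eq_sum_range (fun i => 2 * i + 1)]
  induction n with
  | zero => rfl
  | succ n ih => rw [Finset.sum_range_succ, ih]; ring

theorem signedAction_longestWord (n : ℕ) (x : ℕ → ℤ) (i : ℕ) (hi : i < n + 1) :
    signedAction n ((coxB n).wordProd (longestWord n)) x i = -x i := by
  have key : ∀ (l : List (Fin (n + 1))), l.Nodup → ∀ i : ℕ,
      signedAction n ((coxB n).wordProd (l.map signChangeWord).flatten) x i
        = if i ∈ l.map Fin.val then - x i else x i := by
    intro l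
    induction l with
    | nil =>
      intro _ i
      simp only [List.map_nil, List.flatten_nil, CoxeterSystem.wordProd_nil, map_one,
        List.not_mem_nil, if_false]
      rfl
    | cons k l ih =>
      intro hl i
      rw [List.nodup_cons] at hl
      rw [List.map_cons, List.flatten_cons, CoxeterSystem.wordProd_append, map_mul,
        signedAction_signChangeWord]
      change signChange signedPerm k _ i = _
      rw [signChange_signedPerm, Function.update_apply, ih hl.2, ih hl.2]
      have hk : (k : ℕ) ∉ l.map Fin.val := by
        rw [List.mem_map]
        rintro ⟨a, ha, hak⟩
        exact hl.1 (Fin.ext hak ▸ ha)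
      rw [if_neg hk]
      by_cases hik : i = k
      · subst hik; simp
      · simp [hik]
  have h := key (List.finRange (n + 1)).reverse (List.nodup_reverse.2 (List.nodup_finRange _)) i
  rw [List.map_reverse, ← List.ofFn_eq_map] at h
  unfold longestWord
  rw [h, if_pos]
  rw [List.mem_map]
  exact ⟨⟨i, hi⟩, by simp, rfl⟩

/-- Any word for the same element has to create all (n+1)² inversions, one at most per letter, and
`longestWord` has just that many letters. -/
theorem isReduced_longestWord (n : ℕ) : (coxB n).IsReduced (longestWord n) := by
  apply le_antisymm ((coxB n).length_wordProd_le _)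
  obtain ⟨ω, hω, hw⟩ := (coxB n).exists_isReduced ((coxB n).wordProd (longestWord n))
  rw [hw, hω.eq, length_longestWord]
  refine le_trans ?_ (card_inversions_le_length ω)
  rw [← hw]
  apply card_inversions_neg
  intro i hi
  rw [signedAction_longestWord _ _ _ hi]

/-- The last arguments of φ stay those of index `k` through the recursion, so the induction runs
over all `m ≤ k`; the bound also yields `l < k` for the Baxterized letters. -/
theorem forall2_isLetter_phi {n : ℕ} (v : Fin (n + 1) → ℂ) (k m : Fin (n + 1)) (hm : m ≤ k) :
    ∃ L : List (MonoidAlgebra (RatFun (n + 1)) (GroupB n)),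
      List.Forall₂ (IsLetter v) (signChangeWord m) L ∧
        phi v uvar (v k) (uvar k) m = L.prod := by
  induction m using Fin.induction with
  | zero =>
    refine ⟨[baxtT (RatFun (n + 1)) n (v k)], ?_, ?_⟩
    · rw [signChangeWord_zero]
      exact List.Forall₂.cons (Or.inr (Or.inl ⟨rfl, k, rfl⟩)) List.Forall₂.nil
    · simp only [List.prod_cons, List.prod_nil, mul_one]; rfl
  | succ i ih =>
    obtain ⟨L, hL, hprod⟩ := ih (le_trans (Fin.castSucc_lt_succ).le hm)
    refine ⟨baxtS i (v k) (v i.castSucc) (uvar k) (uvar i.castSucc) ::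
      (L ++ [gen (RatFun (n + 1)) i.succ]), ?_, ?_⟩
    · rw [signChangeWord_succ]
      refine List.Forall₂.cons (Or.inr (Or.inr ⟨i, rfl, k, i.castSucc, ?_, rfl⟩)) ?_
      · exact lt_of_lt_of_le Fin.castSucc_lt_succ hm
      · exact List.rel_append hL (List.Forall₂.cons (Or.inl rfl) List.Forall₂.nil)
    · rw [List.prod_cons, List.prod_append, List.prod_singleton, ← hprod, ← mul_assoc]
      rfl

theorem isBaxterizedLongestWord_Phi {n : ℕ} (v : Fin (n + 1) → ℂ) :
    IsBaxterizedLongestWord v (Phi v uvar) := by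
  have key : ∀ l : List (Fin (n + 1)), ∃ L : List (MonoidAlgebra (RatFun (n + 1)) (GroupB n)),
      List.Forall₂ (IsLetter v) (l.map signChangeWord).flatten L ∧
        (l.map fun k => phi v uvar (v k) (uvar k) k).prod = L.prod := by
    intro l
    induction l with
    | nil => exact ⟨[], List.Forall₂.nil, rfl⟩
    | cons k l ih =>
      obtain ⟨L, hL, hprod⟩ := ih
      obtain ⟨L', hL', hprod'⟩ := forall2_isLetter_phi v k k le_rfl
      refine ⟨L' ++ L, ?_, ?_⟩
      · rw [List.map_cons, List.flatten_cons]; exact List.rel_append hL' hL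
      · rw [List.map_cons, List.prod_cons, List.prod_append, hprod, hprod']
  obtain ⟨L, hL, hprod⟩ := key (List.finRange (n + 1)).reverse
  refine ⟨longestWord n, L, isReduced_longestWord n, ?_, ?_, ?_⟩
  · intro w
    rw [(isReduced_longestWord n).eq, length_longestWord]
    exact length_le_sq w
  · unfold longestWord
    rw [List.ofFn_eq_map, ← List.map_reverse]
    exact hL
  · unfold Phi
    rw [List.ofFn_eq_map, ← List.map_reverse]
    exact hprod

end FusionB

/-! ### Standard 2-tableaux as sequences of nodes -/

namespace FusionB

/-- The content of a node, as an integer. -/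
def cont (α : Fin 2 × ℕ × ℕ) : ℤ := (α.2.2 : ℤ) - α.2.1

/-- A sequence of nodes that numbers the nodes of a standard 2-tableau. -/
def IsStandard {m : ℕ} (x : Fin m → Fin 2 × ℕ × ℕ) : Prop :=
  Function.Injective x ∧ ∀ a r c, r ≤ (x a).2.1 → c ≤ (x a).2.2 → ∃ b ≤ a, x b = ((x a).1, r, c)

/-- Two nodes of the same diagram whose contents differ by one. -/
def Near (α β : Fin 2 × ℕ × ℕ) : Prop :=
  α.1 = β.1 ∧ (cont β - cont α = 1 ∨ cont β - cont α = -1)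

namespace StandardTableau

variable {m : ℕ}

/-- The sequence of nodes carrying the numbers `0, 1, …`. -/
def seq (T : StandardTableau m) (a : Fin m) : Fin 2 × ℕ × ℕ := (T.node a).1

theorem seq_injective (T : StandardTableau m) : Function.Injective T.seq :=
  Subtype.val_injective.comp T.node.injective

theorem mem_shape_iff (T : StandardTableau m) (k : Fin 2) (c : ℕ × ℕ) :
    c ∈ T.shape k ↔ ∃ a, T.seq a = (k, c) := by
  constructor
  · intro h
    refine ⟨T.node.symm ⟨(k, c), h⟩, ?_⟩
    simp [seq]
  · rintro ⟨a, ha⟩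
    have := (T.node a).2
    change (T.seq a).2 ∈ T.shape (T.seq a).1 at this
    rwa [ha] at this

theorem seq_row_lt (T : StandardTableau m) {a b : Fin m} {k : Fin 2} {r c d : ℕ}
    (ha : T.seq a = (k, r, c)) (hb : T.seq b = (k, r, d)) (h : c < d) : a < b := by
  apply T.row_lt <;> simp only [seq] at ha hb <;> rw [ha, hb]
  exact h

theorem seq_col_lt (T : StandardTableau m) {a b : Fin m} {k : Fin 2} {r s c : ℕ}
    (ha : T.seq a = (k, r, c)) (hb : T.seq b = (k, s, c)) (h : r < s) : a < b := by
  apply T.col_lt <;> simp only [seq] at ha hb <;> rw [ha, hb]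
  exact h

theorem isStandard_seq (T : StandardTableau m) : IsStandard T.seq := by
  refine ⟨T.seq_injective, fun a r c hr hc => ?_⟩
  have hmem : ((T.seq a).2.1, (T.seq a).2.2) ∈ T.shape (T.seq a).1 := (T.node a).2
  obtain ⟨b, hb⟩ := (T.mem_shape_iff _ _).1 ((T.shape (T.seq a).1).up_left_mem hr hc hmem)
  obtain ⟨d, hd⟩ := (T.mem_shape_iff _ _).1 ((T.shape (T.seq a).1).up_left_mem hr le_rfl hmem)
  refine ⟨b, ?_, hb⟩
  have h1 : b ≤ d := by
    rcases hc.eq_or_lt with h | h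
    · exact (T.seq_injective (by rw [hb, hd, h])).le
    · exact (T.seq_row_lt hb hd h).le
  have h2 : d ≤ a := by
    rcases hr.eq_or_lt with h | h
    · exact (T.seq_injective (by rw [hd, h])).le
    · exact (T.seq_col_lt hd rfl h).le
  exact h1.trans h2

theorem le_of_node_le (T : StandardTableau m) {a b : Fin m} (h0 : (T.seq a).1 = (T.seq b).1)
    (h1 : (T.seq a).2.1 ≤ (T.seq b).2.1) (h2 : (T.seq a).2.2 ≤ (T.seq b).2.2) : a ≤ b := by
  obtain ⟨c, hc, he⟩ := T.isStandard_seq.2 b _ _ h1 h2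
  rw [← h0] at he
  exact T.seq_injective he ▸ hc

theorem exists_seq_eq (T : StandardTableau m) (a : Fin m) {r c : ℕ} (h1 : r ≤ (T.seq a).2.1)
    (h2 : c ≤ (T.seq a).2.2) : ∃ b ≤ a, T.seq b = ((T.seq a).1, r, c) :=
  T.isStandard_seq.2 a r c h1 h2

/-- The standard 2-tableau with a given sequence of nodes. -/
noncomputable def ofSeq (x : Fin m → Fin 2 × ℕ × ℕ) (hx : IsStandard x) : StandardTableau m where
  shape k :=
    { cells := (Finset.univ.filter fun a => (x a).1 = k).image fun a => (x a).2
      isLowerSet := by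
        rintro ⟨i, j⟩ ⟨r, c⟩ hle h
        simp only [Finset.coe_image, Finset.coe_filter, Finset.mem_univ, true_and, Set.mem_image,
          Set.mem_ofPred_eq] at h ⊢
        obtain ⟨a, rfl, ha⟩ := h
        obtain ⟨b, -, hb⟩ := hx.2 a r c (by rw [ha]; exact hle.1) (by rw [ha]; exact hle.2)
        exact ⟨b, by rw [hb], by rw [hb]⟩ }
  node := Equiv.ofBijective (fun a => ⟨x a, by
      change _ ∈ Finset.image _ _
      exact Finset.mem_image.2 ⟨a, by simp, rfl⟩⟩) (by
    constructor
    · intro a b h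
      exact hx.1 (congrArg Subtype.val h)
    · rintro ⟨⟨k, c⟩, hc⟩
      obtain ⟨a, ha, rfl⟩ := Finset.mem_image.1 (YoungDiagram.mem_cells _ |>.2 hc)
      refine ⟨a, Subtype.ext ?_⟩
      simp only [Finset.mem_filter, Finset.mem_univ, true_and] at ha
      exact Prod.ext ha rfl)
  row_lt a b h0 h1 h2 := by
    change (x a).1 = (x b).1 at h0
    change (x a).2.1 = (x b).2.1 at h1
    change (x a).2.2 < (x b).2.2 at h2
    obtain ⟨c, hc, he⟩ := hx.2 b _ _ h1.le h2.le
    rw [← h0] at he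
    have : c = a := hx.1 he
    subst this
    refine lt_of_le_of_ne hc ?_
    rintro rfl
    exact lt_irrefl _ h2
  col_lt a b h0 h1 h2 := by
    change (x a).1 = (x b).1 at h0
    change (x a).2.2 = (x b).2.2 at h1
    change (x a).2.1 < (x b).2.1 at h2
    obtain ⟨c, hc, he⟩ := hx.2 b _ _ h2.le h1.le
    rw [← h0] at he
    have : c = a := hx.1 he
    subst this
    refine lt_of_le_of_ne hc ?_
    rintro rfl
    exact lt_irrefl _ h2

@[simp] theorem seq_ofSeq (x : Fin m → Fin 2 × ℕ × ℕ) (hx : IsStandard x) :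
    (ofSeq x hx).seq = x := rfl

theorem seq_ext {T S : StandardTableau m} (h : T.seq = S.seq) : T = S := by
  have hs : T.shape = S.shape := by
    funext k
    apply YoungDiagram.ext
    ext c
    rw [YoungDiagram.mem_cells, YoungDiagram.mem_cells, mem_shape_iff, mem_shape_iff, h]
  obtain ⟨shT, nT, _, _⟩ := T
  obtain ⟨shS, nS, _, _⟩ := S
  obtain rfl : shT = shS := hs
  obtain rfl : nT = nS := by
    ext1 a
    exact Subtype.ext (congrFun h a)
  rfl

theorem row_le (T : StandardTableau m) (a : Fin m) : (T.seq a).2.1 ≤ a := by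
  have : ∀ r (a : Fin m), (T.seq a).2.1 = r → r ≤ a := by
    intro r
    induction r with
    | zero => intro a _; omega
    | succ r ih =>
      intro a ha
      obtain ⟨b, hb, he⟩ := T.exists_seq_eq a (r := r) (by omega) le_rfl
      have h1 := ih b (by rw [he])
      have h2 : b ≠ a := by
        rintro rfl
        rw [he] at ha
        simp at ha
      have := lt_of_le_of_ne hb h2
      have h3 : (b : ℕ) < a := this
      omega
  exact this _ a rfl

theorem col_le (T : StandardTableau m) (a : Fin m) : (T.seq a).2.2 ≤ a := by
  have : ∀ r (a : Fin m), (T.seq a).2.2 = r → r ≤ a := by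
    intro r
    induction r with
    | zero => intro a _; omega
    | succ r ih =>
      intro a ha
      obtain ⟨b, hb, he⟩ := T.exists_seq_eq a (c := r) le_rfl (by omega)
      have h1 := ih b (by rw [he])
      have h2 : b ≠ a := by
        rintro rfl
        rw [he] at ha
        simp at ha
      have := lt_of_le_of_ne hb h2
      have h3 : (b : ℕ) < a := this
      omega
  exact this _ a rfl

instance : Finite (StandardTableau m) := by
  apply Finite.of_injective (β := Fin m → Fin 2 × Fin m × Fin m)
    (fun T a => ((T.seq a).1, ⟨_, (T.row_le a).trans_lt a.2⟩, ⟨_, (T.col_le a).trans_lt a.2⟩))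
  intro T S h
  apply seq_ext
  funext a
  have := congrFun h a
  simp only [Prod.mk.injEq, Fin.mk.injEq] at this
  exact Prod.ext this.1 (Prod.ext this.2.1 this.2.2)

noncomputable instance : Fintype (StandardTableau m) := Fintype.ofFinite _

noncomputable instance : DecidableEq (StandardTableau m) := Classical.decEq _

/-- Positions and contents determine a standard 2-tableau. -/
theorem seq_eq_of_cont_eq (T S : StandardTableau m) (k : ℕ)
    (h : ∀ a : Fin m, (a : ℕ) < k → (T.seq a).1 = (S.seq a).1 ∧ cont (T.seq a) = cont (S.seq a))
    (a : Fin m) (ha : (a : ℕ) < k) : T.seq a = S.seq a := by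
  -- If the node of `a` in `T` lies weakly to the north-west of that in `S` and in a higher row,
  -- then in `S` it carries a number smaller than `a`, where both tableaux agree. Two different
  -- nodes of equal content in one diagram are always in such a position.
  have key : ∀ (T S : StandardTableau m) (a : Fin m), (∀ b < a, T.seq b = S.seq b) →
      (T.seq a).1 = (S.seq a).1 → (T.seq a).2.1 < (S.seq a).2.1 →
      (T.seq a).2.2 ≤ (S.seq a).2.2 → False := by
    intro T S a hb h0 h1 h2
    obtain ⟨b, hba, he⟩ := S.exists_seq_eq a h1.le h2
    rw [← h0] at he
    rcases hba.eq_or_lt with rfl | hlt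
    · rw [he] at h1
      exact lt_irrefl _ h1
    · rw [← hb b hlt] at he
      exact hlt.ne (T.seq_injective he)
  induction a using WellFoundedLT.induction with
  | ind a ih =>
    have hb : ∀ b < a, T.seq b = S.seq b := fun b hb => ih b hb (lt_trans hb ha)
    obtain ⟨h0, h1⟩ := h a ha
    unfold cont at h1
    rcases lt_trichotomy (T.seq a).2.1 (S.seq a).2.1 with hlt | heq | hlt
    · exact (key T S a hb h0 hlt (by omega)).elim
    · exact Prod.ext h0 (Prod.ext heq (by omega))
    · exact (key S T a (fun b h => (hb b h).symm) h0.symm hlt (by omega)).elim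

/-- Consecutive nodes of one diagram have different contents. -/
theorem cont_ne (T : StandardTableau m) {a b : Fin m} (hab : a < b) (hb : (b : ℕ) ≤ a + 2)
    (h : (T.seq a).1 = (T.seq b).1) : cont (T.seq a) ≠ cont (T.seq b) := by
  intro hc
  unfold cont at hc
  have hlt : (T.seq a).2.1 < (T.seq b).2.1 := by
    by_contra hle
    exact absurd (T.le_of_node_le h.symm (by omega) (by omega)) (not_le.2 hab)
  -- The node of `b` lies strictly to the south-east of that of `a` on the same diagonal. The right
  -- and lower neighbours of the node of `a` then carry two different numbers strictly between `a`
  -- and `b`, so `b` is at least `a + 3`.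
  obtain ⟨c, hcb, hce⟩ := T.exists_seq_eq b (r := (T.seq a).2.1) (c := (T.seq a).2.2 + 1)
    (by omega) (by omega)
  obtain ⟨d, hdb, hde⟩ := T.exists_seq_eq b (r := (T.seq a).2.1 + 1) (c := (T.seq a).2.2)
    (by omega) (by omega)
  have hac : a ≤ c := T.le_of_node_le (by rw [hce, h]) (by rw [hce]) (by rw [hce]; simp)
  have had : a ≤ d := T.le_of_node_le (by rw [hde, h]) (by rw [hde]; simp) (by rw [hde])
  have n1 : a ≠ c := by rintro rfl; have := congrArg (·.2.2) hce; simp at this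
  have n2 : a ≠ d := by rintro rfl; have := congrArg (·.2.1) hde; simp at this
  have n3 : b ≠ c := by rintro rfl; have := congrArg (·.2.1) hce; simp at this; omega
  have n4 : b ≠ d := by
    rintro rfl
    have h5 := congrArg (·.2.2) hde
    simp at h5
    omega
  have n5 : c ≠ d := by rintro rfl; rw [hce] at hde; simp at hde
  rw [Ne, Fin.ext_iff] at n1 n2 n3 n4 n5
  rw [Fin.le_def] at hac had hcb hdb
  omega

theorem isSwap_iff {n : ℕ} {i : Fin n} {T S : StandardTableau (n + 1)} :
    T.IsSwap i S ↔ S.seq = T.seq ∘ Equiv.swap i.castSucc i.succ :=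
  ⟨fun h => funext h, fun h => congrFun h⟩

/-- Consecutive numbers can be exchanged unless their nodes are adjacent. -/
theorem exists_isSwap_iff {n : ℕ} {i : Fin n} {T : StandardTableau (n + 1)} :
    (∃ S, T.IsSwap i S) ↔ ¬ Near (T.seq i.castSucc) (T.seq i.succ) := by
  have hlt : i.castSucc < i.succ := Fin.castSucc_lt_succ
  constructor
  · rintro ⟨S, hS⟩ ⟨h0, h1⟩
    have e1 : S.seq i.castSucc = T.seq i.succ := by
      rw [isSwap_iff.1 hS]; simp
    have e2 : S.seq i.succ = T.seq i.castSucc := by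
      rw [isSwap_iff.1 hS]; simp
    unfold cont at h1
    rcases le_or_gt (T.seq i.castSucc).2.1 (T.seq i.succ).2.1 with hr | hr
    · rcases le_or_gt (T.seq i.castSucc).2.2 (T.seq i.succ).2.2 with hc | hc
      · exact absurd (S.le_of_node_le (a := i.succ) (b := i.castSucc) (by rw [e1, e2, h0])
          (by rw [e1, e2]; exact hr) (by rw [e1, e2]; exact hc)) (not_le.2 hlt)
      · exact absurd (T.le_of_node_le h0.symm (by omega) (by omega)) (not_le.2 hlt)
    · exact absurd (T.le_of_node_le h0.symm (by omega) (by omega)) (not_le.2 hlt)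
  · intro hnear
    refine ⟨ofSeq (T.seq ∘ Equiv.swap i.castSucc i.succ) ⟨T.seq_injective.comp
      (Equiv.injective _), ?_⟩, isSwap_iff.2 rfl⟩
    intro a r c hr hc
    obtain ⟨b, hb, he⟩ := T.exists_seq_eq (Equiv.swap i.castSucc i.succ a) hr hc
    refine ⟨Equiv.swap i.castSucc i.succ b, ?_, by simpa using he⟩
    -- The exchange reverses the order of only one pair of numbers, so standardness can only fail if
    -- the node of i lies to the north-west of that of i+1.
    by_cases hbad : a = i.castSucc ∧ b = i.castSucc
    · exfalso
      obtain ⟨rfl, rfl⟩ := hbad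
      simp only [Function.comp_apply, Equiv.swap_apply_left] at hr hc he hb
      apply hnear
      have hne : T.seq i.castSucc ≠ T.seq i.succ := fun h => hlt.ne (T.seq_injective h)
      -- A node of the rectangle spanned by the two nodes carries a number between i and i+1. The
      -- rectangle therefore has no third node, and its corners are adjacent.
      have hbet : ∀ r' c', r ≤ r' → c ≤ c' → r' ≤ (T.seq i.succ).2.1 → c' ≤ (T.seq i.succ).2.2 →
          (r' = r ∧ c' = c) ∨ (r' = (T.seq i.succ).2.1 ∧ c' = (T.seq i.succ).2.2) := by
        intro r' c' h1 h2 h3 h4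
        obtain ⟨d, hd, hde⟩ := T.exists_seq_eq i.succ h3 h4
        have hid : i.castSucc ≤ d :=
          T.le_of_node_le (by rw [he, hde]) (by rw [he, hde]; exact h1) (by rw [he, hde]; exact h2)
        have : d = i.castSucc ∨ d = i.succ := by
          rw [Fin.le_def] at hid hd
          rw [Fin.ext_iff, Fin.ext_iff]
          simp only [Fin.val_castSucc, Fin.val_succ] at hid hd ⊢
          omega
        rcases this with rfl | rfl
        · left
          rw [he] at hde
          simp only [Prod.mk.injEq, true_and] at hde
          exact ⟨hde.1.symm, hde.2.symm⟩
        · right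
          have := congrArg Prod.snd hde
          rw [this]
          exact ⟨rfl, rfl⟩
      refine ⟨by rw [he], ?_⟩
      unfold cont
      rw [he]
      have hne' : ¬ (r = (T.seq i.succ).2.1 ∧ c = (T.seq i.succ).2.2) := by
        rintro ⟨rfl, rfl⟩
        exact hne he
      simp only
      rcases hr.eq_or_lt with h | h
      · have := hbet r (c + 1) le_rfl (by omega) hr (by omega)
        omega
      · have := hbet (r + 1) c (by omega) le_rfl (by omega) hc
        omega
    · rw [Equiv.swap_apply_def] at hb ⊢
      simp only [Fin.le_def, Fin.ext_iff] at hb hbad ⊢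
      split_ifs at hb ⊢ <;> simp only [Fin.val_castSucc, Fin.val_succ] at * <;> omega

/-- The tableau without its largest number. -/
noncomputable def restrict (T : StandardTableau (m + 1)) : StandardTableau m :=
  ofSeq (T.seq ∘ Fin.castSucc) ⟨T.seq_injective.comp (Fin.castSucc_injective m), by
    intro a r c hr hc
    obtain ⟨b, hb, he⟩ := T.exists_seq_eq a.castSucc hr hc
    have hb' : (b : ℕ) < m := lt_of_le_of_lt hb a.2
    exact ⟨⟨b, hb'⟩, hb, he⟩⟩

@[simp] theorem seq_restrict (T : StandardTableau (m + 1)) (a : Fin m) :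
    T.restrict.seq a = T.seq a.castSucc := rfl

theorem eq_of_restrict_eq {T S : StandardTableau (m + 1)} (h : T.restrict = S.restrict)
    (hl : T.seq (Fin.last m) = S.seq (Fin.last m)) : T = S := by
  apply seq_ext
  funext a
  refine Fin.lastCases hl (fun a => ?_) a
  exact congrFun (congrArg seq h) a

/-- The number of nodes with numbers less than `k` in row `i` of the diagram `κ`. -/
def rows (T : StandardTableau m) (k : ℕ) (κ : Fin 2) (i : ℕ) : ℕ :=
  (Finset.univ.filter fun a : Fin m => (a : ℕ) < k ∧ (T.seq a).1 = κ ∧ (T.seq a).2.1 = i).card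

/-- The columns occupied in a row form an initial segment of ℕ, so their number determines them. -/
theorem lt_rows_iff (T : StandardTableau m) (k : ℕ) (κ : Fin 2) (i c : ℕ) :
    c < T.rows k κ i ↔ ∃ a : Fin m, (a : ℕ) < k ∧ T.seq a = (κ, i, c) := by
  set A := Finset.univ.filter fun a : Fin m => (a : ℕ) < k ∧ (T.seq a).1 = κ ∧ (T.seq a).2.1 = i
    with hA
  set C := A.image fun a => (T.seq a).2.2 with hC
  have hmem : ∀ c, c ∈ C ↔ ∃ a : Fin m, (a : ℕ) < k ∧ T.seq a = (κ, i, c) := by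
    intro c
    rw [hC, Finset.mem_image]
    constructor
    · rintro ⟨a, ha, rfl⟩
      simp only [hA, Finset.mem_filter, Finset.mem_univ, true_and] at ha
      exact ⟨a, ha.1, Prod.ext ha.2.1 (Prod.ext ha.2.2 rfl)⟩
    · rintro ⟨a, ha, he⟩
      refine ⟨a, ?_, by rw [he]⟩
      simp only [hA, Finset.mem_filter, Finset.mem_univ, true_and]
      rw [he]
      exact ⟨ha, rfl, rfl⟩
  have hcard : T.rows k κ i = C.card := by
    rw [hC, Finset.card_image_of_injOn]
    · rfl
    · intro a ha b hb hab
      simp only [hA, Finset.coe_filter, Finset.mem_univ, true_and, Set.mem_ofPred_eq] at ha hb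
      exact T.seq_injective (Prod.ext (ha.2.1.trans hb.2.1.symm)
        (Prod.ext (ha.2.2.trans hb.2.2.symm) hab))
  have hdown : ∀ c ∈ C, ∀ d ≤ c, d ∈ C := by
    intro c hc d hd
    obtain ⟨a, ha, he⟩ := (hmem c).1 hc
    obtain ⟨b, hb, hbe⟩ := T.exists_seq_eq a (r := i) (c := d) (by rw [he]) (by rw [he]; exact hd)
    exact (hmem d).2 ⟨b, lt_of_le_of_lt hb ha, by rw [hbe, he]⟩
  rw [hcard, ← hmem]
  constructor
  · intro h
    by_contra hc
    have : C ⊆ Finset.range c := by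
      intro d hd
      rw [Finset.mem_range]
      by_contra hle
      exact hc (hdown d hd c (by omega))
    have := Finset.card_le_card this
    rw [Finset.card_range] at this
    omega
  · intro h
    have : Finset.range (c + 1) ⊆ C := by
      intro d hd
      exact hdown c h d (by rw [Finset.mem_range] at hd; omega)
    have := Finset.card_le_card this
    rw [Finset.card_range] at this
    omega

theorem rows_antitone (T : StandardTableau m) (k : ℕ) (κ : Fin 2) : Antitone (T.rows k κ) := by
  intro i j hij
  by_contra h
  rw [not_le, lt_rows_iff] at h
  obtain ⟨a, ha, he⟩ := h
  obtain ⟨b, hb, hbe⟩ := T.exists_seq_eq a (r := i) (c := T.rows k κ i) (by rw [he]; exact hij)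
    (by rw [he])
  rw [he] at hbe
  exact lt_irrefl _ ((T.lt_rows_iff k κ i _).2 ⟨b, lt_of_le_of_lt hb ha, hbe⟩)

theorem col_eq_rows (T : StandardTableau m) (a : Fin m) :
    (T.seq a).2.2 = T.rows a (T.seq a).1 (T.seq a).2.1 := by
  apply eq_of_forall_lt_iff
  intro c
  rw [lt_rows_iff]
  constructor
  · intro hc
    obtain ⟨b, hb, he⟩ := T.exists_seq_eq a (c := c) le_rfl hc.le
    refine ⟨b, ?_, he⟩
    refine lt_of_le_of_ne hb fun h => ?_
    rw [Fin.val_inj] at h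
    subst h
    rw [he] at hc
    exact lt_irrefl _ hc
  · rintro ⟨b, hb, he⟩
    by_contra hle
    have : a ≤ b := T.le_of_node_le (by rw [he]) (by rw [he]) (by rw [he]; exact not_lt.1 hle)
    rw [Fin.le_def] at this
    omega

theorem rows_succ (T : StandardTableau m) (a : Fin m) (κ : Fin 2) (i : ℕ) :
    T.rows (a + 1) κ i = T.rows a κ i + if (T.seq a).1 = κ ∧ (T.seq a).2.1 = i then 1 else 0 := by
  have hset : (Finset.univ.filter fun b : Fin m =>
      (b : ℕ) < a + 1 ∧ (T.seq b).1 = κ ∧ (T.seq b).2.1 = i) =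
      (Finset.univ.filter fun b : Fin m => (b : ℕ) < a ∧ (T.seq b).1 = κ ∧ (T.seq b).2.1 = i) ∪
      (Finset.univ.filter fun b : Fin m => b = a ∧ (T.seq a).1 = κ ∧ (T.seq a).2.1 = i) := by
    ext b
    simp only [Finset.mem_filter, Finset.mem_univ, true_and, Finset.mem_union]
    constructor
    · rintro ⟨h1, h2⟩
      rcases (Nat.lt_succ_iff.1 h1).eq_or_lt with h | h
      · rw [Fin.val_inj] at h
        subst h
        exact Or.inr ⟨rfl, h2⟩
      · exact Or.inl ⟨h, h2⟩
    · rintro (⟨h1, h2⟩ | ⟨rfl, h2⟩)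
      · exact ⟨by omega, h2⟩
      · exact ⟨by omega, h2⟩
  unfold rows
  rw [hset, Finset.card_union_of_disjoint]
  · congr 1
    split_ifs with h
    · rw [Finset.card_eq_one]
      exact ⟨a, by ext b; simp [h]⟩
    · rw [Finset.card_eq_zero, Finset.filter_eq_empty_iff]
      rintro b - ⟨_, hb⟩
      exact h hb
  · rw [Finset.disjoint_left]
    intro b hb hb'
    simp only [Finset.mem_filter, Finset.mem_univ, true_and] at hb hb'
    rw [hb'.1] at hb
    exact lt_irrefl _ hb.1

theorem rows_eq_rowLen (T : StandardTableau m) (κ : Fin 2) (i : ℕ) :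
    T.rows m κ i = (T.shape κ).rowLen i := by
  apply eq_of_forall_lt_iff
  intro c
  rw [lt_rows_iff, ← YoungDiagram.mem_iff_lt_rowLen, mem_shape_iff]
  exact ⟨fun ⟨a, _, h⟩ => ⟨a, h⟩, fun ⟨a, h⟩ => ⟨a, a.2, h⟩⟩

theorem rows_eq_zero (T : StandardTableau m) (k : ℕ) (κ : Fin 2) {i : ℕ} (hi : m ≤ i) :
    T.rows k κ i = 0 := by
  by_contra h
  obtain ⟨a, _, he⟩ := (T.lt_rows_iff k κ i 0).1 (Nat.pos_of_ne_zero h)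
  have := T.row_le a
  rw [he] at this
  have := a.2
  simp only at *
  omega

theorem rows_congr {T S : StandardTableau m} {k : ℕ}
    (h : ∀ a : Fin m, (a : ℕ) < k → T.seq a = S.seq a) (κ : Fin 2) (i : ℕ) :
    T.rows k κ i = S.rows k κ i := by
  unfold rows
  congr 1
  ext a
  simp only [Finset.mem_filter, Finset.mem_univ, true_and]
  constructor
  · rintro ⟨h1, h2⟩; rw [h a h1] at h2; exact ⟨h1, h2⟩
  · rintro ⟨h1, h2⟩; rw [← h a h1] at h2; exact ⟨h1, h2⟩

theorem rows_restrict (T : StandardTableau (m + 1)) (κ : Fin 2) (i : ℕ) :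
    T.restrict.rows m κ i = T.rows m κ i := by
  apply eq_of_forall_lt_iff
  intro c
  rw [lt_rows_iff, lt_rows_iff]
  constructor
  · rintro ⟨a, ha, he⟩; exact ⟨a.castSucc, ha, he⟩
  · rintro ⟨a, ha, he⟩; exact ⟨⟨a, ha⟩, ha, he⟩

/-- A number is added at an inner corner. -/
theorem rows_lt_of_lt (T : StandardTableau m) (a : Fin m) {j : ℕ} (hj : j < (T.seq a).2.1) :
    T.rows a (T.seq a).1 (T.seq a).2.1 < T.rows a (T.seq a).1 j := by
  have h := T.rows_antitone (a + 1) (T.seq a).1 hj.le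
  rw [rows_succ, rows_succ, if_pos ⟨rfl, rfl⟩, if_neg (by omega)] at h
  omega

/-- Every inner corner of a tableau can take the next number. -/
theorem exists_extend (U : StandardTableau m) (κ : Fin 2) (i : ℕ)
    (h : ∀ j < i, U.rows m κ i < U.rows m κ j) :
    ∃ S : StandardTableau (m + 1), S.restrict = U ∧ S.seq (Fin.last m) = (κ, i, U.rows m κ i) := by
  have hx : IsStandard (Fin.snoc (α := fun _ => Fin 2 × ℕ × ℕ) U.seq (κ, i, U.rows m κ i)) := by
    have hnot : ∀ a, U.seq a ≠ (κ, i, U.rows m κ i) := by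
      intro a ha
      exact lt_irrefl _ ((U.lt_rows_iff m κ i _).2 ⟨a, a.2, ha⟩)
    constructor
    · intro a b
      refine Fin.lastCases ?_ (fun a => ?_) a <;> refine Fin.lastCases ?_ (fun b => ?_) b
      · intro _; rfl
      · simp only [Fin.snoc_last, Fin.snoc_castSucc]
        intro hab
        exact (hnot _ hab.symm).elim
      · simp only [Fin.snoc_last, Fin.snoc_castSucc]
        intro hab
        exact (hnot _ hab).elim
      · simp only [Fin.snoc_castSucc]
        intro hab
        rw [U.seq_injective hab]
    · intro a
      refine Fin.lastCases ?_ (fun a => ?_) a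
      · simp only [Fin.snoc_last]
        intro r c hr hc
        by_cases hrc : r = i ∧ c = U.rows m κ i
        · obtain ⟨rfl, rfl⟩ := hrc
          exact ⟨Fin.last m, le_rfl, by rw [Fin.snoc_last]⟩
        · have : c < U.rows m κ r := by
            rcases hr.eq_or_lt with rfl | hlt
            · omega
            · have := h r hlt
              omega
          obtain ⟨b, _, hb⟩ := (U.lt_rows_iff m κ r c).1 this
          exact ⟨b.castSucc, Fin.le_last _, by rw [Fin.snoc_castSucc, hb]⟩
      · simp only [Fin.snoc_castSucc]
        intro r c hr hc
        obtain ⟨b, hb, he⟩ := U.exists_seq_eq a hr hc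
        exact ⟨b.castSucc, hb, by rw [Fin.snoc_castSucc, he]⟩
  refine ⟨ofSeq _ hx, ?_, ?_⟩
  · apply seq_ext
    funext a
    simp
  · simp

end StandardTableau

end FusionB

/-! ### The seminormal operators and their relations -/

namespace FusionB

open StandardTableau

instance {α β : Fin 2 × ℕ × ℕ} : Decidable (Near α β) := by unfold Near; infer_instance

theorem near_comm {α β : Fin 2 × ℕ × ℕ} : Near α β ↔ Near β α := by
  unfold Near
  constructor <;> rintro ⟨h, h'⟩ <;> exact ⟨h.symm, by omega⟩

section Coefficients

variable (K : Type) [Field K]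

/-- The diagonal coefficient of the seminormal form. -/
noncomputable def dcoef (α β : Fin 2 × ℕ × ℕ) : K :=
  if α.1 = β.1 then ((cont β - cont α : ℤ) : K)⁻¹ else 0

/-- The off-diagonal coefficient of the seminormal form. -/
noncomputable def gcoef (α β : Fin 2 × ℕ × ℕ) : K := if Near α β then 0 else 1 + dcoef K α β

variable {K}

theorem dcoef_comm (α β : Fin 2 × ℕ × ℕ) : dcoef K β α = -dcoef K α β := by
  unfold dcoef
  by_cases h : α.1 = β.1
  · rw [if_pos h, if_pos h.symm, ← inv_neg]; push_cast; congr 1; ring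
  · rw [if_neg h, if_neg (Ne.symm h), neg_zero]

/-- For adjacent contents in one diagram d = ±1, so the right side vanishes together with the
coefficients set to zero on the left. -/
theorem gcoef_mul_gcoef (α β : Fin 2 × ℕ × ℕ) :
    gcoef K α β * gcoef K β α = 1 - dcoef K α β ^ 2 := by
  unfold gcoef
  by_cases h : Near α β
  · rw [if_pos h, zero_mul]
    obtain ⟨h0, h1 | h1⟩ := h <;> simp [dcoef, h0, h1]
  · rw [if_neg h, if_neg (fun h' => h (near_comm.1 h')), dcoef_comm α β]; ring

/-- Within one diagram this is 1/(x+y) · (1/x + 1/y) = 1/x · 1/y. If the three nodes do not share a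
diagram, both sides vanish. -/
theorem dcoef_mul_add [CharZero K] {α β γ : Fin 2 × ℕ × ℕ} (h1 : α.1 = β.1 → cont α ≠ cont β)
    (h2 : β.1 = γ.1 → cont β ≠ cont γ) (h3 : α.1 = γ.1 → cont α ≠ cont γ) :
    dcoef K α γ * (dcoef K α β + dcoef K β γ) = dcoef K α β * dcoef K β γ := by
  have hne : ∀ {a b : ℤ}, a ≠ b → ((b - a : ℤ) : K) ≠ 0 := fun h =>
    Int.cast_ne_zero.2 (sub_ne_zero.2 h.symm)
  unfold dcoef
  by_cases hab : α.1 = β.1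
  · by_cases hbc : β.1 = γ.1
    · have hac := hab.trans hbc
      have e1 := hne (h1 hab)
      have e2 := hne (h2 hbc)
      have e3 := hne (h3 hac)
      rw [if_pos hab, if_pos hbc, if_pos hac]
      field_simp
      push_cast
      ring
    · have hac : α.1 ≠ γ.1 := fun h => hbc (hab.symm.trans h)
      simp [hbc, hac]
  · by_cases hbc : β.1 = γ.1
    · have hac : α.1 ≠ γ.1 := fun h => hab (h.trans hbc.symm)
      simp [hab, hac]
    · simp [hab, hbc]

end Coefficients

/-- The braid relation on one vector, in terms of its orbit of six under two adjacent exchanges.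
Nothing is assumed about independence, so vectors of non-standard sequences may be zero. -/
theorem braid_of_seminormal {K V : Type*} [Field K] [AddCommGroup V] [Module K V]
    {A B : Module.End K V} {x y₁ y₂ y₃ z₁ z₂ : V} {a b c g₁ g₁' g₂ g₂' g₃ : K}
    (hA : A x = a • x + g₁ • y₁) (hA₁ : A y₁ = (-a) • y₁ + g₁' • x) (hA₂ : A y₂ = b • y₂ + g₂ • y₃)
    (hAz : A z₁ = c • z₁ + g₃ • z₂) (hB : B x = b • x + g₂ • z₁) (hB₁ : B y₁ = c • y₁ + g₃ • y₂)
    (hBz : B z₁ = (-b) • z₁ + g₂' • x) (hBz₂ : B z₂ = a • z₂ + g₁ • y₃)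
    (hg₁ : g₁ * g₁' = 1 - a ^ 2) (hg₂ : g₂ * g₂' = 1 - b ^ 2) (habc : c * (a + b) = a * b) :
    A (B (A x)) = B (A (B x)) := by
  simp only [hA, hB, map_add, map_smul, hB₁, hAz, hA₁, hA₂, hBz, hBz₂]
  match_scalars
  · linear_combination (-c) * hg₂ + c * hg₁ + (b - a) * habc
  · linear_combination (-g₁) * habc
  · linear_combination g₂ * habc
  all_goals ring

section Operators

variable (K : Type) [Field K] {n : ℕ}

/-- The basis vector of a sequence of nodes; zero unless the sequence is standard. -/
noncomputable def vec (x : Fin (n + 1) → Fin 2 × ℕ × ℕ) : StandardTableau (n + 1) →₀ K :=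
  open Classical in if h : IsStandard x then Finsupp.single (ofSeq x h) 1 else 0

theorem vec_seq (T : StandardTableau (n + 1)) : vec K T.seq = Finsupp.single T 1 := by
  unfold vec
  rw [dif_pos T.isStandard_seq]
  congr 1
  exact seq_ext rfl

variable {K} in
theorem end_ext {A B : Module.End K (StandardTableau (n + 1) →₀ K)}
    (h : ∀ T : StandardTableau (n + 1), A (vec K T.seq) = B (vec K T.seq)) : A = B := by
  apply Finsupp.lhom_ext'
  intro T
  apply LinearMap.ext_ring
  have := h T
  rw [vec_seq] at this
  exact this

/-- A diagonal operator. -/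
noncomputable def diagOp (f : StandardTableau (n + 1) → K) :
    Module.End K (StandardTableau (n + 1) →₀ K) :=
  Finsupp.linearCombination K fun T => f T • vec K T.seq

/-- The operator of `s_{i+1}` in the seminormal form. -/
noncomputable def swapOp (i : Fin n) : Module.End K (StandardTableau (n + 1) →₀ K) :=
  Finsupp.linearCombination K fun T => dcoef K (T.seq i.castSucc) (T.seq i.succ) • vec K T.seq +
    gcoef K (T.seq i.castSucc) (T.seq i.succ) • vec K (T.seq ∘ Equiv.swap i.castSucc i.succ)

variable {K}

theorem diagOp_vec (f : StandardTableau (n + 1) → K) (T : StandardTableau (n + 1)) :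
    diagOp K f (vec K T.seq) = f T • vec K T.seq := by
  conv_lhs => rw [vec_seq]
  simp [diagOp]

/-- The formula persists for non-standard sequences: if the exchange makes such a sequence standard,
the two nodes are near and `gcoef` is zero. The relations can thus be checked without asking which
exchanges are standard. -/
theorem swapOp_vec (i : Fin n) (x : Fin (n + 1) → Fin 2 × ℕ × ℕ) :
    swapOp K i (vec K x) = dcoef K (x i.castSucc) (x i.succ) • vec K x +
      gcoef K (x i.castSucc) (x i.succ) • vec K (x ∘ Equiv.swap i.castSucc i.succ) := by
  by_cases hx : IsStandard x
  · obtain ⟨T, rfl⟩ : ∃ T : StandardTableau (n + 1), T.seq = x := ⟨ofSeq x hx, rfl⟩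
    conv_lhs => rw [vec_seq]
    simp [swapOp]
  · have h0 : vec K x = 0 := by unfold vec; rw [dif_neg hx]
    rw [h0, map_zero, smul_zero, zero_add]
    by_cases hy : IsStandard (x ∘ Equiv.swap i.castSucc i.succ)
    · have hnear : Near (x i.castSucc) (x i.succ) := by
        by_contra hn
        have hT : (ofSeq _ hy).seq = x ∘ Equiv.swap i.castSucc i.succ := rfl
        obtain ⟨S, hS⟩ := (exists_isSwap_iff (i := i) (T := ofSeq _ hy)).2 (by
          rw [hT]
          simp only [Function.comp_apply, Equiv.swap_apply_left, Equiv.swap_apply_right]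
          exact fun h => hn (near_comm.1 h))
        rw [isSwap_iff, hT] at hS
        apply hx
        have : S.seq = x := by
          rw [hS]; funext a; simp
        rw [← this]
        exact S.isStandard_seq
      rw [gcoef, if_pos hnear, zero_smul]
    · rw [vec, dif_neg hy, smul_zero]

theorem diagOp_node_vec (f : Fin 2 × ℕ × ℕ → K) (a : Fin (n + 1))
    (x : Fin (n + 1) → Fin 2 × ℕ × ℕ) :
    diagOp K (fun T => f (T.seq a)) (vec K x) = f (x a) • vec K x := by
  by_cases hx : IsStandard x
  · obtain ⟨T, rfl⟩ : ∃ T : StandardTableau (n + 1), T.seq = x := ⟨ofSeq x hx, rfl⟩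
    exact diagOp_vec _ T
  · have h0 : vec K x = 0 := by unfold vec; rw [dif_neg hx]
    rw [h0, map_zero, smul_zero]

/-- The operators of the generators `t, s_1, …, s_n`, indexed by the natural numbers. -/
noncomputable def genOp (n : ℕ) (τ : Fin 2 → K) :
    ℕ → Module.End K (StandardTableau (n + 1) →₀ K)
  | 0 => diagOp K fun T => τ (T.seq 0).1
  | m + 1 => if h : m < n then swapOp K ⟨m, h⟩ else 1

theorem swapOp_sq (i : Fin n) : swapOp K i * swapOp K i = 1 := by
  apply end_ext
  intro T
  have hne : i.castSucc ≠ i.succ := Fin.castSucc_lt_succ.ne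
  rw [Module.End.mul_apply, Module.End.one_apply, swapOp_vec, map_add, map_smul, map_smul,
    swapOp_vec, swapOp_vec]
  have h2 : (T.seq ∘ Equiv.swap i.castSucc i.succ) ∘ Equiv.swap i.castSucc i.succ = T.seq := by
    funext a; simp
  rw [h2]
  simp only [Function.comp_apply, Equiv.swap_apply_left, Equiv.swap_apply_right]
  have hg := gcoef_mul_gcoef (K := K) (T.seq i.castSucc) (T.seq i.succ)
  rw [dcoef_comm (T.seq i.castSucc)]
  match_scalars
  · linear_combination hg
  · ring

theorem swapOp_mul_diagOp_pos (f : Fin 2 → K) (i : Fin n) :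
    swapOp K i * diagOp K (fun T => f (T.seq i.succ).1) =
      diagOp K (fun T => f (T.seq i.castSucc).1) * swapOp K i := by
  apply end_ext
  intro T
  have h1 := diagOp_node_vec (K := K) (fun α => f α.1) i.succ
  have h2 := diagOp_node_vec (K := K) (fun α => f α.1) i.castSucc
  simp only [Module.End.mul_apply, h1, h2, swapOp_vec, map_smul, map_add, Function.comp_apply,
    Equiv.swap_apply_left]
  by_cases h : (T.seq i.castSucc).1 = (T.seq i.succ).1
  · rw [h]; module
  · rw [dcoef, if_neg h]; module

/-- The mixed relation of degenerate affine Hecke type between s_i and the Jucys–Murphy operators.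
On the diagonal it is (c_{i+1} - c_i) d = 1, with both sides zero when the two numbers lie in
different diagrams. -/
theorem swapOp_mul_diagOp_cont [CharZero K] (i : Fin n) :
    swapOp K i * diagOp K (fun T => (cont (T.seq i.succ) : K)) =
      diagOp K (fun T => (cont (T.seq i.castSucc) : K)) * swapOp K i +
        diagOp K (fun T => if (T.seq i.castSucc).1 = (T.seq i.succ).1 then 1 else 0) := by
  apply end_ext
  intro T
  have h1 := diagOp_node_vec (K := K) (fun α => (cont α : K)) i.succ
  have h2 := diagOp_node_vec (K := K) (fun α => (cont α : K)) i.castSucc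
  simp only [Module.End.mul_apply, LinearMap.add_apply, h1, h2, diagOp_vec, swapOp_vec, map_smul,
    map_add, Function.comp_apply, Equiv.swap_apply_left]
  by_cases h : (T.seq i.castSucc).1 = (T.seq i.succ).1
  · have hne := T.cont_ne Fin.castSucc_lt_succ (by simp) h
    have hne' : (cont (T.seq i.succ) : K) - cont (T.seq i.castSucc) ≠ 0 := by
      rw [← Int.cast_sub, Int.cast_ne_zero]
      omega
    rw [dcoef, if_pos h, if_pos h]
    push_cast
    match_scalars <;> field_simp
    ring
  · rw [dcoef, if_neg h, if_neg h]; module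

theorem swapOp_mul_diagOp_pos_mul_swapOp (f : Fin 2 → K) (i : Fin n) :
    swapOp K i * diagOp K (fun T => f (T.seq i.castSucc).1) * swapOp K i =
      diagOp K (fun T => f (T.seq i.succ).1) := by
  rw [mul_assoc, ← swapOp_mul_diagOp_pos, ← mul_assoc, swapOp_sq, one_mul]

theorem swapOp_comm {i j : Fin n} (hij : (i : ℕ) + 2 ≤ j) :
    swapOp K i * swapOp K j = swapOp K j * swapOp K i := by
  apply end_ext
  intro T
  have h1 : i.castSucc ≠ j.castSucc := by rw [Ne, Fin.ext_iff]; simp; omega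
  have h2 : i.castSucc ≠ j.succ := by rw [Ne, Fin.ext_iff]; simp; omega
  have h3 : i.succ ≠ j.castSucc := by rw [Ne, Fin.ext_iff]; simp; omega
  have h4 : i.succ ≠ j.succ := by rw [Ne, Fin.ext_iff]; simp; omega
  have hc : (T.seq ∘ Equiv.swap i.castSucc i.succ) ∘ Equiv.swap j.castSucc j.succ =
      (T.seq ∘ Equiv.swap j.castSucc j.succ) ∘ Equiv.swap i.castSucc i.succ := by
    funext a
    simp only [Function.comp_apply]
    congr 1
    simp only [Equiv.swap_apply_def]
    split_ifs <;> simp_all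
  simp only [Module.End.mul_apply, swapOp_vec, map_add, map_smul, Function.comp_apply,
    Equiv.swap_apply_of_ne_of_ne h1 h2, Equiv.swap_apply_of_ne_of_ne h3 h4,
    Equiv.swap_apply_of_ne_of_ne h1.symm h3.symm, Equiv.swap_apply_of_ne_of_ne h2.symm h4.symm, hc]
  module

theorem swapOp_braid [CharZero K] {i j : Fin n} (hij : (i : ℕ) + 1 = j) :
    swapOp K i * swapOp K j * swapOp K i = swapOp K j * swapOp K i * swapOp K j := by
  apply end_ext
  intro T
  have hq : j.castSucc = i.succ := by rw [Fin.ext_iff]; simp; omega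
  have h1 : i.castSucc ≠ i.succ := Fin.castSucc_lt_succ.ne
  have h2 : i.castSucc ≠ j.succ := by rw [Ne, Fin.ext_iff]; simp; omega
  have h3 : i.succ ≠ j.succ := by rw [Ne, Fin.ext_iff]; simp; omega
  have hi := swapOp_vec (K := K) i
  have hj := swapOp_vec (K := K) j
  rw [hq] at hj
  have g1 := T.cont_ne (a := i.castSucc) (b := i.succ) Fin.castSucc_lt_succ (by simp)
  have g2 := T.cont_ne (a := i.succ) (b := j.succ) (by rw [Fin.lt_def]; simp; omega)
    (by simp; omega)
  have g3 := T.cont_ne (a := i.castSucc) (b := j.succ) (by rw [Fin.lt_def]; simp; omega)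
    (by simp; omega)
  set p := i.castSucc
  set q := i.succ
  set r := j.succ
  have epr := Equiv.swap_apply_of_ne_of_ne h1 h2
  have erq := Equiv.swap_apply_of_ne_of_ne h2.symm h3.symm
  set x := T.seq
  change swapOp K i (swapOp K j (swapOp K i (vec K x)))
    = swapOp K j (swapOp K i (swapOp K j (vec K x)))
  have e1 : (x ∘ Equiv.swap p q) ∘ Equiv.swap p q = x := by funext a; simp
  have e2 : (x ∘ Equiv.swap q r) ∘ Equiv.swap q r = x := by funext a; simp
  have e3 : ((x ∘ Equiv.swap q r) ∘ Equiv.swap p q) ∘ Equiv.swap q r =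
      ((x ∘ Equiv.swap p q) ∘ Equiv.swap q r) ∘ Equiv.swap p q := by
    funext a
    simp only [Function.comp_apply]
    congr 1
    simp only [Equiv.swap_apply_def]
    split_ifs <;> simp_all
  apply braid_of_seminormal (a := dcoef K (x p) (x q)) (b := dcoef K (x q) (x r))
    (c := dcoef K (x p) (x r)) (g₁ := gcoef K (x p) (x q)) (g₁' := gcoef K (x q) (x p))
    (g₂ := gcoef K (x q) (x r)) (g₂' := gcoef K (x r) (x q)) (g₃ := gcoef K (x p) (x r))
    (y₁ := vec K (x ∘ Equiv.swap p q)) (y₂ := vec K ((x ∘ Equiv.swap p q) ∘ Equiv.swap q r))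
    (y₃ := vec K (((x ∘ Equiv.swap p q) ∘ Equiv.swap q r) ∘ Equiv.swap p q))
    (z₁ := vec K (x ∘ Equiv.swap q r)) (z₂ := vec K ((x ∘ Equiv.swap q r) ∘ Equiv.swap p q))
  · rw [hi]
  · rw [hi, e1, ← dcoef_comm]; simp
  · rw [hi]; simp [epr, erq]
  · rw [hi]; simp [epr]
  · rw [hj]
  · rw [hj]; simp [erq]
  · rw [hj, e2, ← dcoef_comm]; simp
  · rw [hj, e3]; simp [epr, erq]
  · exact gcoef_mul_gcoef _ _
  · exact gcoef_mul_gcoef _ _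
  · exact dcoef_mul_add g1 g2 g3

theorem relB_genOp [CharZero K] (n : ℕ) {τ : Fin 2 → K} (hτ : ∀ k, τ k ^ 2 = 1) :
    RelB n (genOp n τ) := by
  have hs : ∀ m (h : m < n), genOp n τ (m + 1) = swapOp K ⟨m, h⟩ := fun m h => by
    simp [genOp, h]
  have ht : ∀ x : Fin (n + 1) → Fin 2 × ℕ × ℕ, genOp n τ 0 (vec K x) = τ (x 0).1 • vec K x :=
    fun x => diagOp_node_vec (fun α => τ α.1) 0 x
  refine ⟨?_, ?_, ?_, ?_⟩
  · rintro (_ | m) hm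
    · apply end_ext
      intro T
      rw [Module.End.mul_apply, ht, map_smul, ht, smul_smul, ← pow_two, hτ]
      simp
    · rw [hs m hm]
      exact swapOp_sq _
  · rintro (_ | i) (_ | j) hj hij
    · omega
    · apply end_ext
      intro T
      have h1 : (0 : Fin (n + 1)) ≠ (⟨j, hj⟩ : Fin n).castSucc := by
        rw [Ne, Fin.ext_iff]; simp; omega
      have h2 : (0 : Fin (n + 1)) ≠ (⟨j, hj⟩ : Fin n).succ := by
        rw [Ne, Fin.ext_iff]; simp
      rw [hs j hj]
      simp only [Module.End.mul_apply, swapOp_vec, ht, map_add, map_smul, Function.comp_apply,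
        Equiv.swap_apply_of_ne_of_ne h1 h2]
      module
    · omega
    · rw [hs j hj, hs i (by omega)]
      exact swapOp_comm (by simp; omega)
  · rintro (_ | i) h1 hn
    · omega
    · rw [hs i (by omega), hs (i + 1) (by omega)]
      exact swapOp_braid rfl
  · intro hn
    -- The conjugate s_1 t s_1 is diagonal, giving the position of the number 2, so it commutes with
    -- t.
    have key : genOp n τ 1 * genOp n τ 0 * genOp n τ 1 =
        diagOp K fun T => τ (T.seq (⟨0, hn⟩ : Fin n).succ).1 := by
      rw [hs 0 hn, ← swapOp_mul_diagOp_pos_mul_swapOp]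
      rfl
    apply end_ext
    intro T
    have e1 : genOp n τ 0 * genOp n τ 1 * genOp n τ 0 * genOp n τ 1 =
      genOp n τ 0 * (genOp n τ 1 * genOp n τ 0 * genOp n τ 1) := by simp only [mul_assoc]
    rw [e1, key, Module.End.mul_apply, Module.End.mul_apply, ht, map_smul, diagOp_vec, map_smul, ht,
      smul_comm]

/-- Young's seminormal form, as a representation of the group. -/
noncomputable def seminormal [CharZero K] (n : ℕ) {τ : Fin 2 → K} (hτ : ∀ k, τ k ^ 2 = 1) :
    GroupB n →* Module.End K (StandardTableau (n + 1) →₀ K) :=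
  (coxB n).lift ⟨_, (relB_genOp n hτ).isLiftable⟩

theorem seminormal_simple [CharZero K] {τ : Fin 2 → K} (hτ : ∀ k, τ k ^ 2 = 1) (i : Fin (n + 1)) :
    seminormal n hτ ((coxB n).simple i) = genOp n τ i :=
  (coxB n).lift_apply_simple (relB_genOp n hτ).isLiftable i

theorem genOp_succ (τ : Fin 2 → K) (i : Fin n) : genOp n τ i.succ = swapOp K i := by
  simp [genOp]

/-- Young's seminormal form, as a representation of the group algebra. -/
noncomputable def seminormalAlg [CharZero K] (n : ℕ) {τ : Fin 2 → K} (hτ : ∀ k, τ k ^ 2 = 1) :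
    MonoidAlgebra K (GroupB n) →ₐ[K] Module.End K (StandardTableau (n + 1) →₀ K) :=
  MonoidAlgebra.lift K _ _ (seminormal n hτ)

theorem seminormalAlg_of [CharZero K] {τ : Fin 2 → K} (hτ : ∀ k, τ k ^ 2 = 1) (g : GroupB n) :
    seminormalAlg n hτ (MonoidAlgebra.of K _ g) = seminormal n hτ g :=
  MonoidAlgebra.lift_of _ _

theorem seminormalAlg_genS [CharZero K] {τ : Fin 2 → K} (hτ : ∀ k, τ k ^ 2 = 1) (i : Fin n) :
    seminormalAlg n hτ (genS K i) = swapOp K i := by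
  rw [genS, gen, seminormalAlg_of, seminormal_simple, genOp_succ]

theorem seminormalAlg_genT [CharZero K] {τ : Fin 2 → K} (hτ : ∀ k, τ k ^ 2 = 1) :
    seminormalAlg n hτ (genT K n) = diagOp K fun T => τ (T.seq 0).1 := by
  rw [genT, gen, seminormalAlg_of, seminormal_simple]
  rfl

end Operators

end FusionB

/-! ### Hook products, their growth ratios and the function `contFun` -/

namespace FusionB

open Finset

section HookFormula

variable (μ : YoungDiagram)

theorem hookLength_add {i j : ℕ} (h : (i, j) ∈ μ) :
    hookLength μ (i, j) + i + j + 1 = μ.rowLen i + μ.colLen j := by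
  have hj := YoungDiagram.mem_iff_lt_rowLen.1 h
  have hi := YoungDiagram.mem_iff_lt_colLen.1 h
  have hset : (μ.cells.filter fun β => (β.1 = i ∧ j ≤ β.2) ∨ (β.2 = j ∧ i ≤ β.1)) =
      ({i} ×ˢ Ico j (μ.rowLen i)) ∪ (Ico (i + 1) (μ.colLen j) ×ˢ {j}) := by
    ext ⟨a, b⟩
    simp only [mem_filter, YoungDiagram.mem_cells, mem_union, mem_product, mem_singleton, mem_Ico]
    constructor
    · rintro ⟨hm, ⟨rfl, hb⟩ | ⟨rfl, ha⟩⟩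
      · exact Or.inl ⟨rfl, hb, YoungDiagram.mem_iff_lt_rowLen.1 hm⟩
      · rcases ha.eq_or_lt with rfl | hlt
        · exact Or.inl ⟨rfl, le_rfl, hj⟩
        · exact Or.inr ⟨⟨hlt, YoungDiagram.mem_iff_lt_colLen.1 hm⟩, rfl⟩
    · rintro (⟨rfl, hb, hm⟩ | ⟨⟨ha, hm⟩, rfl⟩)
      · exact ⟨YoungDiagram.mem_iff_lt_rowLen.2 hm, Or.inl ⟨rfl, hb⟩⟩
      · exact ⟨YoungDiagram.mem_iff_lt_colLen.2 hm, Or.inr ⟨rfl, by omega⟩⟩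
  have hcard : hookLength μ (i, j) = (μ.rowLen i - j) + (μ.colLen j - (i + 1)) := by
    unfold hookLength
    rw [hset, card_union_of_disjoint]
    · simp
    · rw [disjoint_left]
      rintro ⟨a, b⟩ h1 h2
      simp only [mem_product, mem_singleton, mem_Ico] at h1 h2
      omega
  omega

/-- The hook lengths of row i and the differences λ_i - λ_m + m - i for i < m < L together are
exactly the numbers 1, …, λ_i + L - 1 - i, each once. -/
theorem prod_hookLength_row {L i : ℕ} (hi : i < L) (hL : μ.rowLen L = 0) :
    (∏ j ∈ range (μ.rowLen i), hookLength μ (i, j)) *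
      ∏ m ∈ Ico (i + 1) L, (μ.rowLen i - μ.rowLen m + (m - i)) =
      (μ.rowLen i + (L - 1 - i)).factorial := by
  have hcol : ∀ j, μ.colLen j ≤ L := by
    intro j
    by_contra h
    have := YoungDiagram.mem_iff_lt_rowLen.1 (YoungDiagram.mem_iff_lt_colLen.2 (not_le.1 h))
    omega
  have hook : ∀ j < μ.rowLen i, hookLength μ (i, j) + i + j + 1 = μ.rowLen i + μ.colLen j ∧
      i < μ.colLen j := fun j hj =>
    ⟨hookLength_add μ (YoungDiagram.mem_iff_lt_rowLen.2 hj),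
      YoungDiagram.mem_iff_lt_colLen.1 (YoungDiagram.mem_iff_lt_rowLen.2 hj)⟩
  have inj1 : Set.InjOn (fun j => hookLength μ (i, j)) (range (μ.rowLen i) : Set ℕ) := by
    intro a ha b hb hab
    rw [coe_range, Set.mem_Iio] at ha hb
    have h1 := hook a ha
    have h2 := hook b hb
    simp only at hab
    rcases lt_trichotomy a b with h | h | h
    · have := μ.colLen_anti a b h.le
      omega
    · exact h
    · have := μ.colLen_anti b a h.le
      omega
  have inj2 : Set.InjOn (fun m => μ.rowLen i - μ.rowLen m + (m - i)) (Ico (i + 1) L : Set ℕ) := by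
    intro a ha b hb hab
    rw [coe_Ico, Set.mem_Ico] at ha hb
    simp only at hab
    have h1 := μ.rowLen_anti i a (by omega)
    have h2 := μ.rowLen_anti i b (by omega)
    rcases lt_trichotomy a b with h | h | h
    · have := μ.rowLen_anti a b h.le
      omega
    · exact h
    · have := μ.rowLen_anti b a h.le
      omega
  have hdisj : Disjoint ((range (μ.rowLen i)).image fun j => hookLength μ (i, j))
      ((Ico (i + 1) L).image fun m => μ.rowLen i - μ.rowLen m + (m - i)) := by
    rw [disjoint_left]
    intro c h1 h2
    rw [mem_image] at h1 h2
    obtain ⟨j, hj, rfl⟩ := h1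
    obtain ⟨m, hm, he⟩ := h2
    rw [mem_range] at hj
    rw [mem_Ico] at hm
    have h1 := hook j hj
    have h2 := μ.rowLen_anti i m (by omega)
    -- A coincidence would mean (λ_m - j) + (λ'_j - m) = 1, but the two summands are either both
    -- positive or both at most zero.
    have h3 : j < μ.rowLen m ↔ m < μ.colLen j := by
      rw [← YoungDiagram.mem_iff_lt_rowLen, ← YoungDiagram.mem_iff_lt_colLen]
    omega
  have hunion : ((range (μ.rowLen i)).image fun j => hookLength μ (i, j)) ∪
      ((Ico (i + 1) L).image fun m => μ.rowLen i - μ.rowLen m + (m - i)) =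
      Ico 1 (μ.rowLen i + (L - 1 - i) + 1) := by
    apply eq_of_subset_of_card_le
    · intro c hc
      rw [mem_union, mem_image, mem_image] at hc
      rw [mem_Ico]
      rcases hc with ⟨j, hj, rfl⟩ | ⟨m, hm, rfl⟩
      · rw [mem_range] at hj
        have h1 := hook j hj
        have := hcol j
        omega
      · rw [mem_Ico] at hm
        have := μ.rowLen_anti i m (by omega)
        omega
    · rw [card_union_of_disjoint hdisj, card_image_of_injOn inj1, card_image_of_injOn inj2]
      simp
      omega
  rw [← prod_Ico_id_eq_factorial, ← hunion, prod_union hdisj, prod_image inj1, prod_image inj2]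

end HookFormula

/-- The content of the node that can be added to the `i`-th row. -/
def beta (l : ℕ → ℕ) (i : ℕ) : ℤ := (l i : ℤ) - i

theorem beta_strictAnti {l : ℕ → ℕ} (hl : Antitone l) {i j : ℕ} (h : i < j) :
    beta l j < beta l i := by
  have := hl h.le
  unfold beta
  omega

section Ratio

variable (K : Type) [Field K]

/-- The inverse of the product of the hook lengths, in terms of the row lengths. -/
noncomputable def rowHookFactor (L : ℕ) (l : ℕ → ℕ) : K :=
  ∏ i ∈ range L, (∏ m ∈ Ico (i + 1) L, ((beta l i - beta l m : ℤ) : K)) /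
    ((l i + (L - 1 - i)).factorial : K)

/-- The transition ratio of hook products for the addition of a node to row `i`. -/
noncomputable def transRatio (L : ℕ) (l : ℕ → ℕ) (i : ℕ) : K :=
  (∏ j ∈ range L, ((beta l i - beta l j + 1 : ℤ) : K)) /
    ∏ j ∈ (range (L + 1)).erase i, ((beta l i : K) - (beta l j : K))

/-- The rational function with zeros at the contents of the addable nodes and poles at those of the
removable nodes. -/
noncomputable def contFun (L : ℕ) (l : ℕ → ℕ) (u : K) : K :=
  (∏ j ∈ range (L + 1), (u - (beta l j : K))) / ∏ j ∈ range L, (u - (beta l j : K) + 1)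

variable {K}

theorem prod_hookLength_inv [CharZero K] (μ : YoungDiagram) {L : ℕ} (hL : μ.rowLen L = 0) :
    (∏ α ∈ μ.cells, (hookLength μ α : K))⁻¹ = rowHookFactor K L μ.rowLen := by
  have hcells : ∀ p : ℕ × ℕ, p ∈ μ.cells ↔ p.1 ∈ range L ∧ p.2 ∈ range (μ.rowLen p.1) := by
    rintro ⟨i, j⟩
    rw [YoungDiagram.mem_cells, YoungDiagram.mem_iff_lt_rowLen, mem_range, mem_range]
    refine ⟨fun h => ⟨?_, h⟩, fun h => h.2⟩
    by_contra hi
    have := μ.rowLen_anti L i (by omega)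
    omega
  rw [prod_finset_product μ.cells (range L) (fun i => range (μ.rowLen i)) hcells, ← prod_inv_distrib]
  unfold rowHookFactor
  apply prod_congr rfl
  intro i hi
  rw [mem_range] at hi
  have h := prod_hookLength_row μ hi hL
  have h' : (∏ j ∈ range (μ.rowLen i), (hookLength μ (i, j) : K)) *
      ∏ m ∈ Ico (i + 1) L, ((beta μ.rowLen i - beta μ.rowLen m : ℤ) : K) =
      ((μ.rowLen i + (L - 1 - i)).factorial : K) := by
    rw [← h]
    push_cast
    congr 1
    apply prod_congr rfl
    intro m hm
    rw [mem_Ico] at hm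
    have h2 := μ.rowLen_anti i m (by omega)
    unfold beta
    push_cast [Nat.cast_sub h2, Nat.cast_sub (show i ≤ m by omega)]
    ring
  have h0 : ((μ.rowLen i + (L - 1 - i)).factorial : K) ≠ 0 :=
    Nat.cast_ne_zero.2 (Nat.factorial_ne_zero _)
  have h1 : (∏ j ∈ range (μ.rowLen i), (hookLength μ (i, j) : K)) ≠ 0 := by
    intro h1
    rw [h1, zero_mul] at h'
    exact h0 h'.symm
  rw [eq_div_iff h0, ← h', inv_mul_cancel_left₀ h1]

theorem range_erase_eq {L a : ℕ} (ha : a < L) : (range L).erase a = range a ∪ Ico (a + 1) L := by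
  ext j
  simp only [mem_erase, mem_range, mem_union, mem_Ico]
  omega

theorem prod_range_split {M : Type*} [CommMonoid M] {L a : ℕ} (ha : a < L) (f : ℕ → M) :
    ∏ j ∈ range L, f j = (∏ j ∈ range a, f j) * (f a * ∏ j ∈ Ico (a + 1) L, f j) := by
  rw [← prod_range_mul_prod_Ico f ha.le, prod_eq_prod_Ico_succ_bot ha]

theorem prod_range_erase {M : Type*} [CommMonoid M] {L a : ℕ} (ha : a < L) (f : ℕ → M) :
    ∏ j ∈ (range L).erase a, f j = (∏ j ∈ range a, f j) * ∏ j ∈ Ico (a + 1) L, f j := by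
  rw [range_erase_eq ha, prod_union]
  rw [disjoint_left]
  intro j h1 h2
  rw [mem_range] at h1
  rw [mem_Ico] at h2
  omega

theorem beta_update (l : ℕ → ℕ) (a i : ℕ) :
    beta (Function.update l a (l a + 1)) i = beta l i + if i = a then 1 else 0 := by
  unfold beta
  rw [Function.update_apply]
  split_ifs with h
  · subst h; push_cast; ring
  · ring

theorem beta_sub_ne [CharZero K] {l : ℕ → ℕ} (hl : Antitone l) {i j : ℕ} (h : i ≠ j) :
    (beta l i : K) - (beta l j : K) ≠ 0 := by
  rw [← Int.cast_sub, Int.cast_ne_zero]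
  rcases lt_or_gt_of_ne h with h | h
  · have := beta_strictAnti hl h
    omega
  · have := beta_strictAnti hl h
    omega

/-- Only the factors that involve row a change. Each row above contributes one ratio, and the
factorial of row a grows by one factor, which is the factor j = L in the denominator of
`transRatio`. -/
theorem rowHookFactor_update [CharZero K] {L a : ℕ} {l : ℕ → ℕ} (hl : Antitone l) (ha : a < L)
    (hL : l L = 0) : rowHookFactor K L (Function.update l a (l a + 1)) =
      rowHookFactor K L l * transRatio K L l a := by
  set l' := Function.update l a (l a + 1) with hl'
  have hb : ∀ i, beta l' i = beta l i + if i = a then 1 else 0 := beta_update l a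
  have hne : ∀ {i j : ℕ}, i ≠ j → (beta l i : K) - (beta l j : K) ≠ 0 := fun h => beta_sub_ne hl h
  have hterm : ∀ i, i ≠ a → l' i = l i := fun i hi => Function.update_of_ne hi _ _
  unfold rowHookFactor transRatio
  rw [prod_range_split ha, prod_range_split ha (fun i => (∏ m ∈ Ico (i + 1) L,
    ((beta l i - beta l m : ℤ) : K)) / ((l i + (L - 1 - i)).factorial : K)),
    prod_range_split ha (fun j => ((beta l a - beta l j + 1 : ℤ) : K)),
    prod_range_erase (show a < L + 1 by omega), prod_Ico_succ_top (show a + 1 ≤ L by omega)]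
  have e1 : ∏ i ∈ range a, (∏ m ∈ Ico (i + 1) L, ((beta l' i - beta l' m : ℤ) : K)) /
      ((l' i + (L - 1 - i)).factorial : K) =
      (∏ i ∈ range a, (∏ m ∈ Ico (i + 1) L, ((beta l i - beta l m : ℤ) : K)) /
      ((l i + (L - 1 - i)).factorial : K)) *
      ((∏ i ∈ range a, ((beta l a - beta l i + 1 : ℤ) : K)) /
        ∏ i ∈ range a, ((beta l a : K) - (beta l i : K))) := by
    rw [← prod_div_distrib, ← prod_mul_distrib]
    apply prod_congr rfl
    intro i hi
    rw [mem_range] at hi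
    have ham : a ∈ Ico (i + 1) L := mem_Ico.2 ⟨hi, ha⟩
    rw [hterm i hi.ne, ← mul_prod_erase _ _ ham,
      ← mul_prod_erase (Ico (i + 1) L) (fun m => ((beta l i - beta l m : ℤ) : K)) ham]
    have : ∏ m ∈ (Ico (i + 1) L).erase a, ((beta l' i - beta l' m : ℤ) : K) =
        ∏ m ∈ (Ico (i + 1) L).erase a, ((beta l i - beta l m : ℤ) : K) := by
      apply prod_congr rfl
      intro m hm
      rw [hb, hb, if_neg hi.ne, if_neg (ne_of_mem_erase hm)]
      simp
    rw [this, hb, hb, if_neg hi.ne, if_pos rfl]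
    have h1 := hne hi.ne'
    have h2 : (((l i + (L - 1 - i)).factorial : ℕ) : K) ≠ 0 :=
      Nat.cast_ne_zero.2 (Nat.factorial_ne_zero _)
    push_cast
    field_simp
    ring
  have e2 : ∏ i ∈ Ico (a + 1) L, (∏ m ∈ Ico (i + 1) L, ((beta l' i - beta l' m : ℤ) : K)) /
      ((l' i + (L - 1 - i)).factorial : K) =
      ∏ i ∈ Ico (a + 1) L, (∏ m ∈ Ico (i + 1) L, ((beta l i - beta l m : ℤ) : K)) /
      ((l i + (L - 1 - i)).factorial : K) := by
    apply prod_congr rfl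
    intro i hi
    rw [mem_Ico] at hi
    rw [hterm i (by omega)]
    congr 1
    apply prod_congr rfl
    intro m hm
    rw [mem_Ico] at hm
    rw [hb, hb, if_neg (by omega), if_neg (by omega)]
    simp
  have e3 : ∏ m ∈ Ico (a + 1) L, ((beta l' a - beta l' m : ℤ) : K) =
      ∏ m ∈ Ico (a + 1) L, ((beta l a - beta l m + 1 : ℤ) : K) := by
    apply prod_congr rfl
    intro m hm
    rw [mem_Ico] at hm
    rw [hb, hb, if_pos rfl, if_neg (by omega)]
    congr 1
    ring
  have e4 : ((l' a + (L - 1 - a)).factorial : K) =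
      ((beta l a : K) - (beta l L : K)) * ((l a + (L - 1 - a)).factorial : K) := by
    have : l' a = l a + 1 := Function.update_self _ _ _
    rw [this, show l a + 1 + (L - 1 - a) = (l a + (L - 1 - a)) + 1 by ring, Nat.factorial_succ]
    unfold beta
    rw [hL]
    have h3 : L - 1 - a = L - (a + 1) := by omega
    push_cast [h3, Nat.cast_sub (show a + 1 ≤ L by omega)]
    ring
  have e5 : ∏ m ∈ Ico (a + 1) L, ((beta l a - beta l m : ℤ) : K) =
      ∏ m ∈ Ico (a + 1) L, ((beta l a : K) - (beta l m : K)) := by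
    apply prod_congr rfl
    intro m _
    push_cast
    rfl
  rw [e1, e2, e3, e4, e5]
  have h1 : ∏ i ∈ range a, ((beta l a : K) - (beta l i : K)) ≠ 0 :=
    prod_ne_zero_iff.2 fun i hi => hne (mem_range.1 hi).ne'
  have h2 : ∏ m ∈ Ico (a + 1) L, ((beta l a : K) - (beta l m : K)) ≠ 0 :=
    prod_ne_zero_iff.2 fun i hi => hne (by rw [mem_Ico] at hi; omega)
  have h3 := hne ha.ne
  have h4 : (((l a + (L - 1 - a)).factorial : ℕ) : K) ≠ 0 :=
    Nat.cast_ne_zero.2 (Nat.factorial_ne_zero _)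
  have h5 : ((beta l a - beta l a + 1 : ℤ) : K) = 1 := by push_cast; ring
  rw [h5]
  field_simp

/-- For the empty diagram numerator and denominator agree after a shift of the index, except for the
factor j = 0. -/
theorem contFun_zero [CharZero K] (L : ℕ) {u : K} (hu : ∀ z : ℤ, u ≠ z) :
    contFun K L (fun _ => 0) u = u := by
  unfold contFun
  rw [prod_range_succ']
  have h : ∏ j ∈ range L, (u - (beta (fun _ => 0) (j + 1) : K)) =
      ∏ j ∈ range L, (u - (beta (fun _ => 0) j : K) + 1) := by
    apply prod_congr rfl
    intro j _
    unfold beta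
    push_cast
    ring
  have h0 : ∏ j ∈ range L, (u - (beta (fun _ => 0) j : K) + 1) ≠ 0 := by
    refine prod_ne_zero_iff.2 fun j _ h => hu (beta (fun _ => 0) j - 1) ?_
    push_cast
    linear_combination h
  rw [h, mul_div_assoc, mul_comm, div_mul_cancel₀ _ h0]
  simp [beta]

/-- The new factor is that of (s + x)(s - x) = 1 - x² with x = 1/(u - c), c the content of the added
node; this ties `contFun` to the recursion for φ. -/
theorem contFun_update {L a : ℕ} {l : ℕ → ℕ} (ha : a < L) {u : K} (hu : ∀ z : ℤ, u ≠ z) :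
    contFun K L (Function.update l a (l a + 1)) u =
      contFun K L l u * (1 - (1 / (u - (beta l a : K))) ^ 2) := by
  have hb := beta_update l a
  have hne : ∀ z : ℤ, u - (z : K) ≠ 0 := fun z h => hu z (sub_eq_zero.1 h)
  have hne1 : ∀ z : ℤ, u - (z : K) + 1 ≠ 0 := fun z h => hu (z - 1) (by
    push_cast; linear_combination h)
  unfold contFun
  rw [← mul_prod_erase (range (L + 1)) _ (mem_range.2 (show a < L + 1 by omega)),
    ← mul_prod_erase (range L) _ (mem_range.2 ha),
    ← mul_prod_erase (range (L + 1)) (fun j => u - (beta l j : K))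
      (mem_range.2 (show a < L + 1 by omega)),
    ← mul_prod_erase (range L) (fun j => u - (beta l j : K) + 1) (mem_range.2 ha)]
  have e1 : ∏ j ∈ (range (L + 1)).erase a, (u - (beta (Function.update l a (l a + 1)) j : K)) =
      ∏ j ∈ (range (L + 1)).erase a, (u - (beta l j : K)) := by
    apply prod_congr rfl
    intro j hj
    rw [hb, if_neg (ne_of_mem_erase hj), add_zero]
  have e2 : ∏ j ∈ (range L).erase a, (u - (beta (Function.update l a (l a + 1)) j : K) + 1) =
      ∏ j ∈ (range L).erase a, (u - (beta l j : K) + 1) := by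
    apply prod_congr rfl
    intro j hj
    rw [hb, if_neg (ne_of_mem_erase hj), add_zero]
  rw [e1, e2, hb, if_pos rfl]
  have h1 : ∏ j ∈ (range L).erase a, (u - (beta l j : K) + 1) ≠ 0 :=
    prod_ne_zero_iff.2 fun j _ => hne1 _
  have h2 := hne (beta l a)
  have h3 := hne1 (beta l a)
  push_cast
  have h4 : u - ((beta l a : K) + 1) + 1 ≠ 0 := by
    intro h; apply h2; linear_combination h
  field_simp
  ring

/-- Lagrange interpolation of the monic polynomial P of degree L at the L+1 nodes β_i: the
numerators of `transRatio` are the values of P, and their weighted sum is its leading coefficient.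
-/
theorem sum_transRatio [CharZero K] (L : ℕ) {l : ℕ → ℕ} (hl : Antitone l) :
    ∑ i ∈ range (L + 1), transRatio K L l i = 1 := by
  have hinj : Set.InjOn (fun j => (beta l j : K)) (range (L + 1) : Set ℕ) := by
    intro i _ j _ hij
    by_contra h
    exact beta_sub_ne (K := K) hl h (sub_eq_zero.2 hij)
  set P : Polynomial K := ∏ j ∈ range L, (Polynomial.X - Polynomial.C ((beta l j : K) - 1)) with hP
  have hmonic : P.Monic := Polynomial.monic_prod_of_monic _ _ fun j _ => Polynomial.monic_X_sub_C _
  have hdeg : P.natDegree = L := by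
    rw [hP, Polynomial.natDegree_prod_of_monic _ _ fun j _ => Polynomial.monic_X_sub_C _]
    simp only [Polynomial.natDegree_X_sub_C, sum_const, card_range, smul_eq_mul, mul_one]
  have h := Lagrange.leadingCoeff_eq_sum hinj (P := P) (by
    rw [Polynomial.degree_eq_natDegree hmonic.ne_zero, hdeg, card_range]; norm_cast)
  rw [hmonic.leadingCoeff] at h
  rw [h]
  apply sum_congr rfl
  intro i _
  unfold transRatio
  congr 1
  rw [hP, Polynomial.eval_prod]
  apply prod_congr rfl
  intro j _
  simp
  ring

/-- Division by β_i - (β_a - 1) removes the factor of row a from the numerator. The interpolated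
polynomial has degree L - 1 only, so its coefficient of degree L is zero. -/
theorem sum_transRatio_div [CharZero K] {L a : ℕ} {l : ℕ → ℕ} (hl : Antitone l) (ha : a < L)
    (hlt : l (a + 1) < l a) :
    ∑ i ∈ range (L + 1), transRatio K L l i * ((beta l i - (beta l a - 1) : ℤ) : K)⁻¹ = 0 := by
  have hinj : Set.InjOn (fun j => (beta l j : K)) (range (L + 1) : Set ℕ) := by
    intro i _ j _ hij
    by_contra h
    exact beta_sub_ne (K := K) hl h (sub_eq_zero.2 hij)
  set P : Polynomial K :=
    ∏ j ∈ (range L).erase a, (Polynomial.X - Polynomial.C ((beta l j : K) - 1)) with hP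
  have hmonic : P.Monic := Polynomial.monic_prod_of_monic _ _ fun j _ => Polynomial.monic_X_sub_C _
  have hdeg : P.natDegree = L - 1 := by
    rw [hP, Polynomial.natDegree_prod_of_monic _ _ fun j _ => Polynomial.monic_X_sub_C _]
    simp only [Polynomial.natDegree_X_sub_C, sum_const, card_erase_of_mem (mem_range.2 ha),
      card_range, smul_eq_mul, mul_one]
  have h := Lagrange.coeff_eq_sum hinj (P := P) (by
    rw [Polynomial.degree_eq_natDegree hmonic.ne_zero, hdeg, card_range]; norm_cast; omega)
  rw [Polynomial.coeff_eq_zero_of_natDegree_lt (by rw [hdeg, card_range]; omega)] at h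
  rw [h]
  apply sum_congr rfl
  intro i _
  -- Row a ends in a removable node, so the content of that node is not of the form β_i.
  have hne : ((beta l i - (beta l a - 1) : ℤ) : K) ≠ 0 := by
    rw [Int.cast_ne_zero]
    intro h0
    rcases lt_trichotomy i a with h | h | h
    · have := beta_strictAnti hl h
      omega
    · subst h; omega
    · have h1 : l i ≤ l (a + 1) := hl h
      unfold beta at h0
      omega
  have hnum : ∏ j ∈ range L, ((beta l i - beta l j + 1 : ℤ) : K) =
      ((beta l i - (beta l a - 1) : ℤ) : K) * P.eval (beta l i : K) := by
    rw [← mul_prod_erase _ _ (mem_range.2 ha), hP, Polynomial.eval_prod]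
    congr 1
    · push_cast; ring
    · apply prod_congr rfl
      intro j _
      simp
      ring
  unfold transRatio
  rw [hnum]
  field_simp

end Ratio

end FusionB

/-! ### Sums of hook weights over the extensions of a tableau -/

namespace FusionB

open Finset StandardTableau

section Weights

variable (K : Type) [Field K]

/-- The inverse of the product of the hook lengths of a 2-tableau, in any field. -/
noncomputable def weight {m : ℕ} (T : StandardTableau m) : K :=
  ∏ κ : Fin 2, (∏ α ∈ (T.shape κ).cells, (hookLength (T.shape κ) α : K))⁻¹

/-- The weight of the 2-tableau formed by the numbers less than `k`. -/
noncomputable def partialWeight {m : ℕ} (L : ℕ) (T : StandardTableau m) (k : ℕ) : K :=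
  ∏ κ : Fin 2, rowHookFactor K L (T.rows k κ)

variable {K}

/-- A row that cannot take a node is as long as the row above it, and the factor of that row
vanishes. Hence sums over addable nodes may run over all rows. -/
theorem transRatio_eq_zero {L i : ℕ} {l : ℕ → ℕ} (hl : Antitone l) (hi : i ≤ L) {j : ℕ}
    (hj : j < i) (h : l j ≤ l i) : transRatio K L l i = 0 := by
  unfold transRatio
  rw [prod_eq_zero (mem_range.2 (show i - 1 < L by omega)), zero_div]
  have h1 : l (i - 1) ≤ l j := hl (by omega)
  have h2 : l i ≤ l (i - 1) := hl (by omega)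
  have : beta l i - beta l (i - 1) + 1 = 0 := by
    unfold beta
    omega
  rw [this, Int.cast_zero]

theorem sum_weight_mul {m : ℕ} (G : StandardTableau m → K) (F : StandardTableau (m + 1) → K) :
    ∑ S : StandardTableau (m + 1), weight K S * (F S * G S.restrict) =
      ∑ U : StandardTableau m, (∑ S : StandardTableau (m + 1) with S.restrict = U,
        weight K S * F S) * G U := by
  rw [← sum_fiberwise (s := univ) (g := fun S : StandardTableau (m + 1) => S.restrict)]
  apply sum_congr rfl
  intro U _
  rw [sum_mul]
  apply sum_congr rfl
  intro S hS
  have hS' : S.restrict = U := by simpa using hS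
  rw [hS', mul_assoc]

variable [CharZero K]

theorem weight_eq_partialWeight {m L : ℕ} (h : m ≤ L) (T : StandardTableau m) :
    weight K T = partialWeight K L T m := by
  apply prod_congr rfl
  intro κ _
  have hrows : T.rows m κ = (T.shape κ).rowLen := funext fun i => T.rows_eq_rowLen κ i
  rw [hrows]
  apply prod_hookLength_inv
  rw [← T.rows_eq_rowLen, T.rows_eq_zero _ _ h]

theorem rows_succ_eq_update {m : ℕ} (T : StandardTableau m) (a : Fin m) :
    T.rows (a + 1) (T.seq a).1 = Function.update (T.rows a (T.seq a).1) (T.seq a).2.1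
      (T.rows a (T.seq a).1 (T.seq a).2.1 + 1) := by
  funext i
  rw [rows_succ, Function.update_apply]
  by_cases h : i = (T.seq a).2.1
  · rw [if_pos ⟨rfl, h.symm⟩, if_pos h, h]
  · rw [if_neg (fun h' => h h'.2.symm), if_neg h, add_zero]

theorem rows_succ_of_ne {m : ℕ} (T : StandardTableau m) (a : Fin m) {κ : Fin 2}
    (h : (T.seq a).1 ≠ κ) : T.rows (a + 1) κ = T.rows a κ := by
  funext i
  rw [rows_succ, if_neg (fun h' => h h'.1), add_zero]

theorem partialWeight_succ {m L : ℕ} (h : m ≤ L) (T : StandardTableau m) (a : Fin m) :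
    partialWeight K L T (a + 1) = partialWeight K L T a *
      transRatio K L (T.rows a (T.seq a).1) (T.seq a).2.1 := by
  unfold partialWeight
  rw [← mul_prod_erase univ _ (mem_univ (T.seq a).1),
    ← mul_prod_erase univ (fun κ => rowHookFactor K L (T.rows a κ)) (mem_univ (T.seq a).1),
    rows_succ_eq_update, rowHookFactor_update (T.rows_antitone _ _)]
  · have : ∏ κ ∈ univ.erase (T.seq a).1, rowHookFactor K L (T.rows (a + 1) κ) =
        ∏ κ ∈ univ.erase (T.seq a).1, rowHookFactor K L (T.rows a κ) := by
      apply prod_congr rfl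
      intro κ hκ
      rw [rows_succ_of_ne T a (ne_of_mem_erase hκ).symm]
    rw [this]
    ring
  · exact (T.row_le a).trans_lt (a.2.trans_le h)
  · exact T.rows_eq_zero _ _ h

theorem rows_zero {m : ℕ} (T : StandardTableau m) (κ : Fin 2) : T.rows 0 κ = fun _ => 0 := by
  funext i
  simp [rows]

theorem partialWeight_zero {m L : ℕ} (T : StandardTableau m) : partialWeight K L T 0 = 1 := by
  unfold partialWeight
  apply prod_eq_one
  intro κ _
  have h := prod_hookLength_inv (K := K) (⊥ : YoungDiagram) (L := L) (by
    by_contra h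
    exact YoungDiagram.notMem_bot (L, 0) (YoungDiagram.mem_iff_lt_rowLen.2 (Nat.pos_of_ne_zero h)))
  have hr : T.rows 0 κ = (⊥ : YoungDiagram).rowLen := by
    rw [rows_zero]
    funext i
    by_contra h
    exact YoungDiagram.notMem_bot (i, 0)
      (YoungDiagram.mem_iff_lt_rowLen.2 (Nat.pos_of_ne_zero (Ne.symm h)))
  rw [hr, ← h]
  simp

theorem weight_eq_restrict {m : ℕ} (S : StandardTableau (m + 1)) :
    weight K S = weight K S.restrict * transRatio K (m + 1)
      (S.restrict.rows m (S.seq (Fin.last m)).1) (S.seq (Fin.last m)).2.1 := by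
  have hrows : ∀ κ, S.restrict.rows m κ = S.rows m κ := fun κ => funext fun i => S.rows_restrict κ i
  have h := partialWeight_succ (K := K) le_rfl S (Fin.last m)
  rw [weight_eq_partialWeight (Nat.le_succ m) S.restrict, weight_eq_partialWeight le_rfl S]
  unfold partialWeight at h ⊢
  simp only [hrows]
  exact h

/-- An extension of `U` is determined by the diagram and the row of its new node; the rows missed by
extensions have transition ratio zero. -/
theorem sum_weight_restrict {m : ℕ} (U : StandardTableau m) (F : Fin 2 × ℕ × ℕ → K) :
    ∑ S : StandardTableau (m + 1) with S.restrict = U, weight K S * F (S.seq (Fin.last m)) =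
      weight K U * ∑ κ : Fin 2, ∑ i ∈ range (m + 1 + 1),
        transRatio K (m + 1) (U.rows m κ) i * F (κ, i, U.rows m κ i) := by
  set R : Fin 2 × ℕ → K := fun p =>
    transRatio K (m + 1) (U.rows m p.1) p.2 * F (p.1, p.2, U.rows m p.1 p.2) with hR
  set f : StandardTableau (m + 1) → Fin 2 × ℕ :=
    fun S => ((S.seq (Fin.last m)).1, (S.seq (Fin.last m)).2.1) with hf
  have hcol : ∀ S : StandardTableau (m + 1), S.restrict = U →
      S.seq (Fin.last m) = ((f S).1, (f S).2, U.rows m (f S).1 (f S).2) := by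
    rintro S rfl
    refine Prod.ext rfl (Prod.ext rfl ?_)
    rw [rows_restrict]
    exact S.col_eq_rows (Fin.last m)
  have hinj : Set.InjOn f ((univ.filter fun S : StandardTableau (m + 1) => S.restrict = U :
      Finset (StandardTableau (m + 1))) : Set (StandardTableau (m + 1))) := by
    intro S hS S' hS' h
    simp only [coe_filter, mem_univ, true_and, Set.mem_ofPred_eq] at hS hS'
    exact eq_of_restrict_eq (hS.trans hS'.symm) (by rw [hcol S hS, hcol S' hS', h])
  have h1 : ∑ S : StandardTableau (m + 1) with S.restrict = U, weight K S * F (S.seq (Fin.last m)) =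
      ∑ S : StandardTableau (m + 1) with S.restrict = U, weight K U * R (f S) := by
    apply sum_congr rfl
    intro S hS
    have hS' : S.restrict = U := by simpa using hS
    rw [weight_eq_restrict S, hS', hR]
    simp only [hf]
    rw [mul_assoc]
    congr 2
    exact congrArg F (hcol S hS')
  rw [h1, ← mul_sum, ← sum_image (f := R) hinj]
  congr 1
  have h2 : ∑ κ : Fin 2, ∑ i ∈ range (m + 1 + 1),
      transRatio K (m + 1) (U.rows m κ) i * F (κ, i, U.rows m κ i) =
      ∑ p ∈ (univ : Finset (Fin 2)) ×ˢ range (m + 1 + 1), R p := by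
    rw [sum_product]
  rw [h2]
  apply sum_subset
  · intro p hp
    obtain ⟨S, hS, rfl⟩ := mem_image.1 hp
    rw [mem_product, mem_range]
    have := S.row_le (Fin.last m)
    rw [Fin.val_last] at this
    exact ⟨mem_univ _, by simp only [hf]; omega⟩
  · rintro ⟨κ, i⟩ hp hnot
    rw [mem_product, mem_range] at hp
    have : ∃ j < i, U.rows m κ j ≤ U.rows m κ i := by
      by_contra hcon
      push Not at hcon
      obtain ⟨S, hS, hlast⟩ := U.exists_extend κ i hcon
      apply hnot
      refine mem_image.2 ⟨S, by simpa using hS, ?_⟩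
      simp only [hf]
      rw [hlast]
    obtain ⟨j, hj, hle⟩ := this
    simp only [hR]
    rw [transRatio_eq_zero (U.rows_antitone _ _) (Nat.lt_succ_iff.1 hp.2) hj hle, zero_mul]

/-- Each of the two diagrams contributes a sum of transition ratios equal to 1. -/
theorem sum_weight_eq {m : ℕ} (U : StandardTableau m) :
    ∑ S : StandardTableau (m + 1) with S.restrict = U, weight K S * (1 : K) = weight K U * 2 := by
  rw [sum_weight_restrict U (fun _ => 1)]
  simp only [mul_one, sum_transRatio (m + 1) (U.rows_antitone m _)]
  simp

theorem sum_weight_pos {m : ℕ} (U : StandardTableau m) {τ : Fin 2 → K} (hτ : τ 0 + τ 1 = 0) :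
    ∑ S : StandardTableau (m + 1) with S.restrict = U, weight K S * τ (S.seq (Fin.last m)).1
      = 0 := by
  rw [sum_weight_restrict U (fun α => τ α.1)]
  simp only [← sum_mul, sum_transRatio (m + 1) (U.rows_antitone m _), one_mul]
  simp [hτ]

/-- The node of the largest number of `U` is removable, so `sum_transRatio_div` applies in its
diagram; in the other diagram the coefficients are zero. -/
theorem sum_weight_dcoef {m : ℕ} (U : StandardTableau (m + 1)) :
    ∑ S : StandardTableau (m + 1 + 1) with S.restrict = U,
      weight K S * dcoef K (U.seq (Fin.last m)) (S.seq (Fin.last (m + 1))) = 0 := by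
  rw [sum_weight_restrict U (fun β => dcoef K (U.seq (Fin.last m)) β)]
  set α := U.seq (Fin.last m) with hα
  have hup := rows_succ_eq_update U (Fin.last m)
  rw [← hα, Fin.val_last] at hup
  have hcol := U.col_eq_rows (Fin.last m)
  rw [← hα, Fin.val_last] at hcol
  have ha : U.rows (m + 1) α.1 α.2.1 = α.2.2 + 1 := by
    rw [hup, Function.update_self, hcol]
  have hlt : U.rows (m + 1) α.1 (α.2.1 + 1) < U.rows (m + 1) α.1 α.2.1 := by
    have := U.rows_antitone m α.1 (Nat.le_succ α.2.1)
    rw [ha, hup, Function.update_of_ne (by omega), hcol]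
    exact Nat.lt_succ_of_le this
  have hrow := U.row_le (Fin.last m)
  rw [← hα, Fin.val_last] at hrow
  have hsum := sum_transRatio_div (K := K) (L := m + 1 + 1) (U.rows_antitone (m + 1) α.1)
    (a := α.2.1) (by omega) hlt
  rw [sum_eq_single_of_mem α.1 (mem_univ _)]
  · convert mul_zero _
    rw [← hsum]
    apply sum_congr rfl
    intro i _
    congr 2
    rw [dcoef, if_pos rfl]
    congr 2
    unfold cont beta
    rw [ha]
    push_cast
    ring
  · intro κ _ hκ
    apply sum_eq_zero
    intro i _
    rw [dcoef, if_neg (Ne.symm hκ), mul_zero]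

end Weights

end FusionB

/-! ### Restriction of the seminormal form to the subgroup of rank one less -/

namespace FusionB

open Finset StandardTableau

section Restriction

variable {K : Type} [Field K] {n : ℕ}

theorem RelB.mono {M : Type*} [Monoid M] {n m : ℕ} {σ : ℕ → M} (h : RelB m σ) (hnm : n ≤ m) :
    RelB n σ :=
  ⟨fun i hi => h.sq i (hi.trans hnm), fun i j hj => h.comm i j (hj.trans hnm),
    fun i h1 hi => h.braid i h1 (hi.trans hnm), fun h1 => h.four (h1.trans hnm)⟩

/-- The inclusion of `B_{n+1}` into `B_{n+2}`. -/
noncomputable def inclB (n : ℕ) : GroupB n →* GroupB (n + 1) :=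
  (coxB n).lift ⟨_, ((relB_sig (n + 1)).mono (Nat.le_succ n)).isLiftable⟩

theorem inclB_simple (i : Fin (n + 1)) :
    inclB n ((coxB n).simple i) = (coxB (n + 1)).simple i.castSucc := by
  have h : inclB n ((coxB n).simple i) = sig (n + 1) i :=
    (coxB n).lift_apply_simple ((relB_sig (n + 1)).mono (Nat.le_succ n)).isLiftable i
  rw [h, ← sig_val]
  rfl

theorem exists_inclB_eq {g : GroupB (n + 1)} (hg : g ∈ parabolic (sig (n + 1)) (n + 1)) :
    ∃ h, inclB n h = g := by
  have hle : parabolic (sig (n + 1)) (n + 1) ≤ (inclB n).range := by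
    unfold parabolic
    rw [Subgroup.closure_le]
    rintro _ ⟨m, hm, rfl⟩
    refine ⟨(coxB n).simple ⟨m, hm⟩, ?_⟩
    rw [inclB_simple, ← sig_val]
    rfl
  exact hle hg

/-- Removal of the largest number, if it is carried by the node `α`. -/
noncomputable def removeLast (K : Type) [Field K] (α : Fin 2 × ℕ × ℕ) :
    (StandardTableau (n + 1 + 1) →₀ K) →ₗ[K] (StandardTableau (n + 1) →₀ K) :=
  Finsupp.linearCombination K fun T =>
    if T.seq (Fin.last (n + 1)) = α then vec K T.restrict.seq else 0

theorem removeLast_vec (α : Fin 2 × ℕ × ℕ) (T : StandardTableau (n + 1 + 1)) :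
    removeLast K α (vec K T.seq) =
      if T.seq (Fin.last (n + 1)) = α then vec K T.restrict.seq else 0 := by
  rw [vec_seq, removeLast, Finsupp.linearCombination_single, one_smul]

theorem removeLast_apply (S : StandardTableau (n + 1 + 1))
    (v : StandardTableau (n + 1 + 1) →₀ K) :
    removeLast K (S.seq (Fin.last (n + 1))) v S.restrict = v S := by
  have : Finsupp.lapply (R := K) (M := K) S.restrict ∘ₗ removeLast K (S.seq (Fin.last (n + 1))) =
      Finsupp.lapply S := by
    apply Finsupp.lhom_ext'
    intro T
    apply LinearMap.ext_ring
    simp only [LinearMap.comp_apply, Finsupp.lsingle_apply, Finsupp.lapply_apply]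
    rw [← vec_seq, removeLast_vec, vec_seq, vec_seq]
    by_cases hT : T = S
    · subst hT; simp
    · rw [Finsupp.single_eq_of_ne (Ne.symm hT)]
      split_ifs with h
      · rw [Finsupp.single_eq_of_ne]
        intro h'
        exact hT (eq_of_restrict_eq h'.symm h)
      · rfl
  exact LinearMap.congr_fun this v

theorem removeLast_swapOp (α : Fin 2 × ℕ × ℕ) (i : Fin n)
    (v : StandardTableau (n + 1 + 1) →₀ K) :
    removeLast K α (swapOp K i.castSucc v) = swapOp K i (removeLast K α v) := by
  have : removeLast K α ∘ₗ swapOp K i.castSucc = swapOp K i ∘ₗ removeLast K α := by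
    apply Finsupp.lhom_ext'
    intro T
    apply LinearMap.ext_ring
    simp only [LinearMap.comp_apply, Finsupp.lsingle_apply]
    rw [← vec_seq, removeLast_vec, swapOp_vec, map_add, map_smul, map_smul, removeLast_vec]
    have e1 : T.seq i.castSucc.castSucc = T.restrict.seq i.castSucc := rfl
    have e2 : T.seq i.castSucc.succ = T.restrict.seq i.succ := rfl
    by_cases hnear : Near (T.seq i.castSucc.castSucc) (T.seq i.castSucc.succ)
    · rw [gcoef, if_pos hnear, zero_smul, add_zero]
      split_ifs
      · rw [swapOp_vec, gcoef, ← e1, ← e2, if_pos hnear, zero_smul, add_zero]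
      · simp
    · obtain ⟨S, hS⟩ := exists_isSwap_iff.2 hnear
      rw [isSwap_iff] at hS
      have hl : S.seq (Fin.last (n + 1)) = T.seq (Fin.last (n + 1)) := by
        rw [hS, Function.comp_apply, Equiv.swap_apply_of_ne_of_ne]
        · rw [Ne, Fin.ext_iff]
          simp
          omega
        · rw [Ne, Fin.ext_iff]
          simp
          omega
      have hr : S.restrict.seq = T.restrict.seq ∘ Equiv.swap i.castSucc i.succ := by
        funext a
        rw [seq_restrict, hS, Function.comp_apply, Function.comp_apply, seq_restrict]
        congr 1
        simp only [Equiv.swap_apply_def]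
        split_ifs <;> simp_all [Fin.ext_iff]
      rw [← hS, removeLast_vec, hl, e1, e2]
      split_ifs
      · rw [swapOp_vec, hr]
      · simp
  exact LinearMap.congr_fun this v

theorem removeLast_diagOp (f : Fin 2 × ℕ × ℕ → K) (α : Fin 2 × ℕ × ℕ) (a : Fin (n + 1))
    (v : StandardTableau (n + 1 + 1) →₀ K) :
    removeLast K α (diagOp K (fun T => f (T.seq a.castSucc)) v) =
      diagOp K (fun T => f (T.seq a)) (removeLast K α v) := by
  have : removeLast K α ∘ₗ diagOp K (fun T => f (T.seq a.castSucc)) =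
      diagOp K (fun T => f (T.seq a)) ∘ₗ removeLast K α := by
    apply Finsupp.lhom_ext'
    intro T
    apply LinearMap.ext_ring
    simp only [LinearMap.comp_apply, Finsupp.lsingle_apply]
    rw [← vec_seq, diagOp_vec, map_smul, removeLast_vec]
    split_ifs
    · rw [diagOp_vec]; rfl
    · simp
  exact LinearMap.congr_fun this v

variable [CharZero K] {τ : Fin 2 → K} (hτ : ∀ k, τ k ^ 2 = 1)

/-- The branching rule: the smaller group never moves the largest number, so fixing its node gives a
summand that is the smaller seminormal form. -/
theorem removeLast_seminormal (α : Fin 2 × ℕ × ℕ) (h : GroupB n)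
    (v : StandardTableau (n + 1 + 1) →₀ K) :
    removeLast K α (seminormal (n + 1) hτ (inclB n h) v) =
      seminormal n hτ h (removeLast K α v) := by
  induction h using (coxB n).simple_induction_left generalizing v with
  | one => simp
  | mul_simple_left h i ih =>
    rw [map_mul, map_mul, map_mul, inclB_simple, seminormal_simple, seminormal_simple,
      Module.End.mul_apply, Module.End.mul_apply, ← ih]
    refine Fin.cases ?_ (fun i => ?_) i
    · exact removeLast_diagOp (fun α => τ α.1) α 0 _
    · rw [genOp_succ, Fin.castSucc_succ, genOp_succ]
      exact removeLast_swapOp α i _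

theorem seminormal_inclB_apply (h : GroupB n) (S : StandardTableau (n + 1 + 1)) :
    seminormal (n + 1) hτ (inclB n h) (vec K S.seq) S =
      seminormal n hτ h (vec K S.restrict.seq) S.restrict := by
  rw [← removeLast_apply, removeLast_seminormal, removeLast_vec, if_pos rfl]

theorem seminormal_inclB_apply_eq_zero (h : GroupB n) {S R : StandardTableau (n + 1 + 1)}
    (hl : S.seq (Fin.last (n + 1)) ≠ R.seq (Fin.last (n + 1))) :
    seminormal (n + 1) hτ (inclB n h) (vec K S.seq) R = 0 := by
  rw [← removeLast_apply, removeLast_seminormal, removeLast_vec, if_neg hl, map_zero]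
  rfl

end Restriction

/-! ### The weighted trace and faithfulness -/

section Trace

variable (K : Type) [Field K] {n : ℕ}

/-- The trace of the seminormal form, weighted by the inverse hook products. -/
noncomputable def weightedTrace (n : ℕ) :
    Module.End K (StandardTableau (n + 1) →₀ K) →ₗ[K] K :=
  ∑ S : StandardTableau (n + 1),
    weight K S • (Finsupp.lapply S ∘ₗ LinearMap.applyₗ (vec K S.seq))

variable {K}

theorem weightedTrace_apply (A : Module.End K (StandardTableau (n + 1) →₀ K)) :
    weightedTrace K n A = ∑ S, weight K S * A (vec K S.seq) S := by
  unfold weightedTrace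
  rw [LinearMap.sum_apply]
  rfl

theorem vec_seq_self (S : StandardTableau (n + 1)) : vec K S.seq S = 1 := by
  rw [vec_seq, Finsupp.single_eq_same]

theorem vec_seq_of_ne {R S : StandardTableau (n + 1)} (h : R ≠ S) : vec K R.seq S = 0 := by
  rw [vec_seq, Finsupp.single_eq_of_ne (Ne.symm h)]

theorem sum_smul_vec (v : StandardTableau (n + 1) →₀ K) : v = ∑ R, v R • vec K R.seq := by
  conv_lhs => rw [← Finsupp.univ_sum_single v]
  apply sum_congr rfl
  intro R _
  rw [vec_seq, Finsupp.smul_single, smul_eq_mul, mul_one]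

theorem diagOp_apply (f : StandardTableau (n + 1) → K) (v : StandardTableau (n + 1) →₀ K)
    (R : StandardTableau (n + 1)) : diagOp K f v R = f R * v R := by
  have : Finsupp.lapply R ∘ₗ diagOp K f = f R • (Finsupp.lapply R :
      (StandardTableau (n + 1) →₀ K) →ₗ[K] K) := by
    apply Finsupp.lhom_ext'
    intro T
    apply LinearMap.ext_ring
    simp only [LinearMap.comp_apply, Finsupp.lsingle_apply, Finsupp.lapply_apply,
      LinearMap.smul_apply]
    rw [← vec_seq, diagOp_vec, vec_seq]
    by_cases h : T = R
    · subst h; simp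
    · simp [Finsupp.single_eq_of_ne (Ne.symm h)]
  exact LinearMap.congr_fun this v

theorem weight_eq_of_isSwap {i : Fin n} {T S : StandardTableau (n + 1)} (h : T.IsSwap i S) :
    weight K S = weight K T := by
  have : S.shape = T.shape := by
    funext k
    apply YoungDiagram.ext
    ext c
    rw [YoungDiagram.mem_cells, YoungDiagram.mem_cells, mem_shape_iff, mem_shape_iff,
      isSwap_iff.1 h]
    exact (Equiv.swap i.castSucc i.succ).exists_congr_left.trans (by simp)
  unfold weight
  rw [this]

theorem swapOp_mul_weight (i : Fin n) :
    swapOp K i * diagOp K (weight K) = diagOp K (weight K) * swapOp K i := by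
  apply end_ext
  intro T
  rw [Module.End.mul_apply, Module.End.mul_apply, diagOp_vec, map_smul, swapOp_vec, map_add,
    map_smul, map_smul, diagOp_vec]
  by_cases hnear : Near (T.seq i.castSucc) (T.seq i.succ)
  · rw [gcoef, if_pos hnear, zero_smul, zero_smul, add_zero, add_zero, smul_comm]
  · obtain ⟨S, hS⟩ := exists_isSwap_iff.2 hnear
    rw [← isSwap_iff.1 hS, diagOp_vec, weight_eq_of_isSwap hS]
    module

/-- Commuting with the weights means that `B` only connects tableaux of equal weight, so the weights
pass through the usual proof of the trace property. -/
theorem weightedTrace_mul_comm {A B : Module.End K (StandardTableau (n + 1) →₀ K)}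
    (hB : B * diagOp K (weight K) = diagOp K (weight K) * B) :
    weightedTrace K n (A * B) = weightedTrace K n (B * A) := by
  have hentry : ∀ S R, weight K S * B (vec K S.seq) R = weight K R * B (vec K S.seq) R := by
    intro S R
    have h := congrArg (fun v => v R) (LinearMap.congr_fun hB (vec K S.seq))
    simp only [Module.End.mul_apply, diagOp_vec, map_smul, diagOp_apply] at h
    exact h
  have hprod : ∀ (A B : Module.End K (StandardTableau (n + 1) →₀ K)) S,
      (A * B) (vec K S.seq) S = ∑ R, B (vec K S.seq) R * A (vec K R.seq) S := by
    intro A B S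
    rw [Module.End.mul_apply]
    conv_lhs => rw [sum_smul_vec (B (vec K S.seq)), map_sum, Finsupp.finsetSum_apply]
    simp
  rw [weightedTrace_apply, weightedTrace_apply]
  simp only [hprod, mul_sum]
  rw [sum_comm]
  apply sum_congr rfl
  intro R _
  apply sum_congr rfl
  intro S _
  rw [← mul_assoc, hentry]
  ring

variable [CharZero K] {τ : Fin 2 → K} (hτ : ∀ k, τ k ^ 2 = 1)

theorem seminormal_mul_weight (g : GroupB n) :
    seminormal n hτ g * diagOp K (weight K) = diagOp K (weight K) * seminormal n hτ g := by
  induction g using (coxB n).simple_induction_left with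
  | one => simp
  | mul_simple_left g i ih =>
    rw [map_mul, mul_assoc, ih, ← mul_assoc, ← mul_assoc, seminormal_simple]
    congr 1
    refine Fin.cases ?_ (fun i => ?_) i
    · apply end_ext
      intro T
      change diagOp K _ (diagOp K _ _) = diagOp K _ (diagOp K _ _)
      rw [diagOp_vec, diagOp_vec, map_smul, map_smul, diagOp_vec, diagOp_vec, smul_comm]
    · rw [genOp_succ]
      exact swapOp_mul_weight i

theorem seminormal_sig {m : ℕ} (hm : m < n + 1) : seminormal n hτ (sig n m) = genOp n τ m := by
  have : sig n m = (coxB n).simple ⟨m, hm⟩ := sig_val ⟨m, hm⟩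
  rw [this, seminormal_simple]

theorem seminormal_signChange (k : Fin (n + 1)) :
    seminormal n hτ (signChange (sig n) k) = diagOp K fun T => τ (T.seq k).1 := by
  induction k using Fin.induction with
  | zero =>
    exact seminormal_sig hτ (Nat.succ_pos n)
  | succ i ih =>
    have h1 := seminormal_sig hτ (m := (i : ℕ) + 1) (n := n) (by omega)
    have h2 : genOp n τ ((i : ℕ) + 1) = swapOp K i := genOp_succ τ i
    change seminormal n hτ (sig n (i + 1) * signChange (sig n) i * sig n (i + 1)) = _
    rw [map_mul, map_mul, h1, h2, ← swapOp_mul_diagOp_pos_mul_swapOp τ i, ← ih]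
    rfl

theorem weightedTrace_inclB (h : GroupB n) :
    weightedTrace K (n + 1) (seminormal (n + 1) hτ (inclB n h)) =
      2 * weightedTrace K n (seminormal n hτ h) := by
  rw [weightedTrace_apply, weightedTrace_apply]
  have := sum_weight_mul (K := K) (fun U : StandardTableau (n + 1) =>
    seminormal n hτ h (vec K U.seq) U) (fun _ => 1)
  simp only [one_mul, sum_weight_eq] at this
  simp only [seminormal_inclB_apply]
  rw [this, mul_sum]
  apply sum_congr rfl
  intro U _
  ring

theorem weightedTrace_signChange_mul (hτ' : τ 0 + τ 1 = 0) (h : GroupB n) :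
    weightedTrace K (n + 1) (seminormal (n + 1) hτ
      (inclB n h * signChange (sig (n + 1)) (n + 1))) = 0 := by
  have hs := seminormal_signChange hτ (Fin.last (n + 1))
  rw [Fin.val_last] at hs
  rw [map_mul, hs, weightedTrace_apply]
  have := sum_weight_mul (K := K) (fun U : StandardTableau (n + 1) =>
    seminormal n hτ h (vec K U.seq) U) (fun S => τ (S.seq (Fin.last (n + 1))).1)
  simp only [sum_weight_pos _ hτ', zero_mul, sum_const_zero] at this
  rw [← this]
  apply sum_congr rfl
  intro S _
  rw [Module.End.mul_apply, diagOp_vec, map_smul, Finsupp.smul_apply, seminormal_inclB_apply,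
    smul_eq_mul]

/-- The subgroup element keeps the node of the largest number, while the off-diagonal part of the
last generator changes it. Only the diagonal coefficient of the generator survives, and its weighted
sum over the extensions of each tableau is zero by `sum_weight_dcoef`. -/
theorem weightedTrace_sig_mul (h : GroupB n) :
    weightedTrace K (n + 1) (seminormal (n + 1) hτ (sig (n + 1) (n + 1) * inclB n h)) = 0 := by
  have hs := seminormal_sig hτ (m := n + 1) (n := n + 1) (by omega)
  have hs' : genOp (n + 1) τ (n + 1) = swapOp K (Fin.last n) := genOp_succ τ (Fin.last n)
  have := sum_weight_mul (K := K) (fun U : StandardTableau (n + 1) =>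
    seminormal n hτ h (vec K U.seq) U)
    (fun S => dcoef K (S.restrict.seq (Fin.last n)) (S.seq (Fin.last (n + 1))))
  have h0 : ∀ U : StandardTableau (n + 1),
      ∑ S : StandardTableau (n + 1 + 1) with S.restrict = U, weight K S *
        dcoef K (S.restrict.seq (Fin.last n)) (S.seq (Fin.last (n + 1))) = 0 := by
    intro U
    rw [← sum_weight_dcoef (K := K) U]
    apply sum_congr rfl
    intro S hS
    have hS' : S.restrict = U := by simpa using hS
    rw [hS']
  simp only [h0, zero_mul, sum_const_zero] at this
  rw [map_mul, hs, hs', weightedTrace_apply, ← this]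
  apply sum_congr rfl
  intro S _
  congr 1
  rw [Module.End.mul_apply, sum_smul_vec (seminormal (n + 1) hτ (inclB n h) (vec K S.seq)),
    map_sum, Finsupp.finsetSum_apply, sum_eq_single S]
  · rw [map_smul, Finsupp.smul_apply, seminormal_inclB_apply, swapOp_vec, Finsupp.add_apply,
      Finsupp.smul_apply, Finsupp.smul_apply, vec_seq_self, smul_eq_mul, smul_eq_mul, smul_eq_mul,
      mul_one]
    have hz : vec K (S.seq ∘ Equiv.swap (Fin.last n).castSucc (Fin.last n).succ) S = 0 := by
      unfold vec
      split_ifs with hx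
      · rw [Finsupp.single_eq_of_ne]
        intro he
        have h1 := congrFun (congrArg seq he) (Fin.last n).castSucc
        simp only [seq_ofSeq, Function.comp_apply, Equiv.swap_apply_left] at h1
        exact Fin.castSucc_lt_succ.ne (S.seq_injective h1)
      · rfl
    rw [hz, mul_zero, add_zero, mul_comm]
    rfl
  · intro R _ hRS
    rw [map_smul, Finsupp.smul_apply]
    by_cases hl : S.seq (Fin.last (n + 1)) = R.seq (Fin.last (n + 1))
    · rw [swapOp_vec, Finsupp.add_apply, Finsupp.smul_apply, Finsupp.smul_apply,
        vec_seq_of_ne hRS, smul_zero, zero_add]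
      have hz : vec K (R.seq ∘ Equiv.swap (Fin.last n).castSucc (Fin.last n).succ) S = 0 := by
        unfold vec
        split_ifs with hx
        · rw [Finsupp.single_eq_of_ne]
          intro he
          have h1 := congrFun (congrArg seq he) (Fin.last n).succ
          simp only [seq_ofSeq, Function.comp_apply, Equiv.swap_apply_right] at h1
          rw [Fin.succ_last, hl] at h1
          have h2 := R.seq_injective h1
          rw [Fin.ext_iff] at h2
          simp at h2
        · rfl
      rw [hz, smul_zero, smul_zero]
    · rw [seminormal_inclB_apply_eq_zero hτ h hl, zero_smul]
  · intro hS
    exact absurd (mem_univ S) hS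

theorem parabolic_zero {G : Type*} [Group G] (σ : ℕ → G) : parabolic σ 0 = ⊥ := by
  simp [parabolic]

theorem weightedTrace_base : weightedTrace K 0 1 = 2 ∧ (τ 0 + τ 1 = 0 →
    weightedTrace K 0 (diagOp K fun T => τ (T.seq 0).1) = 0) := by
  have hU : ∀ U : StandardTableau 0, weight K U = 1 := fun U => by
    rw [weight_eq_partialWeight le_rfl, partialWeight_zero]
  have hsub : ∀ U V : StandardTableau 0, U = V := fun U V => seq_ext (funext fun a => a.elim0)
  have U₀ : StandardTableau 0 := ofSeq (fun a => a.elim0) ⟨fun a => a.elim0, fun a => a.elim0⟩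
  have huniv : (univ : Finset (StandardTableau 0)) = {U₀} := by
    ext U
    simp [hsub U U₀]
  constructor
  · have := sum_weight_mul (K := K) (m := 0) (fun _ => 1) (fun _ => 1)
    simp only [sum_weight_eq, huniv, sum_singleton, hU] at this
    rw [weightedTrace_apply]
    simp only [Module.End.one_apply, vec_seq, Finsupp.single_eq_same]
    simpa using this
  · intro hτ'
    have := sum_weight_mul (K := K) (m := 0) (fun _ => 1) (fun S => τ (S.seq (Fin.last 0)).1)
    simp only [sum_weight_pos _ hτ', sum_const_zero, mul_one] at this
    rw [weightedTrace_apply, ← this]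
    apply sum_congr rfl
    intro S _
    rw [diagOp_vec, vec_seq]
    simp

theorem weightedTrace_one (n : ℕ) : weightedTrace K n 1 = 2 ^ (n + 1) := by
  induction n with
  | zero => rw [(weightedTrace_base (τ := fun _ : Fin 2 => (1 : K))).1]; norm_num
  | succ n ih =>
    have h := weightedTrace_inclB (K := K) (n := n) (τ := fun _ => 1) (by simp) 1
    rw [map_one (inclB n), map_one (seminormal _ _), map_one (seminormal _ _), ih] at h
    rw [h]
    ring

/-- The weighted trace of the seminormal form is a multiple of the regular character. -/
theorem weightedTrace_seminormal (hτ' : τ 0 + τ 1 = 0) {g : GroupB n} (hg : g ≠ 1) :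
    weightedTrace K n (seminormal n hτ g) = 0 := by
  induction n with
  | zero =>
    have hmem : g ∈ parabolic (sig 0) 1 := by rw [parabolic_sig_eq_top]; trivial
    rcases (relB_sig 0).double_coset 0 le_rfl hmem with h | ⟨h, _⟩ | ⟨a, ha, rfl⟩
    · rw [parabolic_zero, Subgroup.mem_bot] at h
      exact absurd h hg
    · omega
    · rw [parabolic_zero, Subgroup.mem_bot] at ha
      have := seminormal_signChange hτ (0 : Fin (0 + 1))
      rw [Fin.val_zero] at this
      rw [ha, one_mul, this]
      exact weightedTrace_base.2 hτ'
  | succ n ih =>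
    have hmem : g ∈ parabolic (sig (n + 1)) (n + 1 + 1) := by rw [parabolic_sig_eq_top]; trivial
    rcases (relB_sig (n + 1)).double_coset (n + 1) le_rfl hmem with
      h | ⟨_, a, ha, b, hb, rfl⟩ | ⟨a, ha, rfl⟩
    · obtain ⟨h, rfl⟩ := exists_inclB_eq h
      rw [weightedTrace_inclB, ih, mul_zero]
      rintro rfl
      exact hg (map_one _)
    · obtain ⟨a, rfl⟩ := exists_inclB_eq ha
      obtain ⟨b, rfl⟩ := exists_inclB_eq hb
      -- The trace property carries the left factor `a` to the right end, where it joins `b`.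
      rw [mul_assoc, map_mul, ← weightedTrace_mul_comm (seminormal_mul_weight hτ _), ← map_mul,
        mul_assoc, ← map_mul (inclB n)]
      exact weightedTrace_sig_mul hτ _
    · obtain ⟨a, rfl⟩ := exists_inclB_eq ha
      exact weightedTrace_signChange_mul hτ hτ' a

/-- The coefficient of `x` at `g` is recovered, up to 2^{n+1}, as the weighted trace of `g⁻¹ * x`.
-/
theorem seminormalAlg_injective (hτ' : τ 0 + τ 1 = 0) :
    Function.Injective (seminormalAlg n hτ) := by
  classical
  rw [injective_iff_map_eq_zero]
  intro x hx
  ext g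
  have h1 : weightedTrace K n (seminormal n hτ g⁻¹ * seminormalAlg n hτ x) = 0 := by
    rw [hx, mul_zero, map_zero]
  rw [seminormalAlg, MonoidAlgebra.lift_apply, Finsupp.sum, mul_sum, map_sum] at h1
  have h2 : ∀ h ∈ x.coeff.support, weightedTrace K n (seminormal n hτ g⁻¹ *
      x.coeff h • seminormal n hτ h) = if h = g then x.coeff g * 2 ^ (n + 1) else 0 := by
    intro h _
    rw [mul_smul_comm, map_smul, ← map_mul, smul_eq_mul]
    split_ifs with hgh
    · rw [hgh, inv_mul_cancel, map_one, weightedTrace_one]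
    · rw [weightedTrace_seminormal hτ hτ', mul_zero]
      intro h'
      exact hgh (inv_mul_eq_one.1 h').symm
  rw [sum_congr rfl h2, sum_ite_eq'] at h1
  split_ifs at h1 with hmem
  · simpa using h1
  · simpa using hmem

end Trace

end FusionB

/-! ### The action of φ on seminormal vectors -/

namespace FusionB

open Finset StandardTableau

section Fusion

variable {K : Type} [Field K] {n : ℕ}

theorem diagOp_comp (f g : StandardTableau (n + 1) → K) (v : StandardTableau (n + 1) →₀ K) :
    diagOp K f (diagOp K g v) = diagOp K g (diagOp K f v) := by
  ext R
  simp only [diagOp_apply]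
  ring

theorem swapOp_diagOp_of_ne (f : Fin 2 × ℕ × ℕ → K) {i : Fin n} {a : Fin (n + 1)}
    (h1 : a ≠ i.castSucc) (h2 : a ≠ i.succ) (v : StandardTableau (n + 1) →₀ K) :
    diagOp K (fun T => f (T.seq a)) (swapOp K i v) =
      swapOp K i (diagOp K (fun T => f (T.seq a)) v) := by
  have : diagOp K (fun T => f (T.seq a)) * swapOp K i =
      swapOp K i * diagOp K (fun T => f (T.seq a)) := by
    apply end_ext
    intro T
    rw [Module.End.mul_apply, Module.End.mul_apply, diagOp_node_vec, swapOp_vec, map_add, map_smul,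
      map_smul, map_smul, swapOp_vec, diagOp_node_vec, diagOp_node_vec, Function.comp_apply,
      Equiv.swap_apply_of_ne_of_ne h1 h2]
    module
  exact LinearMap.congr_fun this v

theorem cont_zero (S : StandardTableau (n + 1)) : cont (S.seq 0) = 0 := by
  have h1 := S.row_le 0
  have h2 := S.col_le 0
  simp only [Fin.val_zero, Nat.le_zero] at h1 h2
  simp [cont, h1, h2]

/-- `w` is a simultaneous eigenvector of the position and content operators of the numbers less
than `k`, with the eigenvalues prescribed by `T`. -/
def HasWeight (T : StandardTableau (n + 1)) (k : ℕ) (w : StandardTableau (n + 1) →₀ K) : Prop :=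
  ∀ a : Fin (n + 1), (a : ℕ) < k → ∀ f : Fin 2 → ℤ → K,
    diagOp K (fun S => f (S.seq a).1 (cont (S.seq a))) w = f (T.seq a).1 (cont (T.seq a)) • w

theorem HasWeight.diagOp {T : StandardTableau (n + 1)} {k : ℕ} {w : StandardTableau (n + 1) →₀ K}
    (hw : HasWeight T k w) (g : StandardTableau (n + 1) → K) : HasWeight T k (diagOp K g w) := by
  intro a ha f
  rw [diagOp_comp, hw a ha, map_smul]

/-- The eigenvalue condition at index i is given up, since the exchange mixes i with i+1. This is
the loss that the recursion for φ allows. -/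
theorem HasWeight.swapOp {T : StandardTableau (n + 1)} {i : Fin n}
    {w : StandardTableau (n + 1) →₀ K} (hw : HasWeight T (i + 1) w) :
    HasWeight T i (swapOp K i w) := by
  intro a ha f
  rw [swapOp_diagOp_of_ne (fun α => f α.1 (cont α)) (by rw [Ne, Fin.ext_iff]; simp; omega)
    (by rw [Ne, Fin.ext_iff]; simp; omega), hw a (by omega), map_smul]

theorem hasWeight_vec {T S : StandardTableau (n + 1)} {k : ℕ}
    (h : ∀ a : Fin (n + 1), (a : ℕ) < k → S.seq a = T.seq a) : HasWeight T k (vec K S.seq) := by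
  intro a ha f
  rw [diagOp_vec, h a ha]

variable [CharZero K] [Algebra ℂ K] {ξ : Fin 2 → ℂ}

theorem pos_mul_pos (hξ : ∀ k, ξ k ^ 2 = 1) (hξ' : Function.Injective ξ) (k l : Fin 2) :
    ξ k * ξ l = if k = l then 1 else -1 := by
  split_ifs with h
  · rw [h, ← pow_two, hξ]
  · have h1 : ξ k - ξ l ≠ 0 := sub_ne_zero.2 fun h' => h (hξ' h')
    have h2 : (ξ k - ξ l) * (ξ k + ξ l) = 0 := by
      linear_combination hξ k - hξ l
    have h3 := (mul_eq_zero.1 h2).resolve_left h1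
    linear_combination (ξ k) * h3 - hξ k

theorem map_sq_eq_one (K : Type) [Field K] [Algebra ℂ K] (hξ : ∀ k, ξ k ^ 2 = 1) :
    ∀ k, (algebraMap ℂ K (ξ k)) ^ 2 = 1 := fun k => by rw [← map_pow, hξ, map_one]

/-- The seminormal form over an extension of the complex numbers. -/
noncomputable abbrev seminormalExt (K : Type) [Field K] [CharZero K] [Algebra ℂ K] (n : ℕ)
    (hξ : ∀ k, ξ k ^ 2 = 1) :
    MonoidAlgebra K (GroupB n) →ₐ[K] Module.End K (StandardTableau (n + 1) →₀ K) :=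
  seminormalAlg n (map_sq_eq_one K hξ)

theorem seminormalExt_injective (hξ : ∀ k, ξ k ^ 2 = 1) (hξ' : Function.Injective ξ) :
    Function.Injective (seminormalExt K n hξ) := by
  apply seminormalAlg_injective
  have h := pos_mul_pos hξ hξ' 0 1
  rw [if_neg (by decide)] at h
  rw [← map_add]
  have : ξ 0 + ξ 1 = 0 := by linear_combination (ξ 0) * h - (ξ 1) * hξ 0
  rw [this, map_zero]

theorem seminormalExt_baxtT (hξ : ∀ k, ξ k ^ 2 = 1) (hξ' : Function.Injective ξ) (κ : Fin 2) :
    seminormalExt K n hξ (baxtT K n (ξ κ)) =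
      diagOp K fun S => if (S.seq 0).1 = κ then 1 else 0 := by
  rw [baxtT, map_smul, map_add, map_one, map_smul, seminormalAlg_genT]
  apply end_ext
  intro S
  rw [diagOp_vec, LinearMap.smul_apply, LinearMap.add_apply, LinearMap.smul_apply,
    Module.End.one_apply, diagOp_vec, smul_smul, ← map_mul, pos_mul_pos hξ hξ' κ]
  by_cases h : (S.seq 0).1 = κ
  · rw [if_pos h, if_pos h.symm, map_one]
    module
  · rw [if_neg h, if_neg (Ne.symm h), map_neg, map_one]
    module

theorem seminormalExt_baxtS (hξ : ∀ k, ξ k ^ 2 = 1) (hξ' : Function.Injective ξ) (i : Fin n)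
    (κ κ' : Fin 2) (a a' : K) (w : StandardTableau (n + 1) →₀ K) :
    seminormalExt K n hξ (baxtS i (ξ κ) (ξ κ') a a') w =
      swapOp K i w + (if κ = κ' then 1 / (a - a') else 0) • w := by
  rw [baxtS, map_add, seminormalAlg_genS, AlgHom.commutes, LinearMap.add_apply,
    Module.algebraMap_end_apply]
  congr 2
  by_cases h : κ = κ'
  · rw [if_pos h, if_pos (by rw [h])]
  · rw [if_neg h, if_neg fun h' => h (hξ' h')]

/-- The action of `φ_{r+1}` on simultaneous eigenvectors. -/
theorem seminormalExt_phi (hξ : ∀ k, ξ k ^ 2 = 1) (hξ' : Function.Injective ξ)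
    (T : StandardTableau (n + 1)) (u : Fin (n + 1) → K) (κ : Fin 2) {u' : K}
    (hu' : ∀ z : ℤ, u' ≠ z) (r : Fin (n + 1))
    (hu : ∀ a < r, u a = cont (T.seq a)) (w : StandardTableau (n + 1) →₀ K)
    (hw : HasWeight T r w) :
    seminormalExt K n hξ (phi (T.pos ξ) u (ξ κ) u' r)
      (u' • w - diagOp K (fun S => (cont (S.seq r) : K)) w) =
      contFun K (n + 1) (T.rows r κ) u' •
        diagOp K (fun S => if (S.seq r).1 = κ then 1 else 0) w := by
  induction r using Fin.induction generalizing w with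
  | zero =>
    have h1 : diagOp K (fun S : StandardTableau (n + 1) => (cont (S.seq 0) : K)) w = 0 := by
      ext R
      rw [diagOp_apply, cont_zero, Int.cast_zero, zero_mul]
      rfl
    have h2 : phi (T.pos ξ) u (ξ κ) u' 0 = baxtT K n (ξ κ) := rfl
    rw [h1, sub_zero, map_smul, h2, seminormalExt_baxtT hξ hξ', Fin.val_zero, rows_zero,
      contFun_zero _ hu']
  | succ i ih =>
    have hw' : HasWeight T (i + 1) w := hw
    have hp : HasWeight T i.castSucc w := fun a ha f => hw a (by
      rw [Fin.val_succ]
      rw [Fin.val_castSucc] at ha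
      omega) f
    have hui : ∀ a < i.castSucc, u a = cont (T.seq a) := fun a ha =>
      hu a (ha.trans Fin.castSucc_lt_succ)
    have hwi : ∀ f : Fin 2 → ℤ → K,
        diagOp K (fun S => f (S.seq i.castSucc).1 (cont (S.seq i.castSucc))) w =
          f (T.seq i.castSucc).1 (cont (T.seq i.castSucc)) • w :=
      hw' i.castSucc (by simp)
    have hphi : phi (T.pos ξ) u (ξ κ) u' i.succ =
        baxtS i (ξ κ) (ξ (T.seq i.castSucc).1) u' (u i.castSucc) *
          phi (T.pos ξ) u (ξ κ) u' i.castSucc * genS K i := rfl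
    set δ := diagOp K (fun S : StandardTableau (n + 1) =>
      if (S.seq i.castSucc).1 = (S.seq i.succ).1 then (1 : K) else 0)
    set Jp := diagOp K (fun S : StandardTableau (n + 1) => (cont (S.seq i.castSucc) : K))
    set Jq := diagOp K (fun S : StandardTableau (n + 1) => (cont (S.seq i.succ) : K))
    set Pp := diagOp K (fun S : StandardTableau (n + 1) =>
      if (S.seq i.castSucc).1 = κ then (1 : K) else 0)
    set Pq := diagOp K (fun S : StandardTableau (n + 1) =>
      if (S.seq i.succ).1 = κ then (1 : K) else 0)
    set c := contFun K (n + 1) (T.rows i.castSucc κ) u'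
    set X := seminormalExt K n hξ (phi (T.pos ξ) u (ξ κ) u' i.castSucc)
    have hJ : swapOp K i (Jq w) = Jp (swapOp K i w) + δ w :=
      LinearMap.congr_fun (swapOp_mul_diagOp_cont i) w
    have hP : swapOp K i (Pq w) = Pp (swapOp K i w) :=
      LinearMap.congr_fun (swapOp_mul_diagOp_pos (fun k => if k = κ then (1 : K) else 0) i) w
    have hss : ∀ v, swapOp K i (swapOp K i v) = v := fun v =>
      LinearMap.congr_fun (swapOp_sq i) v
    -- The induction hypothesis for the exchanged vector, followed by s P_{i+1} = P_i s.
    have h1 : X (u' • swapOp K i w - Jp (swapOp K i w)) = c • swapOp K i (Pq w) := by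
      rw [hP]
      exact ih hui _ hw'.swapOp
    have hup : u i.castSucc = cont (T.seq i.castSucc) := hu _ Fin.castSucc_lt_succ
    have hne : u' - u i.castSucc ≠ 0 := by
      rw [hup]
      exact sub_ne_zero.2 (hu' _)
    have hδP : Pp (δ w) = if (T.seq i.castSucc).1 = κ then δ w else 0 := by
      have := hwi (fun k _ => if k = κ then 1 else 0)
      have h2 : Pp (δ w) = δ (Pp w) := diagOp_comp _ _ _
      rw [h2]
      change Pp w = _ at this
      rw [this]
      split_ifs <;> simp
    -- The vector `δ w` is still an eigenvector of `Jp`, with eigenvalue `u i.castSucc`, so `u' -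
    -- Jp` acts on it by a nonzero scalar that can be divided out.
    have h2 : X (δ w) = (c / (u' - u i.castSucc)) • Pp (δ w) := by
      have := ih hui _ (hp.diagOp (fun S : StandardTableau (n + 1) =>
        if (S.seq i.castSucc).1 = (S.seq i.succ).1 then (1 : K) else 0))
      have hJδ : Jp (δ w) = u i.castSucc • δ w := by
        have h3 : Jp (δ w) = δ (Jp w) := diagOp_comp _ _ _
        have h4 : Jp w = _ := hwi (fun _ z => (z : K))
        rw [h3, h4, map_smul, hup]
      change X (u' • δ w - Jp (δ w)) = c • Pp (δ w) at this
      rw [hJδ, ← sub_smul, map_smul] at this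
      rw [div_eq_inv_mul, mul_smul, ← this, inv_smul_smul₀ hne]
    have hrows : T.rows i.succ κ = T.rows ((i.castSucc : Fin (n + 1)) + 1) κ := rfl
    rw [hphi, map_mul, map_mul, Module.End.mul_apply, Module.End.mul_apply, seminormalAlg_genS,
      map_sub, map_smul, hJ, ← sub_sub, map_sub, h1, h2, hδP, seminormalExt_baxtS hξ hξ', hrows]
    -- If the previous number lies in diagram κ, then `δ w = Pq w`, and s + x meets s - x on this
    -- vector with x = 1/(u' - u_i), giving the factor of `contFun_update`. Otherwise the correction
    -- terms vanish and s² = 1 remains.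
    by_cases hκ : (T.seq i.castSucc).1 = κ
    · have hδ : δ w = Pq w := by
        ext R
        have h3 := congrArg (fun v => v R) (hwi (fun k _ => if k = (R.seq i.succ).1 then 1 else 0))
        simp only [diagOp_apply, Finsupp.smul_apply, smul_eq_mul] at h3
        simp only [δ, Pq, diagOp_apply]
        rw [h3, hκ]
        by_cases h4 : (R.seq i.succ).1 = κ
        · rw [if_pos h4, if_pos h4.symm]
        · rw [if_neg h4, if_neg (Ne.symm h4)]
      have hcont : (cont (T.seq i.castSucc) : K) =
          (beta (T.rows i.castSucc κ) (T.seq i.castSucc).2.1 : K) := by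
        rw [← hκ, beta, ← T.col_eq_rows]
        rfl
      rw [if_pos hκ, if_pos hκ.symm, hδ, map_sub, map_smul, map_smul, hss, ← hκ,
        rows_succ_eq_update, contFun_update ((T.row_le _).trans_lt (Fin.is_lt _)) hu', hκ, ← hcont,
        ← hup]
      match_scalars
      · field_simp
        ring
      · field_simp
        ring
    · rw [if_neg hκ, if_neg (Ne.symm hκ), smul_zero, sub_zero, zero_smul, add_zero, map_smul, hss,
        rows_succ_of_ne T _ hκ]

theorem seminormalExt_phi_vec (hξ : ∀ k, ξ k ^ 2 = 1) (hξ' : Function.Injective ξ)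
    (T : StandardTableau (n + 1)) (u : Fin (n + 1) → K) (κ : Fin 2) {u' : K}
    (hu' : ∀ z : ℤ, u' ≠ z) (r : Fin (n + 1))
    (hu : ∀ a < r, u a = cont (T.seq a)) {S : StandardTableau (n + 1)}
    (hS : ∀ a : Fin (n + 1), (a : ℕ) < r → S.seq a = T.seq a) :
    seminormalExt K n hξ (phi (T.pos ξ) u (ξ κ) u' r) (vec K S.seq) =
      (if (S.seq r).1 = κ then contFun K (n + 1) (T.rows r κ) u' / (u' - cont (S.seq r)) else 0) •
        vec K S.seq := by
  have h := seminormalExt_phi hξ hξ' T u κ hu' r hu _ (hasWeight_vec hS)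
  have hne : u' - cont (S.seq r) ≠ 0 := sub_ne_zero.2 (hu' _)
  rw [diagOp_vec, diagOp_vec, ← sub_smul, map_smul] at h
  rw [← inv_smul_smul₀ hne (seminormalExt K n hξ _ _), h, smul_smul, smul_smul]
  congr 1
  split_ifs
  · field_simp
  · simp

end Fusion

end FusionB

/-! ### Diagonal elements of the group algebra and the idempotents E_T -/

namespace FusionB

open Finset StandardTableau

section Idempotents

variable {n : ℕ} {ξ : Fin 2 → ℂ}

/-- Extension of scalars of the group algebra. -/
noncomputable abbrev baseChange (K : Type) [Field K] [Algebra ℂ K] (n : ℕ) :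
    MonoidAlgebra ℂ (GroupB n) →+* MonoidAlgebra K (GroupB n) :=
  MonoidAlgebra.mapRingHom (GroupB n) (algebraMap ℂ K)

theorem baseChange_of (K : Type) [Field K] [Algebra ℂ K] (g : GroupB n) :
    baseChange K n (MonoidAlgebra.of ℂ _ g) = MonoidAlgebra.of K _ g := by
  simp [baseChange, MonoidAlgebra.of_apply]

theorem baseChange_smul (K : Type) [Field K] [Algebra ℂ K] (c : ℂ)
    (x : MonoidAlgebra ℂ (GroupB n)) :
    baseChange K n (c • x) = algebraMap ℂ K c • baseChange K n x := by
  ext g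
  simp [baseChange, Algebra.smul_def]

theorem baseChange_self (x : MonoidAlgebra ℂ (GroupB n)) : baseChange ℂ n x = x := by
  ext g
  simp [baseChange]

section Diagonal

variable (K : Type) [Field K]

theorem diagOp_add (f g : StandardTableau (n + 1) → K) :
    diagOp K (f + g) = diagOp K f + diagOp K g :=
  end_ext fun T => by
    rw [LinearMap.add_apply, diagOp_vec, diagOp_vec, diagOp_vec, Pi.add_apply, add_smul]

theorem diagOp_mul (f g : StandardTableau (n + 1) → K) :
    diagOp K (f * g) = diagOp K f * diagOp K g :=
  end_ext fun T => by
    rw [Module.End.mul_apply, diagOp_vec, diagOp_vec, map_smul, diagOp_vec, Pi.mul_apply, smul_smul,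
      mul_comm]

theorem diagOp_const (c : K) :
    diagOp K (fun _ : StandardTableau (n + 1) => c) = algebraMap K _ c :=
  end_ext fun T => by
    rw [diagOp_vec, Module.algebraMap_end_apply]

end Diagonal

/-- The functions on tableaux by which elements of the group algebra act, over every field. -/
noncomputable def diagonalSubalgebra (n : ℕ) (hξ : ∀ k, ξ k ^ 2 = 1) :
    Subalgebra ℂ (StandardTableau (n + 1) → ℂ) where
  carrier := {f | ∃ x : MonoidAlgebra ℂ (GroupB n), ∀ (K : Type) [Field K] [CharZero K]
    [Algebra ℂ K], seminormalExt K n hξ (baseChange K n x) =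
      diagOp K fun S => algebraMap ℂ K (f S)}
  mul_mem' := by
    rintro f g ⟨x, hx⟩ ⟨y, hy⟩
    refine ⟨x * y, fun K _ _ _ => ?_⟩
    rw [map_mul, map_mul, hx, hy, ← diagOp_mul]
    congr 1
    funext S
    simp
  add_mem' := by
    rintro f g ⟨x, hx⟩ ⟨y, hy⟩
    refine ⟨x + y, fun K _ _ _ => ?_⟩
    rw [map_add, map_add, hx, hy, ← diagOp_add]
    congr 1
    funext S
    simp
  algebraMap_mem' := by
    intro c
    refine ⟨c • 1, fun K _ _ _ => ?_⟩
    rw [baseChange_smul, map_smul, map_one, map_one]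
    rw [← Algebra.algebraMap_eq_smul_one, ← diagOp_const]
    rfl

theorem pos_mem_diagonalSubalgebra (hξ : ∀ k, ξ k ^ 2 = 1) (a : Fin (n + 1)) :
    (fun S => ξ (S.seq a).1) ∈ diagonalSubalgebra n hξ := by
  refine ⟨MonoidAlgebra.of ℂ _ (signChange (sig n) a), fun K _ _ _ => ?_⟩
  rw [baseChange_of, seminormalAlg_of, seminormal_signChange]

theorem comp_eq_mem_diagonalSubalgebra (hξ : ∀ k, ξ k ^ 2 = 1) (hξ' : Function.Injective ξ)
    (a b : Fin (n + 1)) :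
    (fun S => if (S.seq a).1 = (S.seq b).1 then 1 else 0) ∈ diagonalSubalgebra n hξ := by
  have : (fun S : StandardTableau (n + 1) => if (S.seq a).1 = (S.seq b).1 then (1 : ℂ) else 0) =
      (1 / 2 : ℂ) • (1 + (fun S => ξ (S.seq a).1) * fun S => ξ (S.seq b).1) := by
    funext S
    simp only [Pi.smul_apply, Pi.add_apply, Pi.one_apply, Pi.mul_apply, pos_mul_pos hξ hξ']
    split_ifs <;> norm_num
  rw [this]
  exact Subalgebra.smul_mem _ (add_mem (one_mem _) (mul_mem (pos_mem_diagonalSubalgebra hξ a)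
    (pos_mem_diagonalSubalgebra hξ b))) _

/-- The Jucys–Murphy elements, built by J_{i+1} = s_i (J_i s_i + δ). The projection δ is a
polynomial in sign changes, since the product of two positions is 1 or -1. -/
theorem cont_mem_diagonalSubalgebra (hξ : ∀ k, ξ k ^ 2 = 1) (hξ' : Function.Injective ξ)
    (a : Fin (n + 1)) :
    (fun S => (cont (S.seq a) : ℂ)) ∈ diagonalSubalgebra n hξ := by
  induction a using Fin.induction with
  | zero =>
    simp only [cont_zero, Int.cast_zero]
    exact zero_mem _
  | succ i ih =>
    obtain ⟨x, hx⟩ := ih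
    obtain ⟨y, hy⟩ := comp_eq_mem_diagonalSubalgebra hξ hξ' i.castSucc i.succ
    refine ⟨genS ℂ i * (x * genS ℂ i + y), fun K _ _ _ => ?_⟩
    have hg : baseChange K n (genS ℂ i) = genS K i := baseChange_of K _
    simp only [map_mul, map_add, hg, hx, hy, seminormalAlg_genS]
    have h := swapOp_mul_diagOp_cont (K := K) i
    simp only [map_intCast, apply_ite (algebraMap ℂ K), map_one, map_zero]
    rw [← h, ← mul_assoc, swapOp_sq, one_mul]

/-- Positions and contents separate tableaux, and a subalgebra of functions on a finite set that
separates points contains the indicators: a product of normalized differences, one for each other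
tableau. -/
theorem single_mem_diagonalSubalgebra (hξ : ∀ k, ξ k ^ 2 = 1) (hξ' : Function.Injective ξ)
    (T : StandardTableau (n + 1)) :
    (Pi.single T 1 : StandardTableau (n + 1) → ℂ) ∈ diagonalSubalgebra n hξ := by
  have hsep : ∀ S : StandardTableau (n + 1), ∃ h ∈ diagonalSubalgebra n hξ, S ≠ T → h T ≠ h S := by
    intro S
    by_cases hc : ∀ a, ξ (T.seq a).1 = ξ (S.seq a).1 ∧
        (cont (T.seq a) : ℂ) = cont (S.seq a)
    · refine ⟨0, zero_mem _, fun hST => absurd ?_ hST⟩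
      apply seq_ext
      funext a
      exact (seq_eq_of_cont_eq T S (n + 1) (fun a _ => ⟨hξ' (hc a).1, by exact_mod_cast (hc a).2⟩)
        a a.2).symm
    · push Not at hc
      obtain ⟨a, ha⟩ := hc
      by_cases h1 : ξ (T.seq a).1 = ξ (S.seq a).1
      · exact ⟨_, cont_mem_diagonalSubalgebra hξ hξ' a, fun _ => ha h1⟩
      · exact ⟨_, pos_mem_diagonalSubalgebra hξ a, fun _ => h1⟩
  choose h hmem hne using hsep
  have : (Pi.single T 1 : StandardTableau (n + 1) → ℂ) =
      ∏ S ∈ univ.erase T, (h S T - h S S)⁻¹ • (h S - algebraMap ℂ _ (h S S)) := by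
    funext R
    rw [Finset.prod_apply]
    by_cases hR : R = T
    · subst hR
      rw [Pi.single_eq_same]
      symm
      apply prod_eq_one
      intro S hS
      exact inv_mul_cancel₀ (sub_ne_zero.2 (hne S (ne_of_mem_erase hS)))
    · rw [Pi.single_eq_of_ne hR, prod_eq_zero (mem_erase.2 ⟨hR, mem_univ R⟩)]
      simp
  rw [this]
  exact prod_mem fun S _ => Subalgebra.smul_mem _
    (sub_mem (hmem S) (Subalgebra.algebraMap_mem _ _)) _

/-- The element that acts as the diagonal matrix unit of `T`, over every field. -/
noncomputable def tableauIdem (hξ : ∀ k, ξ k ^ 2 = 1) (hξ' : Function.Injective ξ)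
    (T : StandardTableau (n + 1)) : MonoidAlgebra ℂ (GroupB n) :=
  (single_mem_diagonalSubalgebra hξ hξ' T).choose

theorem seminormalExt_tableauIdem (K : Type) [Field K] [CharZero K] [Algebra ℂ K]
    (hξ : ∀ k, ξ k ^ 2 = 1) (hξ' : Function.Injective ξ) (T : StandardTableau (n + 1)) :
    seminormalExt K n hξ (baseChange K n (tableauIdem hξ hξ' T)) = diagOp K (Pi.single T 1) := by
  refine ((single_mem_diagonalSubalgebra hξ hξ' T).choose_spec K).trans ?_
  congr 1
  funext S
  rw [Pi.apply_single (fun _ => algebraMap ℂ K) (fun _ => map_zero _), map_one]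

theorem seminormalExt_tableauIdem_self (hξ : ∀ k, ξ k ^ 2 = 1) (hξ' : Function.Injective ξ)
    (T : StandardTableau (n + 1)) :
    seminormalExt ℂ n hξ (tableauIdem hξ hξ' T) = diagOp ℂ (Pi.single T 1) := by
  rw [← seminormalExt_tableauIdem ℂ hξ hξ' T, baseChange_self]

theorem sum_tableauIdem (hξ : ∀ k, ξ k ^ 2 = 1) (hξ' : Function.Injective ξ) :
    ∑ T : StandardTableau (n + 1), tableauIdem hξ hξ' T = 1 := by
  apply seminormalExt_injective (K := ℂ) hξ hξ'
  rw [map_sum, map_one]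
  apply end_ext
  intro S
  simp only [seminormalExt_tableauIdem_self, LinearMap.sum_apply, diagOp_vec,
    Module.End.one_apply, ← sum_smul]
  simp [Pi.single_apply]

/-! ### The seminormal form over the complex numbers -/

theorem content_eq (T : StandardTableau (n + 1)) (a : Fin (n + 1)) :
    T.content a = (cont (T.seq a) : ℂ) := by
  simp [content, cont, seq]

theorem diagCoeff_eq (hξ' : Function.Injective ξ) (i : Fin n) (T : StandardTableau (n + 1)) :
    diagCoeff ξ i T = dcoef ℂ (T.seq i.castSucc) (T.seq i.succ) := by
  have h : T.pos ξ i.castSucc = T.pos ξ i.succ ↔ (T.seq i.castSucc).1 = (T.seq i.succ).1 :=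
    hξ'.eq_iff
  simp only [diagCoeff, dcoef, h, content_eq, one_div, Int.cast_sub]

/-- The two clauses for s_i match the two cases of `gcoef`, because an exchange exists exactly when
the nodes are not near. -/
theorem isSeminormal_iff (hξ : ∀ k, ξ k ^ 2 = 1) (hξ' : Function.Injective ξ)
    (ρ : MonoidAlgebra ℂ (GroupB n) →ₐ[ℂ] Module.End ℂ (TableauSpace n)) :
    IsSeminormal ξ ρ ↔ ρ = seminormalExt ℂ n hξ := by
  have hb : ∀ T : StandardTableau (n + 1), basisVec T = vec ℂ T.seq := fun T => (vec_seq ℂ T).symm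
  have hT : ∀ T : StandardTableau (n + 1),
      seminormalExt ℂ n hξ (genT ℂ n) (vec ℂ T.seq) = T.pos ξ 0 • vec ℂ T.seq := by
    intro T
    rw [seminormalAlg_genT, diagOp_vec]
    rfl
  have hS : ∀ (i : Fin n) (T S : StandardTableau (n + 1)), T.IsSwap i S →
      seminormalExt ℂ n hξ (genS ℂ i) (vec ℂ T.seq) =
        diagCoeff ξ i T • vec ℂ T.seq + (1 + diagCoeff ξ i T) • vec ℂ S.seq := by
    intro i T S h
    rw [seminormalAlg_genS, swapOp_vec, diagCoeff_eq hξ', gcoef,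
      if_neg (exists_isSwap_iff.1 ⟨S, h⟩), isSwap_iff.1 h]
  have hN : ∀ (i : Fin n) (T : StandardTableau (n + 1)), (¬ ∃ S, T.IsSwap i S) →
      seminormalExt ℂ n hξ (genS ℂ i) (vec ℂ T.seq) = diagCoeff ξ i T • vec ℂ T.seq := by
    intro i T h
    rw [exists_isSwap_iff, not_not] at h
    rw [seminormalAlg_genS, swapOp_vec, diagCoeff_eq hξ', gcoef, if_pos h, zero_smul, add_zero]
  constructor
  · intro hρ
    refine MonoidAlgebra.algHom_ext' ?_ (Subsingleton.elim _ _)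
    apply (coxB n).ext_simple
    intro b
    change ρ (gen ℂ b) = seminormalExt ℂ n hξ (gen ℂ b)
    apply end_ext
    intro T
    refine Fin.cases ?_ (fun i => ?_) b
    · refine Eq.trans ?_ (hT T).symm
      have := hρ.t_apply T
      rwa [hb] at this
    · by_cases h : ∃ S, T.IsSwap i S
      · obtain ⟨S, h⟩ := h
        refine Eq.trans ?_ (hS i T S h).symm
        have := hρ.s_apply i T S h
        rwa [hb, hb] at this
      · refine Eq.trans ?_ (hN i T h).symm
        have := hρ.s_apply_of_not i T h
        rwa [hb] at this
  · rintro rfl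
    constructor
    · simpa only [hb] using hT
    · simpa only [hb] using hS
    · simpa only [hb] using hN

theorem isTableauIdempotent_iff (hξ : ∀ k, ξ k ^ 2 = 1) (hξ' : Function.Injective ξ)
    (T : StandardTableau (n + 1)) (E : MonoidAlgebra ℂ (GroupB n)) :
    IsTableauIdempotent ξ T E ↔ E = tableauIdem hξ hξ' T := by
  have hb : ∀ T : StandardTableau (n + 1), basisVec T = vec ℂ T.seq := fun T => (vec_seq ℂ T).symm
  simp only [IsTableauIdempotent, isSeminormal_iff hξ hξ', exists_eq_left, hb]
  rw [← (seminormalExt_injective (K := ℂ) hξ hξ').eq_iff, seminormalExt_tableauIdem_self]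
  constructor
  · rintro ⟨h1, h2⟩
    apply end_ext
    intro S
    rw [diagOp_vec]
    by_cases hST : S = T
    · rw [hST, h1, Pi.single_eq_same, one_smul]
    · rw [h2 S hST, Pi.single_eq_of_ne hST, zero_smul]
  · intro h
    rw [h]
    refine ⟨?_, fun S hST => ?_⟩
    · rw [diagOp_vec, Pi.single_eq_same, one_smul]
    · rw [diagOp_vec, Pi.single_eq_of_ne hST, zero_smul]

theorem isPrimitiveIdempotent_tableauIdem (hξ : ∀ k, ξ k ^ 2 = 1) (hξ' : Function.Injective ξ)
    (T : StandardTableau (n + 1)) : IsPrimitiveIdempotent (tableauIdem hξ hξ' T) := by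
  have hinj := seminormalExt_injective (K := ℂ) (n := n) hξ hξ'
  have hE := seminormalExt_tableauIdem_self hξ hξ' T
  have hid : IsIdempotentElem (tableauIdem hξ hξ' T) := by
    apply hinj
    rw [map_mul, hE, ← diagOp_mul]
    congr 1
    funext S
    rw [Pi.mul_apply]
    by_cases h : S = T
    · rw [h, Pi.single_eq_same, mul_one]
    · rw [Pi.single_eq_of_ne h, mul_zero]
  have hne : tableauIdem hξ hξ' T ≠ 0 := by
    intro h
    have h1 := congrArg (seminormalExt ℂ n hξ) h
    rw [map_zero, hE] at h1
    have h2 := LinearMap.congr_fun h1 (vec ℂ T.seq)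
    have h3 := congrArg (fun v => v T) h2
    simp [diagOp_vec, vec_seq_self] at h3
  refine ⟨hne, hid, fun a b ha hb hab hba hsum => ?_⟩
  have hEaE : tableauIdem hξ hξ' T * a * tableauIdem hξ hξ' T = a := by
    rw [← hsum, add_mul, hba, add_zero, ha.eq, mul_add, hab, add_zero, ha.eq]
  -- The idempotent acts with rank one, so `E * a * E` is a multiple of `E`, by the diagonal entry
  -- of `a` at `T`. Idempotency then forces the multiple to be 0 or 1.
  obtain ⟨α, hα⟩ : ∃ α : ℂ, a = α • tableauIdem hξ hξ' T := by
    refine ⟨seminormalExt ℂ n hξ a (vec ℂ T.seq) T, ?_⟩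
    apply hinj
    conv_lhs => rw [← hEaE]
    rw [map_mul, map_mul, map_smul, hE]
    apply end_ext
    intro S
    rw [Module.End.mul_apply, Module.End.mul_apply, LinearMap.smul_apply, diagOp_vec, map_smul,
      map_smul, smul_comm]
    by_cases h : S = T
    · subst h
      congr 1
      ext R
      rw [diagOp_apply, Finsupp.smul_apply]
      by_cases hR : R = S
      · rw [hR, Pi.single_eq_same, one_mul, vec_seq_self, smul_eq_mul, mul_one]
      · rw [Pi.single_eq_of_ne hR, zero_mul, vec_seq_of_ne (Ne.symm hR), smul_zero]
    · rw [Pi.single_eq_of_ne h, zero_smul, zero_smul]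
  have hα2 : (α * α - α) • tableauIdem hξ hξ' T = 0 := by
    rw [sub_smul, mul_smul]
    have := ha.eq
    rw [hα, smul_mul_smul_comm, hid.eq, mul_smul] at this
    rw [this, sub_self]
  have hα3 : α * (α - 1) = 0 := by
    have := (smul_eq_zero.1 hα2).resolve_right hne
    linear_combination this
  rcases mul_eq_zero.1 hα3 with h | h
  · left
    rw [hα, h, zero_smul]
  · right
    rw [sub_eq_zero.1 h, one_smul] at hα
    rw [hα] at hsum
    exact left_eq_add.1 hsum.symm

end Idempotents

end FusionB

/-! ### Evaluation of rational functions and of group algebra elements -/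

namespace FusionB

section Evaluation

variable {m : ℕ} {k : Fin m} {c : ℂ}

theorem ne_zero_of_substVar_ne_zero {Q : MvPolynomial (Fin m) ℂ} (h : substVar k c Q ≠ 0) :
    algebraMap _ (RatFun m) Q ≠ 0 := by
  intro h0
  rw [map_eq_zero_iff _ (IsFractionRing.injective (MvPolynomial (Fin m) ℂ) (RatFun m))] at h0
  exact h (by rw [h0, map_zero])

theorem algebraMap_substVar_ne_zero {Q : MvPolynomial (Fin m) ℂ} (h : substVar k c Q ≠ 0) :
    algebraMap _ (RatFun m) (substVar k c Q) ≠ 0 := fun h0 =>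
  h ((map_eq_zero_iff _ (IsFractionRing.injective (MvPolynomial (Fin m) ℂ) (RatFun m))).1 h0)

theorem IsEvalAt.of_polynomial (P : MvPolynomial (Fin m) ℂ) :
    IsEvalAt k c (algebraMap _ (RatFun m) P) (algebraMap _ (RatFun m) (substVar k c P)) :=
  ⟨P, 1, by simp, by simp, by simp⟩

theorem IsEvalAt.const (a : ℂ) :
    IsEvalAt k c (algebraMap ℂ (RatFun m) a) (algebraMap ℂ (RatFun m) a) := by
  have := IsEvalAt.of_polynomial (k := k) (c := c) (algebraMap ℂ _ a)
  rwa [AlgHom.commutes, ← IsScalarTower.algebraMap_apply] at this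

theorem IsEvalAt.zero : IsEvalAt k c 0 0 := by
  have := IsEvalAt.const (k := k) (c := c) 0
  rwa [map_zero] at this

theorem IsEvalAt.one : IsEvalAt k c 1 1 := by
  have := IsEvalAt.const (k := k) (c := c) 1
  rwa [map_one] at this

theorem IsEvalAt.intCast (z : ℤ) : IsEvalAt k c z z := by
  have := IsEvalAt.const (k := k) (c := c) z
  rwa [map_intCast] at this

theorem IsEvalAt.uvar_self : IsEvalAt k c (uvar k) (algebraMap ℂ (RatFun m) c) := by
  have := IsEvalAt.of_polynomial (k := k) (c := c) (MvPolynomial.X k)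
  rwa [substVar, MvPolynomial.aeval_X, Function.update_self, ← MvPolynomial.algebraMap_eq,
    ← IsScalarTower.algebraMap_apply] at this

theorem IsEvalAt.uvar_of_ne {j : Fin m} (h : j ≠ k) : IsEvalAt k c (uvar j) (uvar j) := by
  have := IsEvalAt.of_polynomial (k := k) (c := c) (MvPolynomial.X j)
  rwa [substVar, MvPolynomial.aeval_X, Function.update_of_ne h] at this

variable {x y x' y' : RatFun m}

theorem IsEvalAt.mul (h : IsEvalAt k c x y) (h' : IsEvalAt k c x' y') :
    IsEvalAt k c (x * x') (y * y') := by
  obtain ⟨P, Q, hQ, rfl, rfl⟩ := h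
  obtain ⟨P', Q', hQ', rfl, rfl⟩ := h'
  refine ⟨P * P', Q * Q', ?_, ?_, ?_⟩
  · rw [map_mul]
    exact mul_ne_zero hQ hQ'
  · rw [map_mul, map_mul, div_mul_div_comm]
  · simp only [map_mul, div_mul_div_comm]

theorem IsEvalAt.add (h : IsEvalAt k c x y) (h' : IsEvalAt k c x' y') :
    IsEvalAt k c (x + x') (y + y') := by
  obtain ⟨P, Q, hQ, rfl, rfl⟩ := h
  obtain ⟨P', Q', hQ', rfl, rfl⟩ := h'
  refine ⟨P * Q' + Q * P', Q * Q', ?_, ?_, ?_⟩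
  · rw [map_mul]
    exact mul_ne_zero hQ hQ'
  · rw [map_add, map_mul, map_mul, map_mul, div_add_div _ _ (ne_zero_of_substVar_ne_zero hQ)
      (ne_zero_of_substVar_ne_zero hQ')]
  · simp only [map_mul, map_add]
    rw [div_add_div _ _ (algebraMap_substVar_ne_zero hQ) (algebraMap_substVar_ne_zero hQ')]

theorem IsEvalAt.neg (h : IsEvalAt k c x y) : IsEvalAt k c (-x) (-y) := by
  have := (IsEvalAt.intCast (k := k) (c := c) (-1)).mul h
  simpa using this

theorem IsEvalAt.sub (h : IsEvalAt k c x y) (h' : IsEvalAt k c x' y') :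
    IsEvalAt k c (x - x') (y - y') := by
  rw [sub_eq_add_neg, sub_eq_add_neg]
  exact h.add h'.neg

theorem IsEvalAt.inv (h : IsEvalAt k c x y) (hy : y ≠ 0) : IsEvalAt k c x⁻¹ y⁻¹ := by
  obtain ⟨P, Q, hQ, rfl, rfl⟩ := h
  refine ⟨Q, P, ?_, inv_div _ _, inv_div _ _⟩
  intro h0
  rw [h0, map_zero, zero_div] at hy
  exact hy rfl

theorem IsEvalAt.div (h : IsEvalAt k c x y) (h' : IsEvalAt k c x' y') (hy : y' ≠ 0) :
    IsEvalAt k c (x / x') (y / y') := by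
  rw [div_eq_mul_inv, div_eq_mul_inv]
  exact h.mul (h'.inv hy)

theorem IsEvalAt.prod {ι : Type*} (s : Finset ι) {f g : ι → RatFun m}
    (h : ∀ i ∈ s, IsEvalAt k c (f i) (g i)) : IsEvalAt k c (∏ i ∈ s, f i) (∏ i ∈ s, g i) := by
  classical
  induction s using Finset.induction_on with
  | empty => simpa using IsEvalAt.one
  | insert i s hi ih =>
    rw [Finset.prod_insert hi, Finset.prod_insert hi]
    exact (h i (Finset.mem_insert_self i s)).mul
      (ih fun j hj => h j (Finset.mem_insert_of_mem hj))

/-- The pairs of a rational function and its value at `u_k = c`. -/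
def evalSubring (k : Fin m) (c : ℂ) : Subring (RatFun m × RatFun m) where
  carrier := {p | IsEvalAt k c p.1 p.2}
  mul_mem' h h' := h.mul h'
  one_mem' := IsEvalAt.one
  add_mem' h h' := h.add h'
  zero_mem' := IsEvalAt.zero
  neg_mem' h := h.neg

variable (G : Type) [Group G]

/-- The pairs of an element of the group algebra over the rational functions and its value at
`u_k = c`. -/
noncomputable def evalAlgebra (k : Fin m) (c : ℂ) :
    Subring (MonoidAlgebra (RatFun m) G × MonoidAlgebra (RatFun m) G) :=
  ((MonoidAlgebra.mapRingHom G ((RingHom.fst _ _).comp (evalSubring k c).subtype)).prod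
    (MonoidAlgebra.mapRingHom G ((RingHom.snd _ _).comp (evalSubring k c).subtype))).range

variable {G} {X Y : MonoidAlgebra (RatFun m) G}

/-- Membership in a subring is used to pass products through evaluation; coefficients are read off
only at the end. -/
theorem isEvalAt_coeff (h : (X, Y) ∈ evalAlgebra G k c) (g : G) :
    IsEvalAt k c (X.coeff g) (Y.coeff g) := by
  obtain ⟨Z, hZ⟩ := h
  obtain ⟨rfl, rfl⟩ := Prod.mk.inj hZ
  rw [MonoidAlgebra.coeff_mapRingHom, MonoidAlgebra.coeff_mapRingHom]
  exact (Z.coeff g).2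

theorem of_mem_evalAlgebra (g : G) :
    (MonoidAlgebra.of (RatFun m) G g, MonoidAlgebra.of (RatFun m) G g) ∈ evalAlgebra G k c :=
  ⟨MonoidAlgebra.of _ G g, by simp [MonoidAlgebra.of_apply]⟩

theorem mul_mem_evalAlgebra {X' Y' : MonoidAlgebra (RatFun m) G} (h : (X, Y) ∈ evalAlgebra G k c)
    (h' : (X', Y') ∈ evalAlgebra G k c) : (X * X', Y * Y') ∈ evalAlgebra G k c := by
  rw [← Prod.mk_mul_mk]
  exact mul_mem h h'

theorem add_mem_evalAlgebra {X' Y' : MonoidAlgebra (RatFun m) G} (h : (X, Y) ∈ evalAlgebra G k c)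
    (h' : (X', Y') ∈ evalAlgebra G k c) : (X + X', Y + Y') ∈ evalAlgebra G k c := by
  rw [← Prod.mk_add_mk]
  exact add_mem h h'

theorem one_mem_evalAlgebra : ((1, 1) : MonoidAlgebra (RatFun m) G × MonoidAlgebra (RatFun m) G) ∈
    evalAlgebra G k c := by
  rw [Prod.mk_one_one]
  exact one_mem _

theorem smul_mem_evalAlgebra (hx : IsEvalAt k c x y) (h : (X, Y) ∈ evalAlgebra G k c) :
    (x • X, y • Y) ∈ evalAlgebra G k c := by
  have h1 : (x • 1, y • 1) ∈ evalAlgebra G k c := by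
    refine ⟨MonoidAlgebra.single 1 ⟨(x, y), hx⟩, ?_⟩
    simp [MonoidAlgebra.one_def]
  have h2 := mul_mem_evalAlgebra h1 h
  rwa [smul_one_mul, smul_one_mul] at h2

theorem reverse_prod_mem_evalAlgebra {l l' : List (MonoidAlgebra (RatFun m) G)}
    (h : List.Forall₂ (fun X Y => (X, Y) ∈ evalAlgebra G k c) l l') :
    (l.reverse.prod, l'.reverse.prod) ∈ evalAlgebra G k c := by
  induction h with
  | nil => exact one_mem_evalAlgebra
  | cons h _ ih =>
    rw [List.reverse_cons, List.reverse_cons, List.prod_append, List.prod_append,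
      List.prod_singleton, List.prod_singleton]
    exact mul_mem_evalAlgebra ih h

theorem sum_mem_evalAlgebra {ι : Type*} (s : Finset ι) {f g : ι → MonoidAlgebra (RatFun m) G}
    (h : ∀ i ∈ s, (f i, g i) ∈ evalAlgebra G k c) :
    (∑ i ∈ s, f i, ∑ i ∈ s, g i) ∈ evalAlgebra G k c := by
  classical
  induction s using Finset.induction_on with
  | empty => exact zero_mem (evalAlgebra G k c)
  | insert i s hi ih =>
    rw [Finset.sum_insert hi, Finset.sum_insert hi]
    exact add_mem_evalAlgebra (h i (Finset.mem_insert_self i s))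
      (ih fun j hj => h j (Finset.mem_insert_of_mem hj))

theorem uvar_ne_uvar {i j : Fin m} (h : i ≠ j) : uvar i ≠ uvar j := fun h' =>
  h (MvPolynomial.X_injective (IsFractionRing.injective (MvPolynomial (Fin m) ℂ) (RatFun m) h'))

theorem uvar_ne_const (i : Fin m) (a : ℂ) : uvar i ≠ algebraMap ℂ (RatFun m) a := by
  intro h
  rw [IsScalarTower.algebraMap_apply ℂ (MvPolynomial (Fin m) ℂ) (RatFun m)] at h
  have h1 := congrArg (MvPolynomial.eval fun _ => a + 1)
    (IsFractionRing.injective (MvPolynomial (Fin m) ℂ) (RatFun m) h)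
  simp at h1

theorem uvar_ne_intCast (i : Fin m) (z : ℤ) : uvar i ≠ (z : RatFun m) := by
  have := uvar_ne_const i z
  rwa [map_intCast] at this

end Evaluation

section Baxterized

variable {m n : ℕ} {k : Fin m} {c : ℂ}

theorem baseChange_mem_evalAlgebra (x : MonoidAlgebra ℂ (GroupB n)) :
    (baseChange (RatFun m) n x, baseChange (RatFun m) n x) ∈ evalAlgebra (GroupB n) k c := by
  induction x using MonoidAlgebra.induction_on with
  | of g =>
    rw [baseChange_of]
    exact of_mem_evalAlgebra g
  | add x y hx hy =>
    rw [map_add]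
    exact add_mem_evalAlgebra hx hy
  | smul a x hx =>
    rw [baseChange_smul]
    exact smul_mem_evalAlgebra (IsEvalAt.const a) hx

theorem baxtT_mem_evalAlgebra (p : ℂ) :
    (baxtT (RatFun m) n p, baxtT (RatFun m) n p) ∈ evalAlgebra (GroupB n) k c := by
  have h2 : IsEvalAt k c (1 / 2 : RatFun m) (1 / 2) := by
    have := IsEvalAt.const (k := k) (c := c) (1 / 2)
    rwa [map_div₀, map_one, map_ofNat] at this
  exact smul_mem_evalAlgebra h2 (add_mem_evalAlgebra one_mem_evalAlgebra
    (smul_mem_evalAlgebra (IsEvalAt.const p) (of_mem_evalAlgebra _)))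

theorem baxtS_mem_evalAlgebra (i : Fin n) (p p' : ℂ) {a a' b b' : RatFun m}
    (h : IsEvalAt k c a b) (h' : IsEvalAt k c a' b') (hne : b ≠ b') :
    (baxtS i p p' a a', baxtS i p p' b b') ∈ evalAlgebra (GroupB n) k c := by
  refine add_mem_evalAlgebra (of_mem_evalAlgebra _) ?_
  rw [Algebra.algebraMap_eq_smul_one, Algebra.algebraMap_eq_smul_one]
  refine smul_mem_evalAlgebra ?_ one_mem_evalAlgebra
  split_ifs
  · exact IsEvalAt.one.div (h.sub h') (sub_ne_zero.2 hne)
  · exact IsEvalAt.zero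

/-- The only possible poles of φ are the denominators a - u_i, so it is regular as long as the value
of its last argument stays away from those of the earlier ones. -/
theorem phi_mem_evalAlgebra (v : Fin (n + 1) → ℂ) {u w : Fin (n + 1) → RatFun m} (p : ℂ)
    {a b : RatFun m} (h : IsEvalAt k c a b) (r : Fin (n + 1))
    (hu : ∀ i < r, IsEvalAt k c (u i) (w i) ∧ b ≠ w i) :
    (phi v u p a r, phi v w p b r) ∈ evalAlgebra (GroupB n) k c := by
  induction r using Fin.induction with
  | zero => exact baxtT_mem_evalAlgebra p
  | succ i ih =>
    have hi := hu i.castSucc Fin.castSucc_lt_succ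
    exact mul_mem_evalAlgebra (mul_mem_evalAlgebra (baxtS_mem_evalAlgebra i p (v i.castSucc) h hi.1 hi.2)
      (ih fun j hj => hu j (hj.trans Fin.castSucc_lt_succ))) (of_mem_evalAlgebra _)

end Baxterized

end FusionB

/-! ### The fusion procedure -/

namespace FusionB

open Finset StandardTableau

section Fusion

variable {n : ℕ} {ξ : Fin 2 → ℂ}

theorem contFun_div {K : Type} [Field K] (L : ℕ) (l : ℕ → ℕ) {i : ℕ} (hi : i ≤ L) {u : K}
    (hu : u - beta l i ≠ 0) :
    contFun K L l u / (u - beta l i) = (∏ j ∈ (range (L + 1)).erase i, (u - beta l j)) /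
      ∏ j ∈ range L, (u - beta l j + 1) := by
  rw [contFun, ← mul_prod_erase _ _ (mem_range.2 (Nat.lt_succ_of_le hi)), div_right_comm,
    mul_div_cancel_left₀ _ hu]

/-- The value of the rational function `contFun / (u - x)` at an addable content. -/
theorem isEvalAt_contFun_div {m : ℕ} (k : Fin m) (L : ℕ) (l : ℕ → ℕ) (hl : Antitone l) {i i₀ : ℕ}
    (hi : i ≤ L) (hi₀ : i₀ ≤ L) (hadd : ∀ j < i₀, l i₀ < l j) :
    IsEvalAt k (beta l i₀ : ℂ) (contFun (RatFun m) L l (uvar k) / (uvar k - beta l i))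
      (algebraMap ℂ _ (if i = i₀ then (transRatio ℂ L l i₀)⁻¹ else 0)) := by
  rw [contFun_div L l hi (sub_ne_zero.2 (uvar_ne_intCast k _))]
  -- As row `i₀` can take a node, β_j ≥ β_{i₀} + 2 for the rows above and β_j ≤ β_{i₀} for the
  -- others, so the value β_{i₀} + 1 is skipped.
  have hden : ∏ j ∈ range L, (algebraMap ℂ (RatFun m) (beta l i₀ : ℂ) - beta l j + 1) ≠ 0 := by
    rw [prod_ne_zero_iff]
    intro j _
    rw [map_intCast, ← Int.cast_sub, ← Int.cast_one, ← Int.cast_add, Int.cast_ne_zero]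
    unfold beta
    rcases lt_or_ge j i₀ with hj | hj
    · have := hadd j hj
      omega
    · have := hl hj
      omega
  have heval := (IsEvalAt.prod (k := k) (c := (beta l i₀ : ℂ)) ((range (L + 1)).erase i)
    (f := fun j => uvar k - (beta l j : RatFun m))
    fun j _ => IsEvalAt.uvar_self.sub (IsEvalAt.intCast (beta l j))).div
    (IsEvalAt.prod (range L) (f := fun j => uvar k - (beta l j : RatFun m) + 1) fun j _ =>
      (IsEvalAt.uvar_self.sub (IsEvalAt.intCast (beta l j))).add IsEvalAt.one) hden
  convert heval using 1
  split_ifs with h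
  · subst h
    rw [transRatio, inv_div, map_div₀, map_prod, map_prod]
    simp
  -- The zero of `contFun` at the content for row `i₀` is not cancelled by the pole at that of
  -- another row.
  · rw [map_zero, prod_eq_zero (mem_erase.2 ⟨Ne.symm h, mem_range.2 (Nat.lt_succ_of_le hi₀)⟩),
      zero_div]
    simp

/-- The 2-tableaux that agree with `T` in the numbers less than `k`. -/
noncomputable def agreeing (T : StandardTableau (n + 1)) (k : ℕ) :
    Finset (StandardTableau (n + 1)) :=
  {S | ∀ a : Fin (n + 1), (a : ℕ) < k → S.seq a = T.seq a}

theorem mem_agreeing {T S : StandardTableau (n + 1)} {k : ℕ} :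
    S ∈ agreeing T k ↔ ∀ a : Fin (n + 1), (a : ℕ) < k → S.seq a = T.seq a := by
  simp [agreeing]

theorem agreeing_zero (T : StandardTableau (n + 1)) : agreeing T 0 = univ := by
  ext S
  simp [mem_agreeing]

theorem agreeing_last (T : StandardTableau (n + 1)) : agreeing T (n + 1) = {T} := by
  ext S
  rw [mem_agreeing, mem_singleton]
  constructor
  · intro h
    exact seq_ext (funext fun a => h a a.2)
  · rintro rfl a _
    rfl

theorem agreeing_succ (T : StandardTableau (n + 1)) (k : Fin (n + 1)) :
    agreeing T (k + 1) = (agreeing T k).filter fun S => S.seq k = T.seq k := by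
  ext S
  rw [mem_filter, mem_agreeing, mem_agreeing]
  constructor
  · intro h
    exact ⟨fun a ha => h a (by omega), h k (by omega)⟩
  · rintro ⟨h, hk⟩ a ha
    rcases Nat.lt_succ_iff_lt_or_eq.1 ha with h' | h'
    · exact h a h'
    · rw [Fin.ext h', hk]

/-- The sum of the idempotents of the 2-tableaux that agree with `T` in the numbers less than `k`,
divided by the weight of the 2-tableau formed by these numbers. -/
noncomputable def partialIdem (hξ : ∀ k, ξ k ^ 2 = 1) (hξ' : Function.Injective ξ)
    (T : StandardTableau (n + 1)) (k : ℕ) : MonoidAlgebra ℂ (GroupB n) :=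
  (partialWeight ℂ (n + 1) T k)⁻¹ • ∑ S ∈ agreeing T k, tableauIdem hξ hξ' S

theorem phi_mul_baseChange_tableauIdem {K : Type} [Field K] [CharZero K] [Algebra ℂ K]
    (hξ : ∀ k, ξ k ^ 2 = 1) (hξ' : Function.Injective ξ)
    (T : StandardTableau (n + 1)) (u : Fin (n + 1) → K) {u' : K}
    (hu' : ∀ z : ℤ, u' ≠ z) (r : Fin (n + 1))
    (hu : ∀ a < r, u a = cont (T.seq a)) {S : StandardTableau (n + 1)}
    (hS : S ∈ agreeing T r) :
    phi (T.pos ξ) u (T.pos ξ r) u' r * baseChange K n (tableauIdem hξ hξ' S) =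
      (if (S.seq r).1 = (T.seq r).1 then
        contFun K (n + 1) (T.rows r (T.seq r).1) u' / (u' - cont (S.seq r)) else 0) •
        baseChange K n (tableauIdem hξ hξ' S) := by
  apply seminormalExt_injective (K := K) hξ hξ'
  rw [map_mul, map_smul, seminormalExt_tableauIdem]
  apply end_ext
  intro R
  rw [Module.End.mul_apply, LinearMap.smul_apply, diagOp_vec, map_smul, smul_comm]
  by_cases hR : R = S
  · subst hR
    congr 1
    exact seminormalExt_phi_vec hξ hξ' T u (T.seq r).1 hu' r hu (mem_agreeing.1 hS)
  · rw [Pi.single_eq_of_ne hR, zero_smul, zero_smul]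

/-- The arguments of the function `Φ` after the first `k` evaluations. -/
noncomputable def evaluatedVar (T : StandardTableau (n + 1)) (k : ℕ) (i : Fin (n + 1)) :
    RatFun (n + 1) :=
  if (i : ℕ) < k then (cont (T.seq i) : RatFun (n + 1)) else uvar i

theorem evaluatedVar_of_lt {T : StandardTableau (n + 1)} {k : ℕ} {i : Fin (n + 1)}
    (h : (i : ℕ) < k) : evaluatedVar T k i = cont (T.seq i) := if_pos h

theorem evaluatedVar_of_le {T : StandardTableau (n + 1)} {k : ℕ} {i : Fin (n + 1)}
    (h : k ≤ i) : evaluatedVar T k i = uvar i := if_neg (not_lt.2 h)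

theorem isEvalAt_evaluatedVar (T : StandardTableau (n + 1)) (k i : Fin (n + 1)) :
    IsEvalAt k (T.content k) (evaluatedVar T k i) (evaluatedVar T (k + 1) i) := by
  rcases lt_trichotomy i k with h | rfl | h
  · rw [evaluatedVar_of_lt h, evaluatedVar_of_lt (Nat.lt_succ_of_lt h)]
    exact IsEvalAt.intCast _
  · rw [evaluatedVar_of_le le_rfl, evaluatedVar_of_lt (Nat.lt_succ_self _)]
    have := IsEvalAt.uvar_self (k := i) (c := T.content i)
    rwa [content_eq, map_intCast, ← content_eq] at this
  · rw [evaluatedVar_of_le h.le, evaluatedVar_of_le (Nat.succ_le_of_lt h)]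
    exact IsEvalAt.uvar_of_ne h.ne'

/-- The factors of the function `Φ` after the first `k` evaluations. -/
noncomputable def evaluatedPhi (ξ : Fin 2 → ℂ) (T : StandardTableau (n + 1)) (k : ℕ)
    (j : Fin (n + 1)) : MonoidAlgebra (RatFun (n + 1)) (GroupB n) :=
  phi (T.pos ξ) (evaluatedVar T k) (T.pos ξ j) (evaluatedVar T k j) j

/-- A factor to the left of the current one still has a free last variable, which equals neither a
number nor another variable; hence it is regular. -/
theorem evaluatedPhi_mem_evalAlgebra (T : StandardTableau (n + 1)) {k j : Fin (n + 1)}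
    (h : k < j) : (evaluatedPhi ξ T k j, evaluatedPhi ξ T (k + 1) j) ∈
      evalAlgebra (GroupB n) k (T.content k) := by
  refine phi_mem_evalAlgebra _ _ (isEvalAt_evaluatedVar T k j) j fun i hi =>
    ⟨isEvalAt_evaluatedVar T k i, ?_⟩
  rw [evaluatedVar_of_le (Nat.succ_le_of_lt h)]
  unfold evaluatedVar
  split_ifs
  · exact uvar_ne_intCast _ _
  · exact uvar_ne_uvar hi.ne'

/-- One step of the fusion procedure. -/
theorem evaluatedPhi_mul_partialIdem (hξ : ∀ k, ξ k ^ 2 = 1) (hξ' : Function.Injective ξ)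
    (T : StandardTableau (n + 1)) (k : Fin (n + 1)) :
    (evaluatedPhi ξ T k k * baseChange (RatFun (n + 1)) n (partialIdem hξ hξ' T k),
      baseChange (RatFun (n + 1)) n (partialIdem hξ hξ' T (k + 1))) ∈
        evalAlgebra (GroupB n) k (T.content k) := by
  have hk : ((T.seq k).2.1 : ℕ) ≤ n + 1 := (T.row_le k).trans k.2.le
  have hcont : cont (T.seq k) = beta (T.rows k (T.seq k).1) (T.seq k).2.1 := by
    rw [beta, ← T.col_eq_rows]
    rfl
  -- The factor of index k may have a pole of its own, so only its action on each idempotent is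
  -- evaluated. The scalar is regular, and it vanishes at the content unless the node of `S` at k is
  -- that of `T`.
  have hterm : ∀ S ∈ agreeing T k,
      ((algebraMap ℂ (RatFun (n + 1)) (partialWeight ℂ (n + 1) T k)⁻¹ *
        if (S.seq k).1 = (T.seq k).1 then contFun (RatFun (n + 1)) (n + 1)
          (T.rows k (T.seq k).1) (uvar k) / (uvar k - cont (S.seq k)) else 0) •
          baseChange (RatFun (n + 1)) n (tableauIdem hξ hξ' S),
        algebraMap ℂ (RatFun (n + 1)) (if S.seq k = T.seq k then
          (partialWeight ℂ (n + 1) T (k + 1))⁻¹ else 0) •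
          baseChange (RatFun (n + 1)) n (tableauIdem hξ hξ' S)) ∈
        evalAlgebra (GroupB n) k (T.content k) := by
    intro S hS
    refine smul_mem_evalAlgebra ?_ (baseChange_mem_evalAlgebra _)
    by_cases h : (S.seq k).1 = (T.seq k).1
    · have hS' : cont (S.seq k) = beta (T.rows k (T.seq k).1) (S.seq k).2.1 := by
        rw [beta, ← rows_congr (mem_agreeing.1 hS), ← h, ← S.col_eq_rows]
        rfl
      have hiff : S.seq k = T.seq k ↔ (S.seq k).2.1 = (T.seq k).2.1 := by
        refine ⟨fun h => by rw [h], fun h' => Prod.ext h (Prod.ext h' ?_)⟩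
        rw [S.col_eq_rows, T.col_eq_rows, h, h', rows_congr (mem_agreeing.1 hS)]
      have := (IsEvalAt.const (k := k) (c := T.content k)
        (partialWeight ℂ (n + 1) T k)⁻¹).mul (content_eq T k ▸ hcont ▸ isEvalAt_contFun_div k (n + 1)
          (T.rows k (T.seq k).1) (T.rows_antitone k _) ((S.row_le k).trans k.2.le) hk
          fun j hj => T.rows_lt_of_lt k hj)
      rw [if_pos h, hS']
      convert this using 1
      rw [← map_mul]
      congr 1
      by_cases h' : (S.seq k).2.1 = (T.seq k).2.1
      · rw [if_pos (hiff.2 h'), if_pos h', partialWeight_succ le_rfl, mul_inv]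
      · rw [if_neg fun h => h' (hiff.1 h), if_neg h', mul_zero]
    · rw [if_neg h, if_neg fun h' => h (by rw [h']), mul_zero, map_zero]
      exact IsEvalAt.zero
  have := sum_mem_evalAlgebra _ hterm
  convert this using 2
  · rw [partialIdem, baseChange_smul, map_sum, mul_smul_comm, mul_sum, smul_sum]
    refine sum_congr rfl fun S hS => ?_
    rw [mul_smul]
    congr 1
    rw [evaluatedPhi, evaluatedVar_of_le le_rfl]
    exact phi_mul_baseChange_tableauIdem hξ hξ' T _ (uvar_ne_intCast k) k
      (fun a ha => evaluatedVar_of_lt ha) hS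
  · rw [partialIdem, baseChange_smul, map_sum, agreeing_succ, sum_filter, smul_sum]
    refine sum_congr rfl fun S _ => ?_
    split_ifs
    · rfl
    · rw [smul_zero, map_zero, zero_smul]

/-- After k evaluations the remaining left factors multiply `partialIdem` at k, which has absorbed
the k rightmost factors of Φ. It starts as 1, since the idempotents sum to 1 and the empty tableau
has weight 1. -/
theorem isConsecutiveEval_Phi (hξ : ∀ k, ξ k ^ 2 = 1) (hξ' : Function.Injective ξ)
    (T : StandardTableau (n + 1)) :
    IsConsecutiveEval (Phi (T.pos ξ) uvar) T.content (partialIdem hξ hξ' T (n + 1)) := by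
  refine ⟨fun k => ((List.ofFn (evaluatedPhi ξ T k)).drop k).reverse.prod *
    baseChange (RatFun (n + 1)) n (partialIdem hξ hξ' T k), ?_, ?_, ?_⟩
  · have h0 : evaluatedVar T 0 = uvar := funext fun i => evaluatedVar_of_le (Nat.zero_le _)
    have h1 : evaluatedPhi ξ T 0 = fun j => phi (T.pos ξ) uvar (T.pos ξ j) (uvar j) j := by
      funext j
      rw [evaluatedPhi, h0]
    simp only [Fin.val_zero, List.drop_zero, partialIdem, partialWeight_zero, agreeing_zero,
      sum_tableauIdem, inv_one, one_smul, map_one, mul_one, h1]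
    rfl
  · intro k g
    apply isEvalAt_coeff
    have hlen : (k : ℕ) < (List.ofFn (evaluatedPhi ξ T k)).length := by
      rw [List.length_ofFn]
      exact k.2
    simp only [Fin.val_castSucc, Fin.val_succ]
    rw [List.drop_eq_getElem_cons hlen, List.reverse_cons, List.prod_append, List.prod_singleton,
      List.getElem_ofFn, mul_assoc]
    refine mul_mem_evalAlgebra (reverse_prod_mem_evalAlgebra (List.forall₂_iff_get.2
      ⟨by rw [List.length_drop, List.length_drop, List.length_ofFn, List.length_ofFn], ?_⟩))
      (evaluatedPhi_mul_partialIdem hξ hξ' T k)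
    intro i h1 h2
    simp only [List.get_eq_getElem, List.getElem_drop, List.getElem_ofFn]
    exact evaluatedPhi_mem_evalAlgebra T (Fin.lt_def.2 (by simp only []; omega))
  · intro g
    beta_reduce
    rw [Fin.val_last, List.drop_eq_nil_of_le (by simp), List.reverse_nil, List.prod_nil, one_mul,
      MonoidAlgebra.coeff_mapRingHom]

theorem hookFactor_eq (T : StandardTableau (n + 1)) : hookFactor T.shape = weight ℂ T := by
  rw [hookFactor, weight, prod_inv_distrib]

theorem hookFactor_ne_zero (T : StandardTableau (n + 1)) : hookFactor T.shape ≠ 0 := by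
  refine inv_ne_zero (prod_ne_zero_iff.2 fun κ _ => prod_ne_zero_iff.2 fun α hα =>
    Nat.cast_ne_zero.2 (card_ne_zero_of_mem (a := α) ?_))
  simpa using hα

theorem hookFactor_smul_partialIdem (hξ : ∀ k, ξ k ^ 2 = 1) (hξ' : Function.Injective ξ)
    (T : StandardTableau (n + 1)) :
    hookFactor T.shape • partialIdem hξ hξ' T (n + 1) = tableauIdem hξ hξ' T := by
  rw [partialIdem, agreeing_last, sum_singleton, ← weight_eq_partialWeight le_rfl, ← hookFactor_eq,
    smul_inv_smul₀ (hookFactor_ne_zero T)]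

end Fusion

end FusionB

theorem theorem1 (n : ℕ) (ξ : Fin 2 → ℂ) (hξ : ∀ k, ξ k ^ 2 = 1) (hξ' : Function.Injective ξ)
    (T : FusionB.StandardTableau (n + 1)) :
    (∃! E : MonoidAlgebra ℂ (FusionB.GroupB n), FusionB.IsTableauIdempotent ξ T E) ∧
    (∀ E : MonoidAlgebra ℂ (FusionB.GroupB n), FusionB.IsTableauIdempotent ξ T E →
      FusionB.IsPrimitiveIdempotent E ∧
      ∃ Y : MonoidAlgebra ℂ (FusionB.GroupB n),
        FusionB.IsConsecutiveEval (FusionB.Phi (T.pos ξ) FusionB.uvar) T.content Y ∧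
        E = FusionB.hookFactor T.shape • Y) ∧
    ∀ v : Fin (n + 1) → ℂ,
      FusionB.IsBaxterizedLongestWord v (FusionB.Phi v FusionB.uvar) := by
  simp only [FusionB.isTableauIdempotent_iff hξ hξ', existsUnique_eq, forall_eq, true_and]
  exact ⟨⟨FusionB.isPrimitiveIdempotent_tableauIdem hξ hξ' T, _,
    FusionB.isConsecutiveEval_Phi hξ hξ' T, (FusionB.hookFactor_smul_partialIdem hξ hξ' T).symm⟩,
    FusionB.isBaxterizedLongestWord_Phi⟩
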